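/- **Setting.** Let $X=L^2(0,\pi)$ (real), $A=-\partial^2/\partial x^2$ with $D(A)=H^2(0,\pi)\cap H^1_0(0,\pi)$, $\varphi_k=\sqrt{2/\pi}\,\sin kx$ ($k\ge 1$), and for $\alpha\ge 0$ let $X^\alpha=D(A^\alpha)$ with the norm $\|u\|_\alpha=\|A^\alpha u\|=\big(\sum_{k\ge1}k^{4\alpha}\langle\varphi_k,u\rangle^2\big)^{1/2}$. A sequence $(x_k)_{k\in\mathbb Z}$ in a normed space is *almost periodic* if for every $\varepsilon>0$ the set of integers $q$ with $\|x_{k+q}-x_k\|<\varepsilon$ for all $k$ is relatively dense. A real sequence $(\tau_k)_{k\in\mathbb Z}$ has *uniformly almost periodic sequences of differences* if for every $\varepsilon>0$ the set of integers $q$ that are $\varepsilon$-almost periods of all the sequences $k\mapsto\tau_{k+j}-\tau_k$, $j\in\mathbb Z$, simultaneously is relatively dense. Let $(\tau_k)$ be strictly increasing. A function $\varphi$ from $\mathbb R$ to a normed space is *W-almost periodic* (with respect to $(\tau_k)$) if: (i) $(\tau_k)$ has uniformly almost periodic sequences of differences, $\varphi$ is continuous off $\{\tau_k\}$, and at each $\tau_k$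 it is right-continuous with a left limit; (ii) for every $\varepsilon>0$ there is $\delta>0$ such that $\|\varphi(t')-\varphi(t'')\|<\varepsilon$ whenever $t',t''$ lie in the same interval $[\tau_k,\tau_{k+1})$ and $|t'-t''|<\delta$; (iii) for every $\varepsilon>0$ there is a relatively dense set of reals $r$ such that $\|\varphi(t+r)-\varphi(t)\|<\varepsilon$ for all $t$ with $|t-\tau_k|\ge\varepsilon$ for all $k$. (A continuous Bohr almost periodic function is W-almost periodic with respect to any such sequence.) **Equation.** Consider $$u_t=u_{xx}+f(t,x)\quad(t\ne\tau_j),\qquad u(t,0)=u(t,\pi)=0,$$ $$u(\tau_j,x)-u(\tau_j-0,x)=b_j\,\sin x\;u_x(\tau_j-0,x)+c_j\,x(\pi-x),\qquad j\in\mathbb Z,$$ where $(\tau_j)$ has uniformly almost periodic sequences of differences, $\tau_{j+1}-\tau_j\ge\frac12$ for all $j$, $(b_j)$ and $(c_j)$ are almost periodic real sequences, and $f:\mathbb R\to L^2(0,\pi)$ is W-almost periodic with respect to $(\tau_j)$ and locally Hölder continuous on $\mathbb R\setminus\{\tau_j\}$. For $0\le\alpha<\frac12$, a *solution* in $X^\alpha$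 on $J=\mathbb R$ or $J=[t_0,\infty)$ is a function $u:J\to X^\alpha$ which is right-continuous in $X^\alpha$; is continuous in $X^\alpha$ and continuously differentiable as an $L^2(0,\pi)$-valued function at interior points $t\ne\tau_j$ of $J$, with $u(t)\in H^2(0,\pi)\cap H^1_0(0,\pi)$ and $u_t=u_{xx}+f(t)$ in $L^2(0,\pi)$ there; and has, at every $\tau_j$ in the interior of $J$, a left limit $u(\tau_j-0)$ in $X^\alpha$ that belongs to $H^1_0(0,\pi)$ and satisfies the impulse condition almost everywhere on $(0,\pi)$. **Theorem.** Let $i(s,t)$ be the number of $k$ with $\tau_k\in(s,t)$. The limit $$p=\lim_{T\to\infty}\frac{i(t,t+T)}{T}$$ exists uniformly in $t\in\mathbb R$. Let $b=\sup_j|b_j|$. If $p\ln(1+b)<1$, then for every $\alpha\in[0,\frac12)$ there is exactly one solution $u_0:\mathbb R\to X^\alpha$ that is W-almost periodic in $X^\alpha$ with respect to $(\tau_j)$, and it is asymptotically stable. The latter means the following, where $u$ denotes solutions in $X^\alpha$ on $[t_0,\infty)$. * *Stability:* for all $t_0\in\mathbb R$ and $\varepsilon>0$ there is $\delta>0$ such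 that $\|u(t_0)-u_0(t_0)\|_\alpha<\delta$ implies $\|u(t)-u_0(t)\|_\alpha<\varepsilon$ for all $t\ge t_0$; moreover, for all $\varepsilon,\eta>0$ there is $\delta>0$, independent of $t_0$, such that $\|u(t_0)-u_0(t_0)\|_\alpha<\delta$ implies $\|u(t)-u_0(t)\|_\alpha<\varepsilon$ for all $t\ge t_0$ with $|t-\tau_j|>\eta$ for all $j$. * *Attractivity:* for every $t_0$ there is $\delta_0>0$ such that for every $\varepsilon>0$ there is $T>0$ such that $\|u(t_0)-u_0(t_0)\|_{L^2(0,\pi)}<\delta_0$ implies $\|u(t)-u_0(t)\|_\alpha<\varepsilon$ for all $t\ge t_0+T$. -/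

import Mathlib

open Real Set Filter Topology MeasureTheory
open scoped NNReal ContDiff

noncomputable section

/-! ### Almost periodicity and impulse moments -/

/-- Almost periodic two-sided sequences: for every `ε > 0` the `ε`-almost periods
form a relatively dense set of integers. -/
def IsAlmostPeriodicSeq {E : Type*} [SeminormedAddCommGroup E] (x : ℤ → E) : Prop :=
  ∀ ε : ℝ, 0 < ε → ∃ L : ℤ, ∀ a : ℤ, ∃ q ∈ Icc a (a + L), ∀ k : ℤ, ‖x (k + q) - x k‖ < ε

/-- `τ` has uniformly almost periodic sequences of differences: for every `ε > 0` the common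
`ε`-almost periods of all sequences `k ↦ τ (k + j) - τ k`, `j ∈ ℤ`, are relatively dense. -/
def HasUniformlyAPDifferences (τ : ℤ → ℝ) : Prop :=
  ∀ ε : ℝ, 0 < ε → ∃ L : ℤ, ∀ a : ℤ, ∃ q ∈ Icc a (a + L), ∀ j k : ℤ,
    |(τ (k + q + j) - τ (k + q)) - (τ (k + j) - τ k)| < ε

/-- The number of points `τ k` in the open interval `(s, t)`. -/
def impulseCount (τ : ℤ → ℝ) (s t : ℝ) : ℕ := {k : ℤ | τ k ∈ Ioo s t}.ncard

/-- `p` is the density of `τ`: `i(t, t + T) / T → p` as `T → ∞`, uniformly in `t ∈ ℝ`. -/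
def HasDensity (τ : ℤ → ℝ) (p : ℝ) : Prop :=
  TendstoUniformly (fun (T : ℝ) (t : ℝ) => (impulseCount τ t (t + T) : ℝ) / T)
    (fun _ => p) atTop

/-- Right-continuous W-almost periodic functions whose discontinuities lie in the strictly
increasing sequence `τ`. -/
structure IsWAlmostPeriodic {E : Type*} [SeminormedAddCommGroup E]
    (τ : ℤ → ℝ) (φ : ℝ → E) : Prop where
  strictMono : StrictMono τ
  differences : HasUniformlyAPDifferences τ
  continuousAt : ∀ t : ℝ, t ∉ range τ → ContinuousAt φ t
  right_continuous : ∀ j : ℤ, ContinuousWithinAt φ (Ici (τ j)) (τ j)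
  left_limit : ∀ j : ℤ, ∃ v : E, Tendsto φ (𝓝[<] (τ j)) (𝓝 v)
  uniform : ∀ ε : ℝ, 0 < ε → ∃ δ : ℝ, 0 < δ ∧ ∀ j : ℤ,
    ∀ t ∈ Ico (τ j) (τ (j + 1)), ∀ s ∈ Ico (τ j) (τ (j + 1)), |t - s| < δ → ‖φ t - φ s‖ < ε
  almost_periods : ∀ ε : ℝ, 0 < ε → ∃ L : ℝ, ∀ a : ℝ, ∃ r ∈ Icc a (a + L),
    ∀ t : ℝ, (∀ k : ℤ, ε ≤ |t - τ k|) → ‖φ (t + r) - φ t‖ < ε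

/-- Local Hölder continuity away from the points `τ k`; constant and (positive) exponent may
depend on the place. -/
def IsLocallyHolderOff {E : Type*} [SeminormedAddCommGroup E] (τ : ℤ → ℝ) (f : ℝ → E) : Prop :=
  ∀ t : ℝ, t ∉ range τ → ∃ C r : ℝ≥0, 0 < r ∧ ∃ U ∈ 𝓝 t, HolderOnWith C r f U

/-! ### The space `X = L²(0, π)` and the spaces `X^α` -/

/-- Lebesgue measure on `(0, π)`. -/
abbrev muPi : Measure ℝ := volume.restrict (Ioo 0 π)

/-- `L²(0, π)`. -/
abbrev L2Pi : Type := Lp ℝ 2 muPi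

theorem memLp_sineFun (k : ℕ) :
    MemLp (fun x : ℝ => √(2 / π) * sin (((k : ℝ) + 1) * x)) 2 muPi := by
  refine MemLp.of_bound (C := √(2 / π)) ?_ (Eventually.of_forall fun x => ?_)
  · exact (by fun_prop : Continuous fun x : ℝ => √(2 / π) * sin (((k : ℝ) + 1) * x)).aestronglyMeasurable
  · rw [norm_mul, Real.norm_eq_abs, Real.norm_eq_abs, abs_of_nonneg (Real.sqrt_nonneg _)]
    exact mul_le_of_le_one_right (Real.sqrt_nonneg _) (abs_sin_le_one _)

/-- The normalised eigenfunction `√(2/π) sin ((k + 1) x)` of `A = -∂²/∂x²` with Dirichlet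
conditions; its eigenvalue is `(k + 1)²`. -/
def sineFun (k : ℕ) : L2Pi := (memLp_sineFun k).toLp _

/-- The coefficients of `A^α u` in the eigenbasis. -/
def powCoeff (α : ℝ) (u : L2Pi) (k : ℕ) : ℝ := ((k : ℝ) + 1) ^ (2 * α) * inner ℝ (sineFun k) u

/-- The domain of `A^α` as a subspace of `L²(0, π)`. -/
def fracDomain (α : ℝ) : Submodule ℝ L2Pi where
  carrier := {u | Memℓp (powCoeff α u) 2}
  zero_mem' := by
    have h : powCoeff α 0 = 0 := by
      funext k
      simp [powCoeff]
    change Memℓp (powCoeff α 0) 2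
    rw [h]
    exact zero_memℓp
  add_mem' := by
    intro u v hu hv
    have h : powCoeff α (u + v) = powCoeff α u + powCoeff α v := by
      funext k
      simp [powCoeff, inner_add_right, mul_add]
    change Memℓp (powCoeff α (u + v)) 2
    rw [h]
    exact Memℓp.add hu hv
  smul_mem' := by
    intro c u hu
    have h : powCoeff α (c • u) = c • powCoeff α u := by
      funext k
      simp [powCoeff, inner_smul_right]
      ring
    change Memℓp (powCoeff α (c • u)) 2
    rw [h]
    exact Memℓp.const_smul hu c

/-- The space `X^α = D(A^α)`. It is a separate type because its norm is `‖A^α u‖`, not the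
norm of `L²(0, π)`. -/
def FracSpace (α : ℝ) : Type := fracDomain α

instance (α : ℝ) : AddCommGroup (FracSpace α) := inferInstanceAs (AddCommGroup (fracDomain α))

/-- The inclusion `X^α ⊆ L²(0, π)`. -/
def FracSpace.toL2 {α : ℝ} : FracSpace α →+ L2Pi := (fracDomain α).subtype.toAddMonoidHom

/-- `A^α` on `X^α`, with `L²(0, π)` written in the eigenbasis as `ℓ²`. -/
def FracSpace.pow {α : ℝ} : FracSpace α →+ lp (fun _ : ℕ => ℝ) 2 where
  toFun u := ⟨powCoeff α (FracSpace.toL2 u), Subtype.property (p := (· ∈ fracDomain α)) u⟩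
  map_zero' := by
    ext k
    simp [powCoeff]
  map_add' u v := by
    ext k
    simp only [powCoeff, map_add, inner_add_right, mul_add]
    rfl

/-- `‖u‖_α = ‖A^α u‖ = (∑ (k + 1)^{4α} ⟨φ_k, u⟩²)^{1/2}`, where `φ_k = sineFun k`. This is a norm, since the `φ_k` are
complete in `L²(0, π)`; the instance records only the seminorm axioms. -/
instance (α : ℝ) : SeminormedAddCommGroup (FracSpace α) :=
  SeminormedAddCommGroup.induced (FracSpace α) (lp (fun _ : ℕ => ℝ) 2) FracSpace.pow

/-! ### The impulsive heat equation -/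

/-- `v` is the weak derivative of `u` on `(0, π)`. -/
def IsWeakDeriv (u v : L2Pi) : Prop :=
  ∀ φ : ℝ → ℝ, ContDiff ℝ ∞ φ → HasCompactSupport φ → tsupport φ ⊆ Ioo 0 π →
    ∫ x in Ioo 0 π, u x * deriv φ x = - ∫ x in Ioo 0 π, v x * φ x

/-- The boundary conditions `u(0) = u(π) = 0`, for the continuous representative of `u`. -/
def VanishesAtEnds (u : L2Pi) : Prop :=
  ∃ U : ℝ → ℝ, ContinuousOn U (Icc 0 π) ∧ U 0 = 0 ∧ U π = 0 ∧ ∀ᵐ x ∂muPi, u x = U x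

/-- At time `t` the curve `u` lies in `H²(0, π) ∩ H¹₀(0, π)`, is differentiable in `L²(0, π)`, and
`u_t = u_xx + f(t, ·)`. -/
def SatisfiesHeatAt (f u : ℝ → L2Pi) (t : ℝ) : Prop :=
  ∃ v w : L2Pi, VanishesAtEnds (u t) ∧ IsWeakDeriv (u t) v ∧ IsWeakDeriv v w ∧
    HasDerivAt u (w + f t) t

/-- `y` is the state after an impulse applied to the state `v ∈ H¹₀(0, π)`:
`y - v = b (sin x) v_x + c x (π - x)`. -/
def IsImpulse (b c : ℝ) (v y : L2Pi) : Prop :=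
  VanishesAtEnds v ∧ ∃ v' : L2Pi, IsWeakDeriv v v' ∧
    ∀ᵐ x ∂muPi, y x - v x = b * (sin x * v' x) + c * (x * (π - x))

/-- `u` solves, on the interval `J` (below `J` is `ℝ` or `[t₀, ∞)`), the heat equation
`u_t = u_xx + f` with Dirichlet conditions between the moments `τ j` and the impulse conditions
`u(τ j) - u(τ j - 0) = b j (sin x) u_x(τ j - 0) + c j x (π - x)` at the moments `τ j` inside `J`.
It is an `X^α`-valued function, right-continuous with left limits, and continuously
differentiable in `L²(0, π)` between the impulses. -/
structure IsImpulsiveSolution (τ b c : ℤ → ℝ) (f : ℝ → L2Pi) {α : ℝ} (J : Set ℝ)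
    (u : ℝ → FracSpace α) : Prop where
  right_continuous : ∀ t ∈ J, ContinuousWithinAt u (Ici t) t
  continuousAt : ∀ t ∈ interior J, t ∉ range τ → ContinuousAt u t
  equation : ∀ t ∈ interior J, t ∉ range τ → SatisfiesHeatAt f (fun s => (u s).toL2) t
  deriv_continuousAt : ∀ t ∈ interior J, t ∉ range τ →
    ContinuousAt (deriv fun s => (u s).toL2) t
  impulse : ∀ j : ℤ, τ j ∈ interior J → ∃ v : FracSpace α,
    Tendsto u (𝓝[<] (τ j)) (𝓝 v) ∧ IsImpulse (b j) (c j) v.toL2 (u (τ j)).toL2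

/-- Asymptotic stability in `X^α` of a solution `u₀`: it is Lyapunov stable and attractive.
For a given initial moment `t₀` stability holds at all later times; if neighbourhoods of the
impulse moments are left out, `δ` does not depend on `t₀`. -/
structure IsAsymptoticallyStable (τ b c : ℤ → ℝ) (f : ℝ → L2Pi) {α : ℝ}
    (u₀ : ℝ → FracSpace α) : Prop where
  stable : ∀ t₀ ε : ℝ, 0 < ε → ∃ δ : ℝ, 0 < δ ∧ ∀ u : ℝ → FracSpace α,
    IsImpulsiveSolution τ b c f (Ici t₀) u → ‖u t₀ - u₀ t₀‖ < δ →
      ∀ t : ℝ, t₀ ≤ t → ‖u t - u₀ t‖ < ε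
  uniformly_stable : ∀ ε η : ℝ, 0 < ε → 0 < η → ∃ δ : ℝ, 0 < δ ∧
    ∀ (t₀ : ℝ) (u : ℝ → FracSpace α),
    IsImpulsiveSolution τ b c f (Ici t₀) u → ‖u t₀ - u₀ t₀‖ < δ →
      ∀ t : ℝ, t₀ ≤ t → (∀ j : ℤ, η < |t - τ j|) → ‖u t - u₀ t‖ < ε
  attractive : ∀ t₀ : ℝ, ∃ δ₀ : ℝ, 0 < δ₀ ∧ ∀ ε : ℝ, 0 < ε → ∃ T : ℝ, 0 < T ∧
    ∀ u : ℝ → FracSpace α,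
    IsImpulsiveSolution τ b c f (Ici t₀) u → ‖(u t₀).toL2 - (u₀ t₀).toL2‖ < δ₀ →
      ∀ t : ℝ, t₀ + T ≤ t → ‖u t - u₀ t‖ < ε

end

noncomputable section
namespace ImpulsiveHeat

open scoped ENNReal

/-! In the sine basis the heat flow is diagonal and the impulse is a tridiagonal map plus a fixed
vector, so all estimates are made on coefficient sequences in the weighted ℓ² norms `wnorm`. Since
|sin x| ≤ 1, the map v ↦ (sin x) v_x from X^{1/2} to L² has norm at most 1
(`wnorm_zero_sinDeriv_le`). For t ≥ 1/2 the heat flow maps L² into X^{1/2} with norm at most e^{-t}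
(`wnorm_half_heat_le`). Hence the passage from one post-impulse state to the next is an affine map
of L² with Lipschitz constant (1 + b) e^{-(τ_{j+1} - τ_j)}.

A single such constant may exceed 1. However, the almost periodicity of the differences gives a mean
gap a = 1/p with bounded discrepancy, |τ_{k+n} - τ_k - a n| ≤ C (`exists_mean_gap`). So the weights
exp(τ_j - τ_0 - a j) stay between positive constants, and in the weighted norms every step contracts
by (1 + b) e^{-a}, which is below 1 exactly when p ln(1 + b) < 1. Banach's fixed point theorem
yields a bounded two-sided sequence of states (`exists_bounded_recurrence`), and u₀ is the mild
solution through them. The state before an impulse lies in X^σ for all σ < 1 and the impulse costs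
the power 1/2, whence α < 1/2. Hölder continuity of f makes the mild solution classical
(`satisfiesHeat_of_arc`).

A pigeonhole argument produces common almost periods of τ, b, c and f
(`exists_common_almost_periods`). The shifted states satisfy almost the same contractive recurrence,
so they stay close to the original ones, and away from the impulses the heat flow turns closeness in
L² into closeness in X^α.

The difference of two solutions solves the homogeneous problem, which decays geometrically in the
number of impulses. This gives uniqueness (start ever further in the past) and stability. A bound
uniform in t₀ needs care when t₀ lies just before an impulse. There the impulse is viewed as a map
from L² to X^{-1/2}, and the regularity is recovered afterwards (`wnorm_heat_impulse_le`). -/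

/-- The coefficient of `u` with respect to the sine function of frequency `k + 1`. -/
def sineCoeff (u : L2Pi) (k : ℕ) : ℝ := inner ℝ (sineFun k) u

/-! ### Pairings on (0, π) as integrals -/

theorem integral_muPi (g : ℝ → ℝ) : ∫ x, g x ∂muPi = ∫ x in (0 : ℝ)..π, g x := by
  rw [intervalIntegral.integral_of_le pi_pos.le, integral_Ioc_eq_integral_Ioo]

theorem inner_toLp (u : L2Pi) {g : ℝ → ℝ} (hg : MemLp g 2 muPi) :
    inner ℝ (hg.toLp g) u = ∫ x, u x * g x ∂muPi := by
  rw [L2.inner_def]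
  refine integral_congr_ae ?_
  filter_upwards [hg.coeFn_toLp] with x hx
  simp [hx]

theorem memLp_muPi_of_continuous {g : ℝ → ℝ} (hg : Continuous g) : MemLp g 2 muPi := by
  obtain ⟨C, hC⟩ := isCompact_Icc.exists_bound_of_continuousOn (s := Icc 0 π) hg.continuousOn
  refine MemLp.of_bound hg.aestronglyMeasurable C ?_
  filter_upwards [ae_restrict_mem measurableSet_Ioo] with x hx
  exact hC x (Ioo_subset_Icc_self hx)

theorem sineCoeff_eq (u : L2Pi) (k : ℕ) :
    sineCoeff u k = ∫ x, u x * (√(2 / π) * sin (((k : ℝ) + 1) * x)) ∂muPi :=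
  inner_toLp u (memLp_sineFun k)

theorem integrable_mul_continuous (u : L2Pi) {g : ℝ → ℝ} (hg : Continuous g) :
    Integrable (fun x => u x * g x) muPi :=
  (Lp.memLp u).integrable_mul (memLp_muPi_of_continuous hg)

/-! ### The sine functions form a Hilbert basis -/

theorem integral_cos_int_mul (n : ℤ) (hn : n ≠ 0) : ∫ x in (0 : ℝ)..π, cos (n * x) = 0 := by
  have hn' : (n : ℝ) ≠ 0 := by exact_mod_cast hn
  rw [intervalIntegral.integral_comp_mul_left (fun x => cos x) hn', integral_cos]
  simp [sin_int_mul_pi]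

theorem integral_sin_mul_sin (i j : ℕ) :
    ∫ x in (0 : ℝ)..π, sin (((i : ℝ) + 1) * x) * sin (((j : ℝ) + 1) * x) =
      if i = j then π / 2 else 0 := by
  have h : ∀ x : ℝ, sin (((i : ℝ) + 1) * x) * sin (((j : ℝ) + 1) * x) =
      (cos (((i - j : ℤ) : ℝ) * x) - cos (((i + j + 2 : ℤ) : ℝ) * x)) / 2 := by
    intro x
    have h1 : ((i - j : ℤ) : ℝ) * x = ((i : ℝ) + 1) * x - ((j : ℝ) + 1) * x := by push_cast; ring
    have h2 : ((i + j + 2 : ℤ) : ℝ) * x = ((i : ℝ) + 1) * x + ((j : ℝ) + 1) * x := by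
      push_cast; ring
    rw [h1, h2, cos_sub, cos_add]; ring
  simp_rw [h]
  rw [intervalIntegral.integral_div, intervalIntegral.integral_sub
    (Continuous.intervalIntegrable (by fun_prop) _ _)
    (Continuous.intervalIntegrable (by fun_prop) _ _),
    integral_cos_int_mul (i + j + 2) (by omega)]
  split_ifs with hij
  · subst hij; simp
  · rw [integral_cos_int_mul _ (by omega)]; simp

theorem integral_cos_mul_cos (i j : ℕ) :
    ∫ x in (0 : ℝ)..π, cos (((i : ℝ) + 1) * x) * cos (((j : ℝ) + 1) * x) =
      if i = j then π / 2 else 0 := by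
  have h : ∀ x : ℝ, cos (((i : ℝ) + 1) * x) * cos (((j : ℝ) + 1) * x) =
      (cos (((i - j : ℤ) : ℝ) * x) + cos (((i + j + 2 : ℤ) : ℝ) * x)) / 2 := by
    intro x
    have h1 : ((i - j : ℤ) : ℝ) * x = ((i : ℝ) + 1) * x - ((j : ℝ) + 1) * x := by push_cast; ring
    have h2 : ((i + j + 2 : ℤ) : ℝ) * x = ((i : ℝ) + 1) * x + ((j : ℝ) + 1) * x := by
      push_cast; ring
    rw [h1, h2, cos_sub, cos_add]; ring
  simp_rw [h]
  rw [intervalIntegral.integral_div, intervalIntegral.integral_add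
    (Continuous.intervalIntegrable (by fun_prop) _ _)
    (Continuous.intervalIntegrable (by fun_prop) _ _),
    integral_cos_int_mul (i + j + 2) (by omega)]
  split_ifs with hij
  · subst hij; simp
  · rw [integral_cos_int_mul _ (by omega)]; simp

theorem continuous_sineMode (k : ℕ) :
    Continuous fun x : ℝ => √(2 / π) * sin (((k : ℝ) + 1) * x) := by fun_prop

theorem continuous_cosMode (k : ℕ) :
    Continuous fun x : ℝ => √(2 / π) * cos (((k : ℝ) + 1) * x) := by fun_prop

/-- The normalised cosine function of frequency `k + 1`. -/
def cosFun (k : ℕ) : L2Pi := (memLp_muPi_of_continuous (continuous_cosMode k)).toLp _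

theorem sqrt_two_div_pi_mul_self : √(2 / π) * √(2 / π) * (π / 2) = 1 := by
  rw [Real.mul_self_sqrt (by positivity)]
  field_simp

theorem orthonormal_sineFun : Orthonormal ℝ sineFun := by
  rw [orthonormal_iff_ite]
  intro i j
  rw [sineFun, inner_toLp, integral_congr_ae (g := fun x =>
    √(2 / π) * √(2 / π) * (sin (((i : ℝ) + 1) * x) * sin (((j : ℝ) + 1) * x))), integral_muPi,
    intervalIntegral.integral_const_mul, integral_sin_mul_sin]
  · split_ifs
    · exact sqrt_two_div_pi_mul_self
    · simp
  · filter_upwards [(memLp_sineFun j).coeFn_toLp] with x hx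
    rw [sineFun, hx]; ring

theorem orthonormal_cosFun : Orthonormal ℝ cosFun := by
  rw [orthonormal_iff_ite]
  intro i j
  rw [cosFun, inner_toLp, integral_congr_ae (g := fun x =>
    √(2 / π) * √(2 / π) * (cos (((i : ℝ) + 1) * x) * cos (((j : ℝ) + 1) * x))), integral_muPi,
    intervalIntegral.integral_const_mul, integral_cos_mul_cos]
  · split_ifs
    · exact sqrt_two_div_pi_mul_self
    · simp
  · filter_upwards [(memLp_muPi_of_continuous (continuous_cosMode j)).coeFn_toLp] with x hx
    rw [cosFun, hx]; ring

/-- Multiplying a sine mode by cos x gives half the sum of its two neighbours, so the span of the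
modes is stable under polynomials in cos x. -/
theorem integral_mul_sin_mul_polynomial (u : L2Pi) (hu : ∀ k, sineCoeff u k = 0)
    (p : Polynomial ℝ) (k : ℕ) :
    ∫ x, u x * (sin (((k : ℝ) + 1) * x) * p.eval (cos x)) ∂muPi = 0 := by
  have h0 : ∀ k : ℕ, ∫ x, u x * sin (((k : ℝ) + 1) * x) ∂muPi = 0 := by
    intro k
    have h := hu k
    rw [sineCoeff_eq] at h
    simp_rw [mul_left_comm _ (√(2 / π))] at h
    rw [integral_const_mul] at h
    exact (mul_eq_zero.1 h).resolve_left (by positivity)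
  induction p using Polynomial.induction_on generalizing k with
  | C a =>
    simp_rw [Polynomial.eval_C, ← mul_assoc]
    rw [integral_mul_const, h0, zero_mul]
  | add p q hp hq =>
    simp_rw [Polynomial.eval_add, mul_add]
    rw [integral_add (integrable_mul_continuous u (by fun_prop))
      (integrable_mul_continuous u (by fun_prop)), hp, hq, add_zero]
  | monomial n a h =>
    have key : ∀ x, sin (((k : ℝ) + 1) * x) * Polynomial.eval (cos x)
          (Polynomial.C a * Polynomial.X ^ (n + 1)) =
        (1 / 2) * (sin (((k + 1 : ℕ) + 1 : ℝ) * x) *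
          Polynomial.eval (cos x) (Polynomial.C a * Polynomial.X ^ n)) +
        (1 / 2) * (sin ((k : ℝ) * x) *
          Polynomial.eval (cos x) (Polynomial.C a * Polynomial.X ^ n)) := by
      intro x
      have h1 : ((k + 1 : ℕ) + 1 : ℝ) * x = ((k : ℝ) + 1) * x + x := by push_cast; ring
      have h2 : (k : ℝ) * x = ((k : ℝ) + 1) * x - x := by ring
      rw [h1, h2, sin_add, sin_sub]
      simp only [Polynomial.eval_mul, Polynomial.eval_C, Polynomial.eval_pow, Polynomial.eval_X]
      ring
    simp_rw [key, mul_add, mul_left_comm _ (1 / 2 : ℝ)]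
    rw [integral_add ((integrable_mul_continuous u (by fun_prop)).const_mul _)
      ((integrable_mul_continuous u (by fun_prop)).const_mul _), integral_const_mul,
      integral_const_mul, h (k + 1)]
    -- For the lowest mode the lower neighbour is sin 0 = 0.
    rcases k with _ | k
    · simp
    · have := h k
      push_cast
      rw [this]; simp

/-- By Weierstrass a test function g is uniformly close to p(cos x), where the polynomial p
approximates g ∘ arccos on [-1, 1]. Hence u sin x annihilates all test functions, and sin x > 0
inside the interval. -/
theorem eq_zero_of_sineCoeff_eq_zero (u : L2Pi) (hu : ∀ k, sineCoeff u k = 0) : u = 0 := by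
  have hi : Integrable (fun x => u x * sin x) muPi := integrable_mul_continuous u continuous_sin
  have hu1 : Integrable u muPi := by
    simpa using integrable_mul_continuous u (continuous_const (y := (1 : ℝ)))
  have key : ∀ᵐ x, x ∈ Ioo 0 π → u x * sin x = 0 := by
    refine isOpen_Ioo.ae_eq_zero_of_integral_contDiff_smul_eq_zero
      (IntegrableOn.locallyIntegrableOn hi) fun g hg _ hsupp => ?_
    have h0 : ∫ x, g x • (u x * sin x) = ∫ x, u x * (sin x * g x) ∂muPi := by
      rw [← setIntegral_eq_integral_of_forall_compl_eq_zero (s := Ioo 0 π)]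
      · refine integral_congr_ae (Eventually.of_forall fun x => ?_)
        simp only [smul_eq_mul]; ring
      · intro x hx
        rw [image_eq_zero_of_notMem_tsupport (fun h => hx (hsupp h)), zero_smul]
    rw [h0]
    refine abs_eq_zero.1 (le_antisymm (le_of_forall_pos_le_add fun ε hε => ?_) (abs_nonneg _))
    set K := ∫ x, |u x| ∂muPi
    have hK : 0 ≤ K := integral_nonneg fun x => abs_nonneg _
    obtain ⟨p, hp⟩ := exists_polynomial_near_of_continuousOn (-1) 1 (fun y => g (arccos y))
      (hg.continuous.comp continuous_arccos).continuousOn (ε / (K + 1)) (by positivity)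
    have h1 : ∫ x, u x * (sin x * g x) ∂muPi =
        ∫ x, u x * (sin x * (g x - p.eval (cos x))) ∂muPi := by
      simp_rw [mul_sub]
      rw [integral_sub (integrable_mul_continuous u (by have := hg.continuous; fun_prop))
        (integrable_mul_continuous u (by fun_prop))]
      have := integral_mul_sin_mul_polynomial u hu p 0
      simp only [Nat.cast_zero, zero_add, one_mul] at this
      rw [this, sub_zero]
    rw [h1, zero_add, ← Real.norm_eq_abs]
    calc _ ≤ ∫ x, |u x| * (ε / (K + 1)) ∂muPi := by
          refine norm_integral_le_of_norm_le (hu1.abs.mul_const _) ?_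
          filter_upwards [ae_restrict_mem measurableSet_Ioo] with x hx
          have hx' := hp (cos x) ⟨neg_one_le_cos x, cos_le_one x⟩
          rw [arccos_cos hx.1.le hx.2.le, abs_sub_comm] at hx'
          rw [norm_mul, norm_mul, Real.norm_eq_abs, Real.norm_eq_abs, Real.norm_eq_abs]
          gcongr
          calc |sin x| * |g x - p.eval (cos x)| ≤ 1 * (ε / (K + 1)) :=
                mul_le_mul (abs_sin_le_one x) hx'.le (abs_nonneg _) zero_le_one
            _ = _ := one_mul _
      _ = K * (ε / (K + 1)) := integral_mul_const _ _
      _ ≤ ε := by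
          rw [mul_div_assoc', div_le_iff₀ (by positivity)]
          nlinarith
  refine Lp.ext ?_
  filter_upwards [ae_restrict_of_ae key, ae_restrict_mem measurableSet_Ioo,
    Lp.coeFn_zero ℝ 2 muPi] with x hx hx' h0
  rw [h0]
  exact (mul_eq_zero.1 (hx hx')).resolve_right
    (ne_of_gt (sin_pos_of_pos_of_lt_pi hx'.1 hx'.2))

/-- The sine functions as a Hilbert basis of `L²(0, π)`. -/
def sineBasis : HilbertBasis ℕ ℝ L2Pi :=
  HilbertBasis.mkOfOrthogonalEqBot orthonormal_sineFun (by
    rw [Submodule.eq_bot_iff]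
    intro u hu
    refine eq_zero_of_sineCoeff_eq_zero u fun k => ?_
    exact (Submodule.mem_orthogonal _ _).1 hu _ (Submodule.subset_span (mem_range_self k)))

@[simp] theorem sineBasis_apply (k : ℕ) : sineBasis k = sineFun k := by
  simp [sineBasis]

theorem sineBasis_repr (u : L2Pi) (k : ℕ) : sineBasis.repr u k = sineCoeff u k := by
  rw [HilbertBasis.repr_apply_apply, sineBasis_apply, sineCoeff]

theorem ext_sineCoeff {u v : L2Pi} (h : ∀ k, sineCoeff u k = sineCoeff v k) : u = v := by
  apply sineBasis.repr.injective
  ext k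
  rw [sineBasis_repr, sineBasis_repr, h]

theorem sineCoeff_add (u v : L2Pi) (k : ℕ) : sineCoeff (u + v) k = sineCoeff u k + sineCoeff v k :=
  inner_add_right _ _ _

theorem sineCoeff_sub (u v : L2Pi) (k : ℕ) : sineCoeff (u - v) k = sineCoeff u k - sineCoeff v k :=
  inner_sub_right _ _ _

theorem sineCoeff_smul (c : ℝ) (u : L2Pi) (k : ℕ) : sineCoeff (c • u) k = c * sineCoeff u k := by
  rw [sineCoeff, real_inner_smul_right]; rfl

@[simp] theorem sineCoeff_zero (k : ℕ) : sineCoeff 0 k = 0 := inner_zero_right _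

theorem continuous_sineCoeff (k : ℕ) : Continuous fun u => sineCoeff u k := by
  unfold sineCoeff
  fun_prop

/-! ### Weak derivatives -/

theorem exists_bump : ∃ ψ : ℝ → ℝ, ContDiff ℝ ∞ ψ ∧ HasCompactSupport ψ ∧
    tsupport ψ ⊆ Ioo 0 π ∧ ∫ x in (0 : ℝ)..π, ψ x = 1 := by
  let B : ContDiffBump (1 : ℝ) := ⟨1 / 4, 1 / 2, by norm_num, by norm_num⟩
  have hs : tsupport (B.normed volume) ⊆ Ioo 0 π := by
    rw [B.tsupport_normed_eq, Real.closedBall_eq_Icc]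
    intro x hx
    have := pi_gt_three
    simp only [mem_Icc, mem_Ioo, B] at hx ⊢
    constructor <;> linarith [hx.1, hx.2]
  refine ⟨B.normed volume, B.contDiff_normed, B.hasCompactSupport_normed, hs, ?_⟩
  rw [← integral_muPi, setIntegral_eq_integral_of_forall_compl_eq_zero]
  · exact B.integral_normed
  · intro x hx
    exact image_eq_zero_of_notMem_tsupport fun h => hx (hs h)

/-- The primitive from 0 vanishes to the left of the support trivially, and to the right of it
because the total integral is zero. -/
theorem exists_primitive {η : ℝ → ℝ} (hη : ContDiff ℝ ∞ η) (hc : HasCompactSupport η)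
    (hs : tsupport η ⊆ Ioo 0 π) (h0 : ∫ x in (0 : ℝ)..π, η x = 0) :
    ∃ φ : ℝ → ℝ, ContDiff ℝ ∞ φ ∧ HasCompactSupport φ ∧ tsupport φ ⊆ Ioo 0 π ∧ deriv φ = η := by
  have hd : ∀ x, HasDerivAt (fun x => ∫ t in (0 : ℝ)..x, η t) (η x) x := fun x =>
    intervalIntegral.integral_hasDerivAt_right (hη.continuous.intervalIntegrable _ _)
      (hη.continuous.stronglyMeasurableAtFilter _ _) hη.continuous.continuousAt
  have hde : deriv (fun x => ∫ t in (0 : ℝ)..x, η t) = η := funext fun x => (hd x).deriv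
  have key : ∃ a b : ℝ, 0 < a ∧ b < π ∧ a ≤ b ∧ tsupport η ⊆ Icc a b := by
    rcases (tsupport η).eq_empty_or_nonempty with he | hne
    · exact ⟨1, 2, one_pos, by linarith [pi_gt_three], by norm_num, by simp [he]⟩
    · have hcp : IsCompact (tsupport η) := hc
      refine ⟨sInf (tsupport η), sSup (tsupport η), (hs (hcp.sInf_mem hne)).1,
        (hs (hcp.sSup_mem hne)).2, ?_, fun x hx =>
        ⟨csInf_le hcp.bddBelow hx, le_csSup hcp.bddAbove hx⟩⟩
      exact csInf_le_csSup hne hcp.bddBelow hcp.bddAbove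
  obtain ⟨a, b, ha, hb, hab, hsub⟩ := key
  have hz : ∀ x, x ∉ Icc a b → η x = 0 := fun x hx =>
    image_eq_zero_of_notMem_tsupport fun h => hx (hsub h)
  have hφ : ∀ x, x ∉ Icc a b → ∫ t in (0 : ℝ)..x, η t = 0 := by
    intro x hx
    rw [mem_Icc, not_and_or, not_le, not_le] at hx
    rcases hx with hx | hx
    · refine intervalIntegral.integral_zero_ae (Eventually.of_forall fun t ht => hz t ?_)
      rw [mem_uIoc] at ht
      intro h
      rcases ht with ht | ht <;> linarith [h.1, ht.1, ht.2]
    · rw [← intervalIntegral.integral_add_adjacent_intervals (b := π)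
        (hη.continuous.intervalIntegrable _ _) (hη.continuous.intervalIntegrable _ _), h0, zero_add]
      refine intervalIntegral.integral_zero_ae (Eventually.of_forall fun t ht => hz t ?_)
      rw [mem_uIoc] at ht
      intro h
      rcases ht with ht | ht <;> linarith [h.2, ht.1, ht.2]
  have hts : tsupport (fun x => ∫ t in (0 : ℝ)..x, η t) ⊆ Icc a b :=
    closure_minimal (fun x hx => by by_contra h; exact hx (hφ x h)) isClosed_Icc
  refine ⟨fun x => ∫ t in (0 : ℝ)..x, η t, ?_, ?_, ?_, hde⟩
  · rw [contDiff_infty_iff_deriv, hde]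
    exact ⟨fun x => (hd x).differentiableAt, hη⟩
  · exact HasCompactSupport.of_support_subset_isCompact isCompact_Icc
      ((subset_tsupport _).trans hts)
  · exact hts.trans fun x hx => ⟨ha.trans_le hx.1, hx.2.trans_lt hb⟩

theorem integral_muPi_of_tsupport {φ : ℝ → ℝ} (hs : tsupport φ ⊆ Ioo 0 π) (h : ℝ → ℝ) :
    ∫ x, h x * φ x ∂muPi = ∫ x, φ x • h x := by
  rw [setIntegral_eq_integral_of_forall_compl_eq_zero]
  · simp_rw [smul_eq_mul, mul_comm]
  · intro x hx
    rw [image_eq_zero_of_notMem_tsupport (fun h => hx (hs h)), mul_zero]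

/-- The du Bois-Reymond lemma. For a test function g and a bump ψ of integral 1, the function g - (∫
g) ψ is the derivative of a test function, so ∫ h g = (∫ g)(∫ h ψ). -/
theorem exists_ae_eq_const {h : ℝ → ℝ} (hi : Integrable h muPi)
    (h0 : ∀ φ : ℝ → ℝ, ContDiff ℝ ∞ φ → HasCompactSupport φ → tsupport φ ⊆ Ioo 0 π →
      ∫ x, h x * deriv φ x ∂muPi = 0) : ∃ c : ℝ, ∀ᵐ x ∂muPi, h x = c := by
  obtain ⟨ψ, hψ, hψc, hψs, hψ1⟩ := exists_bump
  have him : ∀ g : ℝ → ℝ, Continuous g → HasCompactSupport g →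
      Integrable (fun x => h x * g x) muPi := by
    intro g hg hgc
    obtain ⟨C, hC⟩ := hg.bounded_above_of_compact_support hgc
    exact hi.mul_bdd hg.aestronglyMeasurable (Eventually.of_forall hC)
  set c := ∫ x, h x * ψ x ∂muPi
  refine ⟨c, ?_⟩
  have key : ∀ᵐ x, x ∈ Ioo 0 π → h x - c = 0 := by
    refine isOpen_Ioo.ae_eq_zero_of_integral_contDiff_smul_eq_zero
      (IntegrableOn.locallyIntegrableOn (hi.sub (integrable_const c))) fun g hg hgc hgs => ?_
    rw [← integral_muPi_of_tsupport hgs]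
    set m := ∫ x in (0 : ℝ)..π, g x with hm
    have hmi : ∫ x, g x ∂muPi = m := integral_muPi g
    have hsub : tsupport (fun x => g x - m * ψ x) ⊆ Ioo 0 π := by
      refine (tsupport_sub _ _).trans (union_subset hgs ?_)
      exact (tsupport_mul_subset_right (f := fun _ => m) (g := ψ)).trans hψs
    obtain ⟨φ, hφ, hφc, hφs, hφd⟩ := exists_primitive (η := fun x => g x - m * ψ x)
      (by fun_prop) (hgc.sub (hψc.mul_left (f := fun _ => m))) hsub (by
        rw [intervalIntegral.integral_sub (hg.continuous.intervalIntegrable _ _)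
          ((hψ.continuous.intervalIntegrable _ _).const_mul _),
          intervalIntegral.integral_const_mul, hψ1, mul_one, ← hm, sub_self])
    have := h0 φ hφ hφc hφs
    rw [hφd] at this
    simp_rw [mul_sub, mul_left_comm _ m] at this
    rw [integral_sub (him g hg.continuous hgc) ((him ψ hψ.continuous hψc).const_mul _),
      integral_const_mul] at this
    simp_rw [sub_mul]
    have hgi : Integrable g muPi := (hg.continuous.integrable_of_hasCompactSupport hgc).restrict
    rw [integral_sub (him g hg.continuous hgc) (hgi.const_mul _), integral_const_mul, hmi]
    linarith
  filter_upwards [ae_restrict_of_ae key, ae_restrict_mem measurableSet_Ioo] with x hx hx'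
  linarith [hx hx']

theorem integrable_L2Pi (u : L2Pi) : Integrable u muPi := by
  simpa using integrable_mul_continuous u (continuous_const (y := (1 : ℝ)))

theorem intervalIntegrable_L2Pi (u : L2Pi) : IntervalIntegrable u volume 0 π := by
  rw [intervalIntegrable_iff_integrableOn_Ioo_of_le pi_pos.le]
  exact integrable_L2Pi u

theorem absolutelyContinuous_primitive (v : L2Pi) :
    AbsolutelyContinuousOnInterval (fun x => ∫ t in (0 : ℝ)..x, v t) 0 π :=
  (intervalIntegrable_L2Pi v).absolutelyContinuousOnInterval_intervalIntegral (by simp)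

/-- Integration by parts for the absolutely continuous primitive, whose derivative is v almost
everywhere. The boundary term at 0 is absent because the primitive starts there. -/
theorem integral_primitive_mul_deriv (v : L2Pi) {g : ℝ → ℝ} (hg : ContDiff ℝ 1 g) :
    ∫ x, (∫ t in (0 : ℝ)..x, v t) * deriv g x ∂muPi =
      (∫ t in (0 : ℝ)..π, v t) * g π - ∫ x, v x * g x ∂muPi := by
  have hgac : AbsolutelyContinuousOnInterval g 0 π := hg.contDiffOn.absolutelyContinuousOnInterval
  rw [integral_muPi, (absolutelyContinuous_primitive v).integral_mul_deriv_eq_deriv_mul hgac,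
    integral_muPi, intervalIntegral.integral_same, zero_mul, sub_zero]
  congr 1
  refine intervalIntegral.integral_congr_ae ?_
  filter_upwards [(intervalIntegrable_L2Pi v).ae_hasDerivAt_integral] with x hx hx'
  rw [(hx (uIoc_subset_uIcc hx') 0 (by simp)).deriv]

theorem integral_deriv_muPi {g : ℝ → ℝ} (hg : ContDiff ℝ 1 g) :
    ∫ x, deriv g x ∂muPi = g π - g 0 := by
  rw [integral_muPi]
  exact intervalIntegral.integral_deriv_eq_sub (fun x _ => (hg.differentiable one_ne_zero) x)
    ((hg.continuous_deriv le_rfl).intervalIntegrable _ _)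

theorem continuousOn_primitive (v : L2Pi) :
    ContinuousOn (fun x => ∫ t in (0 : ℝ)..x, v t) (Icc 0 π) := by
  simpa [uIcc_of_le pi_pos.le] using (absolutelyContinuous_primitive v).continuousOn

theorem integrable_continuousOn {U : ℝ → ℝ} (hU : ContinuousOn U (Icc 0 π)) :
    Integrable U muPi :=
  (hU.integrableOn_compact isCompact_Icc).mono_set Ioo_subset_Icc_self

/-- The difference between u and the primitive of v has weak derivative zero, so it is constant. -/
theorem isWeakDeriv_exists_primitive {u v : L2Pi} (h : IsWeakDeriv u v) :
    ∃ c : ℝ, ∀ᵐ x ∂muPi, u x = c + ∫ t in (0 : ℝ)..x, v t := by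
  have hp := integrable_continuousOn (continuousOn_primitive v)
  obtain ⟨c, hc⟩ := exists_ae_eq_const ((integrable_L2Pi u).sub hp) fun φ hφ hφc hφs => by
    have hdc : Continuous (deriv φ) := hφ.continuous_deriv (by simp)
    obtain ⟨C, hC⟩ := hdc.bounded_above_of_compact_support hφc.deriv
    simp only [Pi.sub_apply, sub_mul]
    rw [integral_sub (integrable_mul_continuous u hdc)
      (hp.mul_bdd hdc.aestronglyMeasurable (Eventually.of_forall hC)),
      h φ hφ hφc hφs, integral_primitive_mul_deriv v (hφ.of_le (by simp))]
    rw [image_eq_zero_of_notMem_tsupport (x := π) fun h => (hφs h).2.ne rfl]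
    ring
  refine ⟨c, ?_⟩
  filter_upwards [hc] with x hx
  simp only [Pi.sub_apply] at hx
  linarith

/-- Integration by parts for a function with a weak derivative, with its boundary values. -/
theorem isWeakDeriv_integral_mul_deriv {u v : L2Pi} (h : IsWeakDeriv u v) :
    ∃ U : ℝ → ℝ, ContinuousOn U (Icc 0 π) ∧ (∀ᵐ x ∂muPi, u x = U x) ∧
      ∀ g : ℝ → ℝ, ContDiff ℝ 1 g → ∫ x, u x * deriv g x ∂muPi =
        U π * g π - U 0 * g 0 - ∫ x, v x * g x ∂muPi := by
  obtain ⟨c, hc⟩ := isWeakDeriv_exists_primitive h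
  refine ⟨fun x => c + ∫ t in (0 : ℝ)..x, v t, continuousOn_const.add (continuousOn_primitive v),
    hc, fun g hg => ?_⟩
  have hdc : Continuous (deriv g) := hg.continuous_deriv le_rfl
  have hi : Integrable (fun x => (∫ t in (0 : ℝ)..x, v t) * deriv g x) muPi :=
    integrable_continuousOn ((continuousOn_primitive v).mul hdc.continuousOn)
  rw [integral_congr_ae (g := fun x => c * deriv g x + (∫ t in (0 : ℝ)..x, v t) * deriv g x),
    integral_add ((integrable_continuousOn hdc.continuousOn).const_mul _) hi, integral_const_mul,
    integral_deriv_muPi hg, integral_primitive_mul_deriv v hg]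
  · simp only [intervalIntegral.integral_same]; ring
  · filter_upwards [hc] with x hx
    rw [hx, add_mul]

/-- Here g kills the boundary terms, so u needs no boundary condition. This is needed for u_x, and
for test functions with the factor sin x. -/
theorem isWeakDeriv_integral_mul_deriv_of_zero {u v : L2Pi} (h : IsWeakDeriv u v) {g : ℝ → ℝ}
    (hg : ContDiff ℝ 1 g) (h0 : g 0 = 0) (hπ : g π = 0) :
    ∫ x, u x * deriv g x ∂muPi = - ∫ x, v x * g x ∂muPi := by
  obtain ⟨U, -, -, hU⟩ := isWeakDeriv_integral_mul_deriv h
  rw [hU g hg, h0, hπ]; ring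

theorem eqOn_of_ae_eq_muPi {U V : ℝ → ℝ} (hU : ContinuousOn U (Icc 0 π))
    (hV : ContinuousOn V (Icc 0 π)) (h : ∀ᵐ x ∂muPi, U x = V x) : EqOn U V (Icc 0 π) := by
  have h1 : EqOn U V (Ioo 0 π) :=
    Measure.eqOn_open_of_ae_eq (μ := volume) h isOpen_Ioo (hU.mono Ioo_subset_Icc_self)
      (hV.mono Ioo_subset_Icc_self)
  exact h1.of_subset_closure hU hV Ioo_subset_Icc_self (by rw [closure_Ioo pi_pos.ne])

theorem isWeakDeriv_integral_mul_deriv_of_vanishes {u v : L2Pi} (h : IsWeakDeriv u v)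
    (hv : VanishesAtEnds u) {g : ℝ → ℝ} (hg : ContDiff ℝ 1 g) :
    ∫ x, u x * deriv g x ∂muPi = - ∫ x, v x * g x ∂muPi := by
  obtain ⟨U, hUc, hu, hU⟩ := isWeakDeriv_integral_mul_deriv h
  obtain ⟨V, hVc, hV0, hVπ, hV⟩ := hv
  have he := eqOn_of_ae_eq_muPi hUc hVc (by filter_upwards [hu, hV] with x h1 h2; rw [← h1, h2])
  rw [hU g hg, he (left_mem_Icc.2 pi_pos.le), he (right_mem_Icc.2 pi_pos.le), hV0, hVπ]; ring

/-- The coefficients of the second derivative under Dirichlet conditions. -/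
theorem sineCoeff_second_deriv {u v w : L2Pi} (hu : VanishesAtEnds u) (h1 : IsWeakDeriv u v)
    (h2 : IsWeakDeriv v w) (k : ℕ) : sineCoeff w k = -((k : ℝ) + 1) ^ 2 * sineCoeff u k := by
  have hs : deriv (fun x : ℝ => √(2 / π) * sin (((k : ℝ) + 1) * x)) =
      fun x => ((k : ℝ) + 1) * (√(2 / π) * cos (((k : ℝ) + 1) * x)) := by
    funext x
    have : HasDerivAt (fun x : ℝ => √(2 / π) * sin (((k : ℝ) + 1) * x))
        (√(2 / π) * (cos (((k : ℝ) + 1) * x) * (((k : ℝ) + 1) * 1))) x :=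
      ((hasDerivAt_id x).const_mul _).sin.const_mul _
    rw [this.deriv]; ring
  have hc : deriv (fun x : ℝ => √(2 / π) * cos (((k : ℝ) + 1) * x)) =
      fun x => -((k : ℝ) + 1) * (√(2 / π) * sin (((k : ℝ) + 1) * x)) := by
    funext x
    have : HasDerivAt (fun x : ℝ => √(2 / π) * cos (((k : ℝ) + 1) * x))
        (√(2 / π) * (-sin (((k : ℝ) + 1) * x) * (((k : ℝ) + 1) * 1))) x :=
      ((hasDerivAt_id x).const_mul _).cos.const_mul _
    rw [this.deriv]; ring
  -- The sine vanishes at both ends, so `v` may have any boundary values. In `e2` the cosine does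
  -- not vanish there, and the Dirichlet condition on `u` is used.
  have e1 := isWeakDeriv_integral_mul_deriv_of_zero h2 (g := fun x => √(2 / π) * sin (((k : ℝ) + 1) * x))
    (by fun_prop) (by simp) (by
      have := sin_int_mul_pi (k + 1)
      push_cast at this
      simp [this])
  have e2 := isWeakDeriv_integral_mul_deriv_of_vanishes h1 hu
    (g := fun x => √(2 / π) * cos (((k : ℝ) + 1) * x)) (by fun_prop)
  rw [hs] at e1
  rw [hc] at e2
  simp_rw [mul_left_comm _ ((k : ℝ) + 1)] at e1
  simp_rw [mul_left_comm _ (-((k : ℝ) + 1))] at e2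
  rw [integral_const_mul] at e1 e2
  rw [sineCoeff_eq, sineCoeff_eq]
  linear_combination e1 - ((k : ℝ) + 1) * e2

/-- The coefficients of `(sin x) u_x`, in terms of those of `u`. -/
def sinDeriv (a : ℕ → ℝ) (k : ℕ) : ℝ :=
  -- At k = 0 the truncated index k - 1 is harmless, since its factor k is zero.
  ((k : ℝ) * a (k - 1) - ((k : ℝ) + 2) * a (k + 1)) / 2

/-- Integrate by parts against sin x sin((k+1)x). This vanishes at both ends, and its derivative is
((k+2) sin((k+2)x) - k sin(kx)) / 2. -/
theorem sineCoeff_sin_mul {v v' z : L2Pi} (h : IsWeakDeriv v v')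
    (hz : ∀ᵐ x ∂muPi, z x = sin x * v' x) (k : ℕ) :
    sineCoeff z k = sinDeriv (sineCoeff v) k := by
  have hd : ∀ x, deriv (fun x : ℝ => sin x * (√(2 / π) * sin (((k : ℝ) + 1) * x))) x =
      (((k : ℝ) + 2) / 2) * (√(2 / π) * sin (((k + 1 : ℕ) + 1 : ℝ) * x)) +
      (-((k : ℝ) / 2)) * (√(2 / π) * sin ((k : ℝ) * x)) := by
    intro x
    have : HasDerivAt (fun x : ℝ => sin x * (√(2 / π) * sin (((k : ℝ) + 1) * x)))
        (cos x * (√(2 / π) * sin (((k : ℝ) + 1) * x)) +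
          sin x * (√(2 / π) * (cos (((k : ℝ) + 1) * x) * (((k : ℝ) + 1) * 1)))) x :=
      (hasDerivAt_sin x).mul (((hasDerivAt_id x).const_mul _).sin.const_mul _)
    rw [this.deriv]
    have h1 : ((k + 1 : ℕ) + 1 : ℝ) * x = ((k : ℝ) + 1) * x + x := by push_cast; ring
    have h2 : (k : ℝ) * x = ((k : ℝ) + 1) * x - x := by ring
    rw [h1, h2, sin_add, sin_sub]
    ring
  have e := isWeakDeriv_integral_mul_deriv_of_zero h
    (g := fun x => sin x * (√(2 / π) * sin (((k : ℝ) + 1) * x))) (by fun_prop)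
    (by simp) (by simp)
  simp_rw [hd, mul_add, mul_left_comm _ (((k : ℝ) + 2) / 2), mul_left_comm _ (-((k : ℝ) / 2))] at e
  rw [integral_add ((integrable_mul_continuous v (by fun_prop)).const_mul _)
    ((integrable_mul_continuous v (by fun_prop)).const_mul _), integral_const_mul,
    integral_const_mul, ← sineCoeff_eq] at e
  have e3 : sineCoeff z k = ∫ x, v' x * (sin x * (√(2 / π) * sin (((k : ℝ) + 1) * x))) ∂muPi := by
    rw [sineCoeff_eq]
    refine integral_congr_ae ?_
    filter_upwards [hz] with x hx
    rw [hx]; ring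
  rw [e3, sinDeriv]
  rcases k with _ | k
  · simp only [Nat.cast_zero, zero_mul] at e ⊢
    simp only [sin_zero, mul_zero, integral_zero] at e
    linarith
  · have : sineCoeff v k = ∫ x, v x * (√(2 / π) * sin (((k + 1 : ℕ) : ℝ) * x)) ∂muPi := by
      rw [sineCoeff_eq]; push_cast; rfl
    rw [← this] at e
    simp only [Nat.add_sub_cancel]
    linarith

/-! ### Weighted `ℓ²` norms of coefficient sequences -/

/-- The (extended) norm of `X^β` on coefficient sequences, for arbitrary real `β`. -/
def wnorm (β : ℝ) (a : ℕ → ℝ) : ℝ≥0∞ :=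
  eLpNorm (fun k : ℕ => ((k : ℝ) + 1) ^ (2 * β) * a k) 2 Measure.count

theorem aestronglyMeasurable_count {g : ℕ → ℝ} : AEStronglyMeasurable g Measure.count :=
  (measurable_of_countable g).aestronglyMeasurable

theorem wnorm_add_le (β : ℝ) (a b : ℕ → ℝ) : wnorm β (a + b) ≤ wnorm β a + wnorm β b := by
  unfold wnorm
  refine le_trans (le_of_eq ?_)
    (eLpNorm_add_le aestronglyMeasurable_count aestronglyMeasurable_count one_le_two)
  congr 1
  funext k
  simp [mul_add]

theorem wnorm_neg (β : ℝ) (a : ℕ → ℝ) : wnorm β (-a) = wnorm β a := by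
  unfold wnorm
  rw [← eLpNorm_neg]
  congr 1
  funext k
  simp

theorem wnorm_sub_le (β : ℝ) (a b : ℕ → ℝ) : wnorm β (a - b) ≤ wnorm β a + wnorm β b := by
  rw [sub_eq_add_neg, ← wnorm_neg β b]
  exact wnorm_add_le β a (-b)

theorem wnorm_sub_comm (β : ℝ) (a b : ℕ → ℝ) : wnorm β (a - b) = wnorm β (b - a) := by
  rw [← wnorm_neg, neg_sub]

@[simp] theorem wnorm_zero_right (β : ℝ) : wnorm β 0 = 0 := by
  unfold wnorm
  simp

theorem wnorm_smul (β c : ℝ) (a : ℕ → ℝ) : wnorm β (c • a) = ‖c‖ₑ * wnorm β a := by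
  unfold wnorm
  rw [← eLpNorm_const_smul]
  congr 1
  funext k
  simp only [Pi.smul_apply, smul_eq_mul]; ring

/-- Comparison mode by mode; the estimates for diagonal operators all reduce to it. -/
theorem wnorm_le_of_le {β γ C : ℝ} {a b : ℕ → ℝ}
    (h : ∀ k : ℕ, ((k : ℝ) + 1) ^ (2 * β) * |a k| ≤ C * (((k : ℝ) + 1) ^ (2 * γ) * |b k|)) :
    wnorm β a ≤ ENNReal.ofReal C * wnorm γ b := by
  refine eLpNorm_le_mul_eLpNorm_of_ae_le_mul (Eventually.of_forall fun k => ?_) 2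
  have h1 : ∀ δ : ℝ, ‖((k : ℝ) + 1) ^ (2 * δ)‖ = ((k : ℝ) + 1) ^ (2 * δ) := fun δ =>
    Real.norm_of_nonneg (by positivity)
  rw [norm_mul, norm_mul, h1, h1]
  exact h k

theorem wnorm_mono_exponent {β γ : ℝ} (h : β ≤ γ) (a : ℕ → ℝ) : wnorm β a ≤ wnorm γ a := by
  have := wnorm_le_of_le (β := β) (γ := γ) (C := 1) (a := a) (b := a) fun k => by
    rw [one_mul]
    gcongr
    linarith [k.cast_nonneg (α := ℝ)]
  simpa using this

theorem wnorm_sq (β : ℝ) (a : ℕ → ℝ) :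
    wnorm β a ^ 2 = ∑' k : ℕ, ‖((k : ℝ) + 1) ^ (2 * β) * a k‖ₑ ^ 2 := by
  unfold wnorm
  rw [eLpNorm_eq_lintegral_rpow_enorm_toReal (by norm_num) (by norm_num), lintegral_count]
  simp only [ENNReal.toReal_ofNat]
  rw [← ENNReal.rpow_natCast, ← ENNReal.rpow_mul]
  norm_num

theorem enorm_lp_eq (x : lp (fun _ : ℕ => ℝ) 2) : ‖x‖ₑ = eLpNorm (⇑x) 2 Measure.count := by
  have hs : Summable fun k => ‖x k‖ ^ (2 : ℝ) := by
    simpa using (memℓp_gen_iff (p := 2) (by norm_num)).1 (lp.memℓp x)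
  rw [← ofReal_norm, lp.norm_eq_tsum_rpow (by norm_num)]
  rw [eLpNorm_eq_lintegral_rpow_enorm_toReal (by norm_num) (by norm_num), lintegral_count]
  simp only [ENNReal.toReal_ofNat]
  rw [← ENNReal.ofReal_rpow_of_nonneg (tsum_nonneg fun k => by positivity) (by norm_num),
    ENNReal.ofReal_tsum_of_nonneg (fun k => by positivity) hs]
  congr 2
  funext k
  rw [← ENNReal.ofReal_rpow_of_nonneg (norm_nonneg _) (by norm_num), ofReal_norm]

theorem memℓp_iff_eLpNorm_ne_top (g : ℕ → ℝ) :
    Memℓp g 2 ↔ eLpNorm g 2 Measure.count ≠ ⊤ := by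
  constructor
  · intro h
    rw [← enorm_lp_eq ⟨g, h⟩]
    exact enorm_ne_top
  · intro h
    rw [memℓp_gen_iff (by norm_num)]
    rw [eLpNorm_eq_lintegral_rpow_enorm_toReal (by norm_num) (by norm_num), lintegral_count] at h
    simp only [ENNReal.toReal_ofNat] at h ⊢
    have h2 : ∑' k, ‖g k‖ₑ ^ (2 : ℝ) ≠ ⊤ := by
      intro h'
      rw [h'] at h
      simp at h
    have h3 := ENNReal.summable_toReal h2
    refine h3.congr fun k => ?_
    rw [← ENNReal.toReal_rpow, toReal_enorm]

/-- Parseval's identity for the sine basis. -/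
theorem enorm_eq_wnorm (u : L2Pi) : ‖u‖ₑ = wnorm 0 (sineCoeff u) := by
  rw [← enorm_norm, ← sineBasis.repr.norm_map u, enorm_norm, enorm_lp_eq, wnorm]
  congr 1
  funext k
  simp [sineBasis_repr]

theorem exists_sineCoeff_eq {a : ℕ → ℝ} (h : wnorm 0 a ≠ ⊤) : ∃ u : L2Pi, sineCoeff u = a := by
  have h' : Memℓp a 2 := by
    rw [memℓp_iff_eLpNorm_ne_top]
    simpa [wnorm] using h
  refine ⟨sineBasis.repr.symm ⟨a, h'⟩, ?_⟩
  funext k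
  rw [← sineBasis_repr, LinearIsometryEquiv.apply_symm_apply]

theorem wnorm_zero_sineCoeff_ne_top (u : L2Pi) : wnorm 0 (sineCoeff u) ≠ ⊤ := by
  rw [← enorm_eq_wnorm]; exact enorm_ne_top

theorem FracSpace.toL2_injective {α : ℝ} : Function.Injective (FracSpace.toL2 (α := α)) :=
  Subtype.val_injective

theorem FracSpace.enorm_eq {α : ℝ} (u : FracSpace α) : ‖u‖ₑ = wnorm α (sineCoeff u.toL2) := by
  have : ‖u‖ = ‖FracSpace.pow u‖ := rfl
  rw [← ofReal_norm, this, ofReal_norm, enorm_lp_eq]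
  rfl

theorem exists_fracSpace {α : ℝ} (u : L2Pi) (h : wnorm α (sineCoeff u) ≠ ⊤) :
    ∃ U : FracSpace α, U.toL2 = u := by
  have h' : Memℓp (powCoeff α u) 2 := by
    rw [memℓp_iff_eLpNorm_ne_top]
    exact h
  exact ⟨⟨u, h'⟩, rfl⟩

theorem sineCoeff_sub_fun (u v : L2Pi) : sineCoeff (u - v) = sineCoeff u - sineCoeff v :=
  funext fun k => sineCoeff_sub u v k

theorem FracSpace.enorm_sub_eq {α : ℝ} (u v : FracSpace α) :
    ‖u - v‖ₑ = wnorm α (sineCoeff u.toL2 - sineCoeff v.toL2) := by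
  rw [FracSpace.enorm_eq, map_sub, sineCoeff_sub_fun]

theorem enorm_coord_le {β : ℝ} (a : ℕ → ℝ) (k : ℕ) :
    ‖((k : ℝ) + 1) ^ (2 * β) * a k‖ₑ ≤ wnorm β a := by
  rw [← ENNReal.pow_le_pow_left_iff two_ne_zero, wnorm_sq]
  exact ENNReal.le_tsum k

/-! ### Regularity of functions with decaying coefficients -/

/-- Cauchy–Schwarz against the square summable sequence 1/(k+1). -/
theorem summable_of_wnorm {a : ℕ → ℝ} (h : wnorm (1 / 2) a ≠ ⊤) : Summable fun k => |a k| := by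
  have h1 : Summable fun k : ℕ => ‖((k : ℝ) + 1) ^ (2 * (1 / 2 : ℝ)) * a k‖ ^ (2 : ℝ) := by
    simpa using (memℓp_gen_iff (p := 2) (by norm_num)).1 ((memℓp_iff_eLpNorm_ne_top _).2 h)
  have h2 : Summable fun k : ℕ => ‖(((k : ℝ) + 1))⁻¹‖ ^ (2 : ℝ) := by
    have := (summable_nat_add_iff 1).2 (Real.summable_one_div_nat_pow.2 one_lt_two)
    refine this.congr fun k => ?_
    rw [Real.norm_of_nonneg (by positivity), Real.rpow_two]
    push_cast
    rw [one_div, inv_pow]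
  refine (Real.summable_mul_of_Lp_Lq_of_nonneg Real.HolderConjugate.two_two
    (fun k => norm_nonneg _) (fun k => norm_nonneg _) h1 h2).congr fun k => ?_
  have hk : (0 : ℝ) < k + 1 := by positivity
  have e1 : ‖((k : ℝ) + 1) ^ (2 * (1 / 2 : ℝ))‖ = (k : ℝ) + 1 := by
    rw [Real.norm_of_nonneg (by positivity)]; norm_num
  have e2 : ‖((k : ℝ) + 1)⁻¹‖ = ((k : ℝ) + 1)⁻¹ := Real.norm_of_nonneg (by positivity)
  rw [norm_mul, e1, e2, Real.norm_eq_abs]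
  field_simp

theorem hasSum_sineFun (u : L2Pi) : HasSum (fun k => sineCoeff u k • sineFun k) u := by
  simpa [sineBasis_repr] using sineBasis.hasSum_repr u

/-- The sine series converges uniformly. Its sum is continuous, vanishes where every mode does, and
represents u because uniform convergence implies convergence in L². -/
theorem vanishesAtEnds_of_wnorm {u : L2Pi} (h : wnorm (1 / 2) (sineCoeff u) ≠ ⊤) :
    VanishesAtEnds u := by
  have hb : ∀ k : ℕ, ∀ x : ℝ, ‖√(2 / π) * sin (((k : ℝ) + 1) * x)‖ ≤ √(2 / π) := by
    intro k x
    rw [norm_mul, Real.norm_of_nonneg (Real.sqrt_nonneg _)]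
    exact mul_le_of_le_one_right (Real.sqrt_nonneg _) (abs_sin_le_one _)
  let s : ℕ → BoundedContinuousFunction ℝ ℝ := fun k =>
    BoundedContinuousFunction.ofNormedAddCommGroup _ (continuous_sineMode k) _ (hb k)
  have hsum : Summable fun k => sineCoeff u k • s k := by
    refine Summable.of_norm_bounded ((summable_of_wnorm h).mul_right √(2 / π)) fun k => ?_
    rw [norm_smul, Real.norm_eq_abs]
    gcongr
    exact BoundedContinuousFunction.norm_ofNormedAddCommGroup_le _ (Real.sqrt_nonneg _) (hb k)
  obtain ⟨U, hU⟩ := hsum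
  have hev : ∀ x : ℝ, (∀ k, s k x = 0) → U x = 0 := by
    intro x hx
    have h1 := (BoundedContinuousFunction.evalCLM ℝ x).hasSum hU
    refine h1.unique ?_
    simp [hx, hasSum_zero]
  have hL := (BoundedContinuousFunction.toLp 2 muPi ℝ (E := ℝ)).hasSum hU
  have heq : BoundedContinuousFunction.toLp 2 muPi ℝ U = u := by
    refine hL.unique ?_
    convert hasSum_sineFun u using 2 with k
    simp only [map_smul]
    rfl
  refine ⟨U, U.continuous.continuousOn, hev 0 fun k => ?_, hev π fun k => ?_, ?_⟩
  · simp [s]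
  · have := sin_int_mul_pi (k + 1)
    push_cast at this
    simp [s, this]
  · rw [← heq]
    exact BoundedContinuousFunction.coeFn_toLp 2 muPi ℝ U

theorem integral_deriv_mul_mode {φ m m' : ℝ → ℝ} (hφ : ContDiff ℝ ∞ φ)
    (hs : tsupport φ ⊆ Ioo 0 π) (hm : ∀ x, HasDerivAt m (m' x) x) (hm' : Continuous m') :
    ∫ x, deriv φ x * m x ∂muPi = -∫ x, φ x * m' x ∂muPi := by
  have h0 : φ 0 = 0 := image_eq_zero_of_notMem_tsupport fun h => (hs h).1.ne rfl
  have hπ : φ π = 0 := image_eq_zero_of_notMem_tsupport fun h => (hs h).2.ne rfl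
  have hdc : Continuous (deriv φ) := hφ.continuous_deriv (by simp)
  have := intervalIntegral.integral_mul_deriv_eq_deriv_mul (a := 0) (b := π) (u := φ) (v := m)
    (u' := deriv φ) (fun x _ => (hφ.differentiable (by simp) x).hasDerivAt) (fun x _ => hm x)
    (hdc.intervalIntegrable _ _) (hm'.intervalIntegrable _ _)
  rw [integral_muPi, integral_muPi, this, h0, hπ]
  ring

/-- Both sides of the defining identity are pairings with fixed L² functions, hence continuous, so
weak derivatives can be taken termwise. -/
theorem isWeakDeriv_of_hasSum {u v : L2Pi} {p q : ℕ → L2Pi} (hp : HasSum p u) (hq : HasSum q v)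
    (h : ∀ k, IsWeakDeriv (p k) (q k)) : IsWeakDeriv u v := by
  intro φ hφ hφc hφs
  have hdc : Continuous (deriv φ) := hφ.continuous_deriv (by simp)
  have hp' := (innerSL ℝ ((memLp_muPi_of_continuous hdc).toLp _)).hasSum hp
  have hq' := (innerSL ℝ ((memLp_muPi_of_continuous hφ.continuous).toLp _)).hasSum hq
  simp only [innerSL_apply_apply, inner_toLp] at hp' hq'
  have hpq : (fun k => ∫ x, p k x * deriv φ x ∂muPi) = fun k => -∫ x, q k x * φ x ∂muPi :=
    funext fun k => h k φ hφ hφc hφs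
  rw [hpq] at hp'
  exact hp'.unique hq'.neg

theorem isWeakDeriv_smul {u v : L2Pi} (h : IsWeakDeriv u v) (c : ℝ) :
    IsWeakDeriv (c • u) (c • v) := by
  intro φ hφ hφc hφs
  have key : ∀ (w : L2Pi) (g : ℝ → ℝ), ∫ x, (c • w : L2Pi) x * g x ∂muPi =
      c * ∫ x, w x * g x ∂muPi := by
    intro w g
    rw [← integral_const_mul]
    refine integral_congr_ae ?_
    filter_upwards [Lp.coeFn_smul c w] with x hx
    rw [hx]; simp [mul_assoc]
  rw [key, key, h φ hφ hφc hφs]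
  ring

theorem isWeakDeriv_toLp {m m' : ℝ → ℝ} (hmL : MemLp m 2 muPi) (hmL' : MemLp m' 2 muPi)
    (hm : ∀ x, HasDerivAt m (m' x) x) (hm' : Continuous m') :
    IsWeakDeriv (hmL.toLp m) (hmL'.toLp m') := by
  intro φ hφ hφc hφs
  have h1 : ∫ x, (hmL.toLp m) x * deriv φ x ∂muPi = ∫ x, deriv φ x * m x ∂muPi := by
    refine integral_congr_ae ?_
    filter_upwards [hmL.coeFn_toLp] with x hx
    rw [hx, mul_comm]
  have h2 : ∫ x, (hmL'.toLp m') x * φ x ∂muPi = ∫ x, φ x * m' x ∂muPi := by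
    refine integral_congr_ae ?_
    filter_upwards [hmL'.coeFn_toLp] with x hx
    rw [hx, mul_comm]
  rw [h1, h2]
  exact integral_deriv_mul_mode hφ hφs hm hm'

theorem isWeakDeriv_sineFun (k : ℕ) : IsWeakDeriv (sineFun k) (((k : ℝ) + 1) • cosFun k) := by
  have h := isWeakDeriv_toLp (memLp_sineFun k)
    ((memLp_muPi_of_continuous (continuous_cosMode k)).const_smul ((k : ℝ) + 1)) (fun x => by
      have : HasDerivAt (fun x : ℝ => √(2 / π) * sin (((k : ℝ) + 1) * x))
        (√(2 / π) * (cos (((k : ℝ) + 1) * x) * (((k : ℝ) + 1) * 1))) x :=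
        ((hasDerivAt_id x).const_mul _).sin.const_mul _
      convert this using 1
      simp only [Pi.smul_apply, smul_eq_mul]; ring) (by fun_prop)
  rwa [MemLp.toLp_const_smul] at h

theorem isWeakDeriv_cosFun (k : ℕ) : IsWeakDeriv (cosFun k) ((-((k : ℝ) + 1)) • sineFun k) := by
  have h := isWeakDeriv_toLp (memLp_muPi_of_continuous (continuous_cosMode k))
    ((memLp_sineFun k).const_smul (-((k : ℝ) + 1))) (fun x => by
      have : HasDerivAt (fun x : ℝ => √(2 / π) * cos (((k : ℝ) + 1) * x))
        (√(2 / π) * (-sin (((k : ℝ) + 1) * x) * (((k : ℝ) + 1) * 1))) x :=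
        ((hasDerivAt_id x).const_mul _).cos.const_mul _
      convert this using 1
      simp only [Pi.smul_apply, smul_eq_mul]; ring) (by fun_prop)
  rwa [MemLp.toLp_const_smul] at h

/-- The termwise derivative converges in L² because the cosines are orthonormal and (k+1) a_k is
square summable. -/
theorem exists_weakDeriv {u : L2Pi} (h : wnorm (1 / 2) (sineCoeff u) ≠ ⊤) :
    ∃ v, IsWeakDeriv u v ∧
      HasSum (fun k : ℕ => (((k : ℝ) + 1) * sineCoeff u k) • cosFun k) v := by
  have hs : Summable fun k : ℕ => (((k : ℝ) + 1) * sineCoeff u k) • cosFun k := by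
    refine (orthonormal_cosFun.orthogonalFamily.summable_iff_norm_sq_summable
      (fun k => ((k : ℝ) + 1) * sineCoeff u k)).2 ?_
    have := (memℓp_gen_iff (p := 2) (by norm_num)).1 ((memℓp_iff_eLpNorm_ne_top _).2 h)
    simpa using this
  obtain ⟨v, hv⟩ := hs
  refine ⟨v, isWeakDeriv_of_hasSum (hasSum_sineFun u) hv fun k => ?_, hv⟩
  rw [mul_comm, mul_smul]
  exact isWeakDeriv_smul (isWeakDeriv_sineFun k) _

/-- Converse to `sineCoeff_second_deriv`: an L² function with these coefficients forces u into
X^{1/2}, which supplies the boundary values and the first derivative. -/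
theorem exists_second_weakDeriv {u w : L2Pi}
    (hw : ∀ k, sineCoeff w k = -((k : ℝ) + 1) ^ 2 * sineCoeff u k) :
    ∃ v, VanishesAtEnds u ∧ IsWeakDeriv u v ∧ IsWeakDeriv v w := by
  have h : wnorm (1 / 2) (sineCoeff u) ≠ ⊤ := by
    refine ne_top_of_le_ne_top (wnorm_zero_sineCoeff_ne_top w) ?_
    refine (wnorm_le_of_le (γ := 0) (C := 1) (b := sineCoeff w) fun k => ?_).trans (by simp)
    rw [hw, abs_mul, abs_neg, abs_of_nonneg (sq_nonneg ((k : ℝ) + 1))]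
    norm_num
    gcongr
    nlinarith [k.cast_nonneg (α := ℝ)]
  obtain ⟨v, hv, hsum⟩ := exists_weakDeriv h
  refine ⟨v, vanishesAtEnds_of_wnorm h, hv, isWeakDeriv_of_hasSum hsum (hasSum_sineFun w)
    fun k => ?_⟩
  have := isWeakDeriv_smul (isWeakDeriv_cosFun k) (((k : ℝ) + 1) * sineCoeff u k)
  rw [smul_smul] at this
  convert this using 2
  rw [hw]; ring

/-! ### The impulse condition in coefficients -/

theorem memLp_parabola : MemLp (fun x : ℝ => x * (π - x)) 2 muPi :=
  memLp_muPi_of_continuous (by fun_prop)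

/-- The function `x (π - x)`. -/
def parabola : L2Pi := memLp_parabola.toLp _

/-- The parabola vanishes at both ends and has second derivative -2 in L², so it lies in D(A) = X^1.
-/
theorem wnorm_parabola_ne_top {β : ℝ} (hβ : β ≤ 1) : wnorm β (sineCoeff parabola) ≠ ⊤ := by
  refine ne_top_of_le_ne_top ?_ (wnorm_mono_exponent hβ _)
  have h1 : MemLp (fun x : ℝ => π - 2 * x) 2 muPi := memLp_muPi_of_continuous (by fun_prop)
  have h2 : MemLp (fun _ : ℝ => (-2 : ℝ)) 2 muPi := memLp_muPi_of_continuous (by fun_prop)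
  have d1 : IsWeakDeriv parabola (h1.toLp _) := isWeakDeriv_toLp _ h1 (fun x => by
    have : HasDerivAt (fun x : ℝ => x * (π - x)) (1 * (π - x) + x * (-1)) x :=
      (hasDerivAt_id x).mul ((hasDerivAt_id x).const_sub π)
    convert this using 1
    ring) (by fun_prop)
  have d2 : IsWeakDeriv (h1.toLp _) (h2.toLp _) := isWeakDeriv_toLp h1 h2 (fun x => by
    have := ((hasDerivAt_id x).const_mul 2).const_sub π
    simpa using this) (by fun_prop)
  have hv : VanishesAtEnds parabola := ⟨fun x => x * (π - x), by fun_prop, by simp, by simp,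
    memLp_parabola.coeFn_toLp⟩
  have hc := sineCoeff_second_deriv hv d1 d2
  refine ne_top_of_le_ne_top (wnorm_zero_sineCoeff_ne_top (h2.toLp _)) ?_
  refine (wnorm_le_of_le (γ := 0) (C := 1) (b := sineCoeff (h2.toLp _)) fun k => ?_).trans (by simp)
  rw [hc, abs_mul, abs_neg, abs_of_nonneg (sq_nonneg ((k : ℝ) + 1))]
  norm_num

/-- The coefficients of the state after an impulse. -/
def jump (b c : ℝ) (a : ℕ → ℝ) : ℕ → ℝ := a + b • sinDeriv a + c • sineCoeff parabola

theorem memLp_sin_mul (v : L2Pi) : MemLp (fun x => sin x * v x) 2 muPi := by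
  refine MemLp.of_le (Lp.memLp v) ?_ (Eventually.of_forall fun x => ?_)
  · exact continuous_sin.aestronglyMeasurable.mul (Lp.aestronglyMeasurable v)
  · rw [norm_mul]
    exact mul_le_of_le_one_left (norm_nonneg _) (abs_sin_le_one x)

theorem isImpulse_iff_ae {b c : ℝ} {v v' y : L2Pi} :
    (∀ᵐ x ∂muPi, y x - v x = b * (sin x * v' x) + c * (x * (π - x))) ↔
      y = v + b • (memLp_sin_mul v').toLp _ + c • parabola := by
  set z := (memLp_sin_mul v').toLp (fun x => sin x * v' x)
  have hz : ∀ᵐ x ∂muPi, z x = sin x * v' x := (memLp_sin_mul v').coeFn_toLp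
  have hp : ∀ᵐ x ∂muPi, parabola x = x * (π - x) := memLp_parabola.coeFn_toLp
  have hR : ∀ᵐ x ∂muPi, (v + b • z + c • parabola : L2Pi) x =
      v x + b * (sin x * v' x) + c * (x * (π - x)) := by
    filter_upwards [hz, hp, Lp.coeFn_add (v + b • z) (c • parabola), Lp.coeFn_add v (b • z),
      Lp.coeFn_smul b z, Lp.coeFn_smul c parabola] with x h1 h2 h3 h4 h5 h6
    rw [h3, Pi.add_apply, h4, Pi.add_apply, h5, h6]
    simp [h1, h2]
  constructor
  · intro h
    refine Lp.ext ?_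
    filter_upwards [h, hR] with x h1 h2
    rw [h2]; linarith
  · intro h
    filter_upwards [hR] with x h2
    rw [h, h2]; ring

theorem sineCoeff_of_isImpulse {b c : ℝ} {v y : L2Pi} (h : IsImpulse b c v y) :
    sineCoeff y = jump b c (sineCoeff v) := by
  obtain ⟨-, v', hv', hae⟩ := h
  rw [isImpulse_iff_ae.1 hae]
  funext k
  simp only [sineCoeff_add, sineCoeff_smul, jump, Pi.add_apply, Pi.smul_apply, smul_eq_mul]
  rw [sineCoeff_sin_mul hv' (memLp_sin_mul v').coeFn_toLp]

/-- Membership in X^{1/2} provides both things asked of the pre-impulse state: zero boundary values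
and a weak derivative. -/
theorem isImpulse_of_sineCoeff {b c : ℝ} {v y : L2Pi} (hv : wnorm (1 / 2) (sineCoeff v) ≠ ⊤)
    (h : sineCoeff y = jump b c (sineCoeff v)) : IsImpulse b c v y := by
  obtain ⟨v', hv', -⟩ := exists_weakDeriv hv
  refine ⟨vanishesAtEnds_of_wnorm hv, v', hv', isImpulse_iff_ae.2 (ext_sineCoeff fun k => ?_)⟩
  rw [h]
  simp only [sineCoeff_add, sineCoeff_smul, jump, Pi.add_apply, Pi.smul_apply, smul_eq_mul]
  rw [sineCoeff_sin_mul hv' (memLp_sin_mul v').coeFn_toLp]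

/-! ### The heat semigroup on coefficients -/

/-- The heat semigroup in the sine basis. -/
def heat (t : ℝ) (a : ℕ → ℝ) (k : ℕ) : ℝ := exp (-(((k : ℝ) + 1) ^ 2 * t)) * a k

theorem heat_add (t : ℝ) (a b : ℕ → ℝ) : heat t (a + b) = heat t a + heat t b :=
  funext fun k => by simp [heat, mul_add]

theorem heat_sub (t : ℝ) (a b : ℕ → ℝ) : heat t (a - b) = heat t a - heat t b :=
  funext fun k => by simp [heat, mul_sub]

theorem heat_smul (t c : ℝ) (a : ℕ → ℝ) : heat t (c • a) = c • heat t a :=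
  funext fun k => by simp [heat, mul_left_comm]

theorem heat_heat (s t : ℝ) (a : ℕ → ℝ) : heat s (heat t a) = heat (s + t) a :=
  funext fun k => by
    rw [heat, heat, heat, ← mul_assoc, ← exp_add]
    ring_nf

@[simp] theorem heat_zero (a : ℕ → ℝ) : heat 0 a = a :=
  funext fun k => by simp [heat]

theorem rpow_mul_exp_neg_le {x γ : ℝ} (hx : 0 ≤ x) (h0 : 0 ≤ γ) (h2 : γ ≤ 2) :
    x ^ γ * exp (-x) ≤ 2 := by
  rw [exp_neg, mul_inv_le_iff₀ (exp_pos x)]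
  rcases le_total x 1 with h | h
  · have := rpow_le_one hx h h0
    have := one_le_exp hx
    linarith
  -- For x ≥ 1 the bound is x^γ ≤ x² ≤ 2(1 + x + x²/2) ≤ 2 e^x; this is the origin of the constant
  -- 2.
  · have h3 := rpow_le_rpow_of_exponent_le h h2
    rw [rpow_two] at h3
    have := quadratic_le_exp_of_nonneg hx
    linarith

theorem sq_rpow_nat (k : ℕ) (δ : ℝ) : (((k : ℝ) + 1) ^ 2) ^ δ = ((k : ℝ) + 1) ^ (2 * δ) := by
  rw [rpow_mul (by positivity), rpow_two]

theorem rpow_mul_exp_le {δ t : ℝ} (ht : 0 < t) (h0 : 0 ≤ δ) (h2 : δ ≤ 2) (k : ℕ) :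
    ((k : ℝ) + 1) ^ (2 * δ) * exp (-(((k : ℝ) + 1) ^ 2 * t)) ≤ 2 * t ^ (-δ) := by
  have h := rpow_mul_exp_neg_le (x := ((k : ℝ) + 1) ^ 2 * t) (by positivity) h0 h2
  rw [mul_rpow (by positivity) ht.le, sq_rpow_nat] at h
  rw [rpow_neg ht.le, ← div_eq_mul_inv, le_div_iff₀ (by positivity)]
  linarith

theorem wnorm_heat_le {β δ t : ℝ} (ht : 0 < t) (h0 : 0 ≤ δ) (h2 : δ ≤ 2) (a : ℕ → ℝ) :
    wnorm (β + δ) (heat t a) ≤ ENNReal.ofReal (2 * t ^ (-δ)) * wnorm β a := by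
  refine wnorm_le_of_le fun k => ?_
  rw [heat, abs_mul, abs_of_nonneg (exp_pos _).le, mul_add, rpow_add (by positivity)]
  have := mul_le_mul_of_nonneg_right (rpow_mul_exp_le ht h0 h2 k)
    (show 0 ≤ ((k : ℝ) + 1) ^ (2 * β) * |a k| by positivity)
  linarith

theorem wnorm_heat_le_self {t : ℝ} (ht : 0 ≤ t) (β : ℝ) (a : ℕ → ℝ) :
    wnorm β (heat t a) ≤ wnorm β a := by
  refine (wnorm_le_of_le (C := 1) (γ := β) (b := a) fun k => ?_).trans (by simp)
  rw [heat, abs_mul, abs_of_nonneg (exp_pos _).le, one_mul]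
  gcongr
  refine mul_le_of_le_one_left (abs_nonneg _) (exp_le_one_iff.2 ?_)
  have : 0 ≤ ((k : ℝ) + 1) ^ 2 * t := by positivity
  linarith

/-- The gap 1/2 enters here: for t ≥ 1/2 one has k + 1 ≤ 1 + ((k+1)² - 1) t ≤ exp(((k+1)² - 1) t).
The constant is exactly e^{-t}, so the smoothing loses nothing in the contraction rate. -/
theorem wnorm_half_heat_le {t : ℝ} (ht : 1 / 2 ≤ t) (a : ℕ → ℝ) :
    wnorm (1 / 2) (heat t a) ≤ ENNReal.ofReal (exp (-t)) * wnorm 0 a := by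
  refine wnorm_le_of_le fun k => ?_
  rw [heat, abs_mul, abs_of_nonneg (exp_pos _).le]
  norm_num
  rw [← mul_assoc]
  gcongr
  have hk : (0 : ℝ) ≤ k := k.cast_nonneg
  have h1 : (k : ℝ) + 1 ≤ exp ((((k : ℝ) + 1) ^ 2 - 1) * t) := by
    refine le_trans ?_ (add_one_le_exp _)
    nlinarith [mul_nonneg (by positivity : (0 : ℝ) ≤ k ^ 2 + 2 * k) (sub_nonneg.2 ht)]
  calc ((k : ℝ) + 1) * exp (-(((k : ℝ) + 1) ^ 2 * t))
      ≤ exp ((((k : ℝ) + 1) ^ 2 - 1) * t) * exp (-(((k : ℝ) + 1) ^ 2 * t)) := by gcongr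
    _ = exp (-t) := by rw [← exp_add]; ring_nf

/-- On each mode 1 - e^{-x} ≤ min(1, x) ≤ x^γ, with x = (k+1)² t. -/
theorem wnorm_heat_sub_le {β γ t : ℝ} (ht : 0 ≤ t) (h0 : 0 ≤ γ) (h1 : γ ≤ 1) (a : ℕ → ℝ) :
    wnorm β (heat t a - a) ≤ ENNReal.ofReal (t ^ γ) * wnorm (β + γ) a := by
  refine wnorm_le_of_le fun k => ?_
  have hx : 0 ≤ ((k : ℝ) + 1) ^ 2 * t := by positivity
  have e1 : (heat t a - a) k = -((1 - exp (-(((k : ℝ) + 1) ^ 2 * t))) * a k) := by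
    simp only [Pi.sub_apply, heat]; ring
  have h2 : 1 - exp (-(((k : ℝ) + 1) ^ 2 * t)) ≤ t ^ γ * ((k : ℝ) + 1) ^ (2 * γ) := by
    rw [← sq_rpow_nat, mul_comm (t ^ γ), ← mul_rpow (by positivity) ht]
    rcases le_total (((k : ℝ) + 1) ^ 2 * t) 1 with h | h
    · have h3 : ((k : ℝ) + 1) ^ 2 * t ≤ (((k : ℝ) + 1) ^ 2 * t) ^ γ := by
        rcases hx.eq_or_lt with h4 | h4
        · rw [← h4]; positivity
        · simpa using rpow_le_rpow_of_exponent_ge h4 h h1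
      linarith [add_one_le_exp (-(((k : ℝ) + 1) ^ 2 * t))]
    · have := one_le_rpow h h0
      linarith [exp_pos (-(((k : ℝ) + 1) ^ 2 * t))]
  have h3 : 0 ≤ 1 - exp (-(((k : ℝ) + 1) ^ 2 * t)) := by
    linarith [exp_le_one_iff.2 (neg_nonpos.2 hx)]
  rw [e1, abs_neg, abs_mul, abs_of_nonneg h3, mul_add, rpow_add (by positivity)]
  have := mul_le_mul_of_nonneg_right h2
    (show 0 ≤ ((k : ℝ) + 1) ^ (2 * β) * |a k| by positivity)
  linarith

/-- Continuity in time of the heat semigroup at positive times, in every weighted norm. -/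
theorem wnorm_heat_sub_heat_le {β δ m s t : ℝ} (hm : 0 < m) (hs : m ≤ s) (ht : m ≤ t)
    (h0 : 0 ≤ δ) (h1 : δ ≤ 1) (a : ℕ → ℝ) :
    wnorm (β + δ) (heat s a - heat t a) ≤
      ENNReal.ofReal |s - t| * (ENNReal.ofReal (2 * m ^ (-(δ + 1))) * wnorm β a) := by
  wlog hst : t ≤ s generalizing s t
  · rw [wnorm_sub_comm, abs_sub_comm]
    exact this ht hs (le_of_not_ge hst)
  -- The time `m` common to both flows does the smoothing, and the remaining increment is Lipschitz
  -- in s - t at the price of one more power of A.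
  have e1 : heat s a - heat t a = heat (t - m) (heat (s - t) (heat m a) - heat m a) := by
    rw [heat_sub, heat_heat, heat_heat, heat_heat]
    congr 2 <;> ring
  rw [e1]
  refine (wnorm_heat_le_self (by linarith) _ _).trans ?_
  refine (wnorm_heat_sub_le (γ := 1) (by linarith) zero_le_one le_rfl _).trans ?_
  rw [rpow_one, abs_of_nonneg (by linarith), add_assoc]
  gcongr
  exact wnorm_heat_le hm (by linarith) (by linarith) a

/-! ### Bounds for `(sin x) u_x` -/

theorem sinDeriv_sub (a b : ℕ → ℝ) : sinDeriv (a - b) = sinDeriv a - sinDeriv b :=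
  funext fun k => by simp only [sinDeriv, Pi.sub_apply]; ring

theorem jump_sub (b c : ℝ) (x y : ℕ → ℝ) :
    jump b c x - jump b c y = (x - y) + b • sinDeriv (x - y) := by
  rw [jump, jump, sinDeriv_sub, smul_sub]
  abel

theorem eLpNorm_shift_down_le (g : ℕ → ℝ) :
    eLpNorm (fun k => g (k + 1)) 2 Measure.count ≤ eLpNorm g 2 Measure.count := by
  simp only [eLpNorm_eq_lintegral_rpow_enorm_toReal (p := 2) (by norm_num) (by norm_num),
    lintegral_count]
  refine ENNReal.rpow_le_rpow ?_ (by positivity)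
  exact ENNReal.tsum_comp_le_tsum_of_injective (add_left_injective 1) (fun k => ‖g k‖ₑ ^ _)

theorem eLpNorm_shift_up_le (g : ℕ → ℝ) :
    eLpNorm (fun k => if k = 0 then 0 else g (k - 1)) 2 Measure.count ≤
      eLpNorm g 2 Measure.count := by
  simp only [eLpNorm_eq_lintegral_rpow_enorm_toReal (p := 2) (by norm_num) (by norm_num),
    lintegral_count]
  refine ENNReal.rpow_le_rpow ?_ (by positivity)
  rw [tsum_eq_zero_add' ENNReal.summable]
  simp

/-- The operator is half the difference of two weighted shifts, each bounded by K: `h1` controls the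
transfer of a mode one place up, `h2` one place down. -/
theorem wnorm_sinDeriv_le {α K : ℝ} (hK : 0 ≤ K)
    (h1 : ∀ k : ℕ, ((k : ℝ) + 2) ^ (2 * α) * ((k : ℝ) + 1) ≤ K * ((k : ℝ) + 1) ^ (2 * (α + 1 / 2)))
    (h2 : ∀ k : ℕ, ((k : ℝ) + 1) ^ (2 * α) * ((k : ℝ) + 2) ≤ K * ((k : ℝ) + 2) ^ (2 * (α + 1 / 2)))
    (a : ℕ → ℝ) : wnorm α (sinDeriv a) ≤ ENNReal.ofReal K * wnorm (α + 1 / 2) a := by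
  set g : ℕ → ℝ := fun k => ((k : ℝ) + 1) ^ (2 * (α + 1 / 2)) * |a k|
  have hg : eLpNorm g 2 Measure.count = wnorm (α + 1 / 2) a := by
    refine eLpNorm_congr_norm_ae (Eventually.of_forall fun k => ?_)
    simp [g]
  have hg0 : ∀ k, 0 ≤ g k := fun k => by positivity
  have h3 : wnorm α (sinDeriv a) ≤ ENNReal.ofReal (K / 2) *
      eLpNorm ((fun k => if k = 0 then 0 else g (k - 1)) + fun k => g (k + 1)) 2
        Measure.count := by
    refine eLpNorm_le_mul_eLpNorm_of_ae_le_mul (Eventually.of_forall fun k => ?_) 2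
    have hnn : 0 ≤ ((fun k => if k = 0 then 0 else g (k - 1)) + fun k => g (k + 1)) k := by
      simp only [Pi.add_apply]
      split_ifs
      · linarith [hg0 (k + 1)]
      · linarith [hg0 (k + 1), hg0 (k - 1)]
    have hp : 0 ≤ ((k : ℝ) + 1) ^ (2 * α) := by positivity
    rw [norm_mul, Real.norm_of_nonneg hp, Real.norm_of_nonneg hnn, sinDeriv, Real.norm_eq_abs]
    simp only [Pi.add_apply]
    have h4 : ((k : ℝ) + 1) ^ (2 * α) * (((k : ℝ) + 2) * |a (k + 1)|) ≤ K * g (k + 1) := by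
      have := mul_le_mul_of_nonneg_right (h2 k) (abs_nonneg (a (k + 1)))
      simp only [g]
      push_cast
      rw [show (k : ℝ) + 1 + 1 = k + 2 by ring]
      linarith
    have h5 : ((k : ℝ) + 1) ^ (2 * α) * ((k : ℝ) * |a (k - 1)|) ≤
        K * (if k = 0 then 0 else g (k - 1)) := by
      rcases k with _ | k
      · simp
      · have := mul_le_mul_of_nonneg_right (h1 k) (abs_nonneg (a k))
        simp only [Nat.add_sub_cancel, Nat.add_eq_zero_iff, one_ne_zero, and_false, if_false, g]
        push_cast
        rw [show (k : ℝ) + 1 + 1 = k + 2 by ring]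
        linarith
    have h6 : |((k : ℝ) * a (k - 1) - ((k : ℝ) + 2) * a (k + 1)) / 2| ≤
        ((k : ℝ) * |a (k - 1)| + ((k : ℝ) + 2) * |a (k + 1)|) / 2 := by
      rw [abs_div, abs_two]
      gcongr
      refine (abs_sub _ _).trans (le_of_eq ?_)
      rw [abs_mul, abs_mul, Nat.abs_cast, abs_of_nonneg (by positivity : (0 : ℝ) ≤ k + 2)]
    have h7 := mul_le_mul_of_nonneg_left h6 hp
    linarith
  refine h3.trans ?_
  calc _ ≤ ENNReal.ofReal (K / 2) * (wnorm (α + 1 / 2) a + wnorm (α + 1 / 2) a) := by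
        gcongr
        refine (eLpNorm_add_le aestronglyMeasurable_count aestronglyMeasurable_count
          one_le_two).trans ?_
        rw [← hg]
        exact add_le_add (eLpNorm_shift_up_le g) (eLpNorm_shift_down_le g)
    _ = _ := by
        rw [← two_mul, ← mul_assoc]
        congr 1
        rw [show (2 : ℝ≥0∞) = ENNReal.ofReal 2 by simp, ← ENNReal.ofReal_mul (by positivity)]
        congr 1; ring

/-- The coefficient form of |sin x| ≤ 1. The constant 1 matters: it yields the factor 1 + b of the
theorem. -/
theorem wnorm_zero_sinDeriv_le (a : ℕ → ℝ) : wnorm 0 (sinDeriv a) ≤ wnorm (1 / 2) a := by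
  have := wnorm_sinDeriv_le (α := 0) (K := 1) zero_le_one (fun k => by norm_num)
    (fun k => by norm_num) a
  simpa using this

/-- Neighbouring frequencies differ by a factor at most 2 and |2α| ≤ 1, so changing the weight costs
at most 2. Negative α is needed for impulses acting on states known only in L². -/
theorem wnorm_sinDeriv_le_two {α : ℝ} (h1 : -(1 / 2) ≤ α) (h2 : α ≤ 1 / 2) (a : ℕ → ℝ) :
    wnorm α (sinDeriv a) ≤ 2 * wnorm (α + 1 / 2) a := by
  have key : ∀ x y : ℝ, 0 < x → 0 < y → x ≤ 2 * y → y ≤ 2 * x →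
      x ^ (2 * α) * y ≤ 2 * y ^ (2 * (α + 1 / 2)) := by
    intro x y hx hy hxy hyx
    rw [show 2 * (α + 1 / 2) = 2 * α + 1 by ring, rpow_add hy, rpow_one, ← mul_assoc]
    gcongr
    rcases le_total 0 α with h | h
    · calc x ^ (2 * α) ≤ (2 * y) ^ (2 * α) := by gcongr
        _ = 2 ^ (2 * α) * y ^ (2 * α) := mul_rpow zero_le_two hy.le
        _ ≤ 2 ^ (1 : ℝ) * y ^ (2 * α) := by gcongr <;> linarith
        _ = _ := by simp
    · have e : ∀ z : ℝ, 0 < z → z ^ (2 * α) = (z ^ (-(2 * α)))⁻¹ := fun z hz => by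
        rw [rpow_neg hz.le, inv_inv]
      rw [e x hx, e y hy, ← div_eq_mul_inv, le_div_iff₀ (by positivity),
        inv_mul_le_iff₀ (by positivity)]
      calc y ^ (-(2 * α)) ≤ (2 * x) ^ (-(2 * α)) := by
            gcongr; linarith
        _ = 2 ^ (-(2 * α)) * x ^ (-(2 * α)) := mul_rpow zero_le_two hx.le
        _ ≤ 2 ^ (1 : ℝ) * x ^ (-(2 * α)) := by gcongr <;> linarith
        _ = _ := by rw [rpow_one]; ring
  have := wnorm_sinDeriv_le (α := α) (K := 2) zero_le_two
    (fun k => key _ _ (by positivity) (by positivity) (by linarith [k.cast_nonneg (α := ℝ)])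
      (by linarith [k.cast_nonneg (α := ℝ)]))
    (fun k => key _ _ (by positivity) (by positivity) (by linarith [k.cast_nonneg (α := ℝ)])
      (by linarith [k.cast_nonneg (α := ℝ)])) a
  simpa using this

/-! ### The Duhamel integral -/

/-- The coefficients of `∫ s in a..t, e^{-A (t - s)} f s`. -/
def duhamel (f : ℝ → L2Pi) (a t : ℝ) (k : ℕ) : ℝ :=
  ∫ s in a..t, exp (-(((k : ℝ) + 1) ^ 2 * (t - s))) * sineCoeff (f s) k

theorem lintegral_exp_le {l : ℝ} (hl : 0 < l) (a t : ℝ) :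
    ∫⁻ s in Ioo a t, ENNReal.ofReal (exp (-(l * (t - s)))) ≤ ENNReal.ofReal (1 / l) := by
  rcases le_total t a with h | h
  · simp [Ioo_eq_empty_of_le h]
  have hc : Continuous fun s => exp (-(l * (t - s))) := by fun_prop
  have hi : IntegrableOn (fun s => exp (-(l * (t - s)))) (Ioo a t) :=
    (hc.integrableOn_Icc).mono_set Ioo_subset_Icc_self
  rw [← ofReal_integral_eq_lintegral_ofReal hi (Eventually.of_forall fun s => (exp_pos _).le)]
  apply ENNReal.ofReal_le_ofReal
  rw [← integral_Ioc_eq_integral_Ioo, ← intervalIntegral.integral_of_le h]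
  have hd : ∀ s, HasDerivAt (fun s => exp (-(l * (t - s))) / l) (exp (-(l * (t - s)))) s := by
    intro s
    have h1 : HasDerivAt (fun s => exp (-(l * (t - s))) / l)
        (exp (-(l * (t - s))) * (-(l * (-1))) / l) s :=
      (((hasDerivAt_id s).const_sub t).const_mul l).neg.exp.div_const l
    convert h1 using 1
    field_simp
  rw [intervalIntegral.integral_eq_sub_of_hasDerivAt (fun s _ => hd s)
    (hc.intervalIntegrable _ _)]
  rw [sub_self, mul_zero, neg_zero, exp_zero]
  have : 0 ≤ exp (-(l * (t - a))) / l := by positivity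
  linarith

theorem aemeasurable_sineCoeff {f : ℝ → L2Pi} {μ : Measure ℝ} (hf : AEStronglyMeasurable f μ)
    (k : ℕ) : AEMeasurable (fun s => sineCoeff (f s) k) μ :=
  ((continuous_sineCoeff k).comp_aestronglyMeasurable hf).aemeasurable

theorem tsum_enorm_sineCoeff (u : L2Pi) : ∑' k, ‖sineCoeff u k‖ₑ ^ 2 = ‖u‖ₑ ^ 2 := by
  rw [enorm_eq_wnorm, wnorm_sq]
  simp

/-- Split the exponential into two equal halves and apply Cauchy–Schwarz: |∫ e^{-λ(t-s)} g|² ≤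
λ^{-1} ∫ e^{-λ(t-s)} |g|² with λ = (k+1)². The power of λ that remains after the factor 1/λ is
absorbed by the exponential, leaving (t-s)^{-(2β-1)}. -/
theorem enorm_duhamel_sq_le {f : ℝ → L2Pi} {a t β : ℝ} (hat : a ≤ t)
    (hf : AEStronglyMeasurable f (volume.restrict (Ioo a t))) (h1 : 1 / 2 ≤ β) (h2 : β ≤ 3 / 2)
    (k : ℕ) :
    ‖((k : ℝ) + 1) ^ (2 * β) * duhamel f a t k‖ₑ ^ 2 ≤
      ∫⁻ s in Ioo a t, 2 * ENNReal.ofReal ((t - s) ^ (-(2 * β - 1))) *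
        ‖sineCoeff (f s) k‖ₑ ^ 2 := by
  set l : ℝ := ((k : ℝ) + 1) ^ 2 with hl
  have hl0 : 0 < l := by positivity
  have hfm := aemeasurable_sineCoeff hf k
  have hhalf : ∀ s, ENNReal.ofReal (exp (-(l * (t - s)))) =
      ENNReal.ofReal (exp (-(l * (t - s)) / 2)) ^ 2 := by
    intro s
    rw [← ENNReal.ofReal_pow (exp_pos _).le, ← exp_nat_mul]
    congr 2
    push_cast; ring
  have hmeas : AEMeasurable (fun s => ENNReal.ofReal (exp (-(l * (t - s)) / 2)))
      (volume.restrict (Ioo a t)) := by fun_prop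
  have hd : ‖duhamel f a t k‖ₑ ≤ ∫⁻ s in Ioo a t,
      ENNReal.ofReal (exp (-(l * (t - s)) / 2)) *
        (ENNReal.ofReal (exp (-(l * (t - s)) / 2)) * ‖sineCoeff (f s) k‖ₑ) := by
    rw [duhamel, intervalIntegral.integral_of_le hat, integral_Ioc_eq_integral_Ioo]
    refine (enorm_integral_le_lintegral_enorm _).trans (le_of_eq ?_)
    refine lintegral_congr fun s => ?_
    rw [enorm_mul, ← mul_assoc, ← sq, ← hhalf, Real.enorm_of_nonneg (exp_pos _).le]
  have hcs : ‖duhamel f a t k‖ₑ ^ 2 ≤ ENNReal.ofReal (1 / l) *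
      ∫⁻ s in Ioo a t, ENNReal.ofReal (exp (-(l * (t - s)))) * ‖sineCoeff (f s) k‖ₑ ^ 2 := by
    have hH := ENNReal.lintegral_mul_le_Lp_mul_Lq (volume.restrict (Ioo a t))
      Real.HolderConjugate.two_two hmeas (hmeas.mul hfm.enorm)
    simp only [Pi.mul_apply, ENNReal.rpow_two, mul_pow, ← hhalf] at hH
    calc ‖duhamel f a t k‖ₑ ^ 2 ≤ ((∫⁻ s in Ioo a t, ENNReal.ofReal (exp (-(l * (t - s))))) ^
            (1 / 2 : ℝ) * (∫⁻ s in Ioo a t, ENNReal.ofReal (exp (-(l * (t - s)))) *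
              ‖sineCoeff (f s) k‖ₑ ^ 2) ^ (1 / 2 : ℝ)) ^ 2 := by
          gcongr
          exact hd.trans hH
      _ = (∫⁻ s in Ioo a t, ENNReal.ofReal (exp (-(l * (t - s))))) *
          ∫⁻ s in Ioo a t, ENNReal.ofReal (exp (-(l * (t - s)))) *
              ‖sineCoeff (f s) k‖ₑ ^ 2 := by
          rw [mul_pow, ← ENNReal.rpow_natCast, ← ENNReal.rpow_natCast, ← ENNReal.rpow_mul,
            ← ENNReal.rpow_mul]
          norm_num
      _ ≤ _ := by
          gcongr
          exact lintegral_exp_le hl0 a t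
  have hw : ‖((k : ℝ) + 1) ^ (2 * β)‖ₑ ^ 2 * ENNReal.ofReal (1 / l) =
      ENNReal.ofReal (((k : ℝ) + 1) ^ (2 * (2 * β - 1))) := by
    rw [Real.enorm_of_nonneg (by positivity), ← ENNReal.ofReal_pow (by positivity),
      ← ENNReal.ofReal_mul (by positivity)]
    congr 1
    rw [hl, ← rpow_natCast, ← rpow_mul (by positivity), mul_sub, rpow_sub (by positivity),
      mul_one, rpow_two, mul_one_div]
    congr 2
    push_cast; ring
  rw [enorm_mul, mul_pow]
  refine (mul_le_mul_right hcs _).trans ?_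
  rw [← mul_assoc, hw, ← lintegral_const_mul' _ _ ENNReal.ofReal_ne_top]
  refine setLIntegral_mono' measurableSet_Ioo fun s hs => ?_
  rw [← mul_assoc]
  refine mul_le_mul' ?_ le_rfl
  rw [← ENNReal.ofReal_mul (by positivity), show (2 : ℝ≥0∞) = ENNReal.ofReal 2 by simp,
    ← ENNReal.ofReal_mul zero_le_two]
  exact ENNReal.ofReal_le_ofReal
    (rpow_mul_exp_le (sub_pos.2 hs.2) (by linarith) (by linarith) k)

/-- Smoothing by the Duhamel integral. -/
theorem wnorm_duhamel_sq_le {f : ℝ → L2Pi} {a t β : ℝ} (hat : a ≤ t)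
    (hf : AEStronglyMeasurable f (volume.restrict (Ioo a t))) (h1 : 1 / 2 ≤ β) (h2 : β ≤ 3 / 2) :
    wnorm β (duhamel f a t) ^ 2 ≤
      ∫⁻ s in Ioo a t, 2 * ENNReal.ofReal ((t - s) ^ (-(2 * β - 1))) * ‖f s‖ₑ ^ 2 := by
  rw [wnorm_sq]
  calc _ ≤ ∑' k, ∫⁻ s in Ioo a t, 2 * ENNReal.ofReal ((t - s) ^ (-(2 * β - 1))) *
        ‖sineCoeff (f s) k‖ₑ ^ 2 :=
        ENNReal.tsum_le_tsum fun k => enorm_duhamel_sq_le hat hf h1 h2 k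
    _ = ∫⁻ s in Ioo a t, ∑' k, 2 * ENNReal.ofReal ((t - s) ^ (-(2 * β - 1))) *
        ‖sineCoeff (f s) k‖ₑ ^ 2 := by
        rw [lintegral_tsum]
        intro k
        have := (aemeasurable_sineCoeff hf k).enorm
        fun_prop
    _ = _ := by
        refine lintegral_congr fun s => ?_
        rw [ENNReal.tsum_mul_left, tsum_enorm_sineCoeff]

/-- At β = 1/2 the kernel is constant and only the time integral of ‖f‖² counts, so a bounded error
on a short time set costs little. -/
theorem wnorm_half_duhamel_sq_le {f : ℝ → L2Pi} {a t : ℝ} (hat : a ≤ t)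
    (hf : AEStronglyMeasurable f (volume.restrict (Ioo a t))) :
    wnorm (1 / 2) (duhamel f a t) ^ 2 ≤ 2 * ∫⁻ s in Ioo a t, ‖f s‖ₑ ^ 2 := by
  refine (wnorm_duhamel_sq_le hat hf le_rfl (by norm_num)).trans (le_of_eq ?_)
  rw [← lintegral_const_mul' _ _ (by simp)]
  norm_num

/-- The integral of `σ^{-γ}` over `(0, H)`. -/
def kernelMass (γ H : ℝ) : ℝ≥0∞ := ∫⁻ s in Ioo 0 H, ENNReal.ofReal (s ^ (-γ))

theorem kernelMass_ne_top {γ : ℝ} (hγ : γ < 1) (H : ℝ) : kernelMass γ H ≠ ⊤ := by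
  rcases le_total H 0 with h | h
  · simp [kernelMass, Ioo_eq_empty_of_le h]
  have hi : IntegrableOn (fun s : ℝ => s ^ (-γ)) (Ioo 0 H) := by
    have := intervalIntegral.intervalIntegrable_rpow' (a := 0) (b := H) (r := -γ) (by linarith)
    rwa [intervalIntegrable_iff_integrableOn_Ioo_of_le h] at this
  rw [kernelMass, ← ofReal_integral_eq_lintegral_ofReal hi]
  · exact ENNReal.ofReal_ne_top
  · filter_upwards [ae_restrict_mem measurableSet_Ioo] with s hs
    exact rpow_nonneg hs.1.le _

theorem lintegral_kernel_eq (γ a t : ℝ) :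
    ∫⁻ s in Ioo a t, ENNReal.ofReal ((t - s) ^ (-γ)) = kernelMass γ (t - a) := by
  rw [kernelMass, ← lintegral_indicator measurableSet_Ioo, ← lintegral_indicator measurableSet_Ioo,
    ← lintegral_sub_left_eq_self _ t]
  refine lintegral_congr fun s => ?_
  by_cases hs : t - s ∈ Ioo a t
  · rw [indicator_of_mem hs, indicator_of_mem, sub_sub_cancel]
    exact ⟨by linarith [hs.2], by linarith [hs.1]⟩
  · rw [indicator_of_notMem hs, indicator_of_notMem]
    exact fun h => hs ⟨by linarith [h.2], by linarith [h.1]⟩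

theorem kernelMass_mono (γ : ℝ) {H H' : ℝ} (h : H ≤ H') : kernelMass γ H ≤ kernelMass γ H' :=
  lintegral_mono_set (Ioo_subset_Ioo_right h)

/-- The exponent γ lets f soften the kernel: γ = 2β - 1 for bounded f, smaller when f vanishes at
the endpoint like a Hölder difference. -/
theorem wnorm_duhamel_sq_le_of_bound {f : ℝ → L2Pi} {a t β γ : ℝ} {K : ℝ≥0} (hat : a ≤ t)
    (hf : AEStronglyMeasurable f (volume.restrict (Ioo a t))) (h1 : 1 / 2 ≤ β) (h2 : β ≤ 3 / 2)
    (hK : ∀ s ∈ Ioo a t, ENNReal.ofReal ((t - s) ^ (-(2 * β - 1))) * ‖f s‖ₑ ^ 2 ≤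
      K * ENNReal.ofReal ((t - s) ^ (-γ))) :
    wnorm β (duhamel f a t) ^ 2 ≤ 2 * K * kernelMass γ (t - a) := by
  refine (wnorm_duhamel_sq_le hat hf h1 h2).trans ?_
  rw [← lintegral_kernel_eq, ← lintegral_const_mul' _ _ (by finiteness)]
  refine setLIntegral_mono' measurableSet_Ioo fun s hs => ?_
  rw [mul_assoc, mul_assoc]
  exact mul_le_mul_right (hK s hs) 2

theorem intervalIntegrable_duhamel {f : ℝ → L2Pi} {K : ℝ} (hfm : AEStronglyMeasurable f volume)
    (hK : ∀ s, ‖f s‖ ≤ K) (k : ℕ) (t a b : ℝ) :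
    IntervalIntegrable (fun s => exp (-(((k : ℝ) + 1) ^ 2 * (t - s))) * sineCoeff (f s) k)
      volume a b := by
  have h1 : IntervalIntegrable (fun s => sineCoeff (f s) k) volume a b := by
    rw [intervalIntegrable_iff]
    refine Measure.integrableOn_of_bounded (M := K) (by simp)
      (aemeasurable_sineCoeff hfm k).aestronglyMeasurable (Eventually.of_forall fun s => ?_)
    refine le_trans ?_ (hK s)
    have := abs_real_inner_le_norm (sineFun k) (f s)
    rwa [orthonormal_sineFun.1 k, one_mul] at this
  exact h1.continuousOn_mul (by fun_prop)

theorem duhamel_eq_add {f : ℝ → L2Pi} {K : ℝ} (hfm : AEStronglyMeasurable f volume)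
    (hK : ∀ s, ‖f s‖ ≤ K) (a s t : ℝ) :
    duhamel f a t = heat (t - s) (duhamel f a s) + duhamel f s t := by
  funext k
  have hi := intervalIntegrable_duhamel hfm hK k t
  rw [Pi.add_apply, heat, duhamel, duhamel, duhamel,
    ← intervalIntegral.integral_add_adjacent_intervals (hi a s) (hi s t),
    ← intervalIntegral.integral_const_mul]
  congr 1
  refine intervalIntegral.integral_congr fun x _ => ?_
  rw [← mul_assoc, ← exp_add]
  congr 2
  ring

theorem duhamel_sub {f g : ℝ → L2Pi} {K K' : ℝ} (hfm : AEStronglyMeasurable f volume)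
    (hK : ∀ s, ‖f s‖ ≤ K) (hgm : AEStronglyMeasurable g volume) (hK' : ∀ s, ‖g s‖ ≤ K')
    (a t : ℝ) : duhamel (f - g) a t = duhamel f a t - duhamel g a t := by
  funext k
  rw [Pi.sub_apply, duhamel, duhamel, duhamel, ← intervalIntegral.integral_sub
    (intervalIntegrable_duhamel hfm hK k t a t) (intervalIntegrable_duhamel hgm hK' k t a t)]
  refine intervalIntegral.integral_congr fun x _ => ?_
  simp only [Pi.sub_apply, sineCoeff_sub]
  ring

theorem duhamel_translate (f : ℝ → L2Pi) (a t r : ℝ) :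
    duhamel f (a + r) (t + r) = duhamel (fun s => f (s + r)) a t := by
  funext k
  rw [duhamel, duhamel, ← intervalIntegral.integral_comp_add_right]
  refine intervalIntegral.integral_congr fun x _ => ?_
  congr 3
  ring

theorem hasDerivAt_duhamel {f : ℝ → L2Pi} {K : ℝ} (hfm : AEStronglyMeasurable f volume)
    (hK : ∀ s, ‖f s‖ ≤ K) (a : ℝ) {t : ℝ} (hc : ContinuousAt f t) (k : ℕ) :
    HasDerivAt (fun t => duhamel f a t k)
      (-((k : ℝ) + 1) ^ 2 * duhamel f a t k + sineCoeff (f t) k) t := by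
  set l : ℝ := ((k : ℝ) + 1) ^ 2
  have e : ∀ t, duhamel f a t k =
      exp (-(l * t)) * ∫ s in a..t, exp (-(l * (0 - s))) * sineCoeff (f s) k := by
    intro t
    rw [duhamel, ← intervalIntegral.integral_const_mul]
    refine intervalIntegral.integral_congr fun x _ => ?_
    rw [← mul_assoc, ← exp_add]
    congr 2
    ring
  have hm : AEStronglyMeasurable (fun s => exp (-(l * (0 - s))) * sineCoeff (f s) k) volume :=
    (by fun_prop : Continuous fun s => exp (-(l * (0 - s)))).aestronglyMeasurable.mul
      (aemeasurable_sineCoeff hfm k).aestronglyMeasurable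
  have hca : ContinuousAt (fun s => exp (-(l * (0 - s))) * sineCoeff (f s) k) t :=
    (by fun_prop : Continuous fun s => exp (-(l * (0 - s)))).continuousAt.mul
      ((continuous_sineCoeff k).continuousAt.comp hc)
  have h1 := intervalIntegral.integral_hasDerivAt_right
    (intervalIntegrable_duhamel hfm hK k 0 a t) hm.stronglyMeasurableAtFilter hca
  have h2 : HasDerivAt (fun t => exp (-(l * t))) (exp (-(l * t)) * (-(l * 1))) t :=
    ((hasDerivAt_id t).const_mul l).neg.exp
  have h3 := h2.mul h1
  have e' : (fun t => duhamel f a t k) =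
      (fun t => exp (-(l * t))) * fun t => ∫ s in a..t, exp (-(l * (0 - s))) * sineCoeff (f s) k :=
    funext e
  rw [e']
  refine h3.congr_deriv ?_
  rw [e t,  ← mul_assoc (exp (-(l * t))) (exp _), ← exp_add]
  have : -(l * t) + -(l * (0 - t)) = 0 := by ring
  rw [this, exp_zero]
  ring

/-! ### Impulse moments -/

theorem strictMono_of_gap {τ : ℤ → ℝ} (hgap : ∀ j : ℤ, 1 / 2 ≤ τ (j + 1) - τ j) : StrictMono τ :=
  strictMono_int_of_lt_succ fun j => by linarith [hgap j]

theorem gap_mul_le {τ : ℤ → ℝ} (hgap : ∀ j : ℤ, 1 / 2 ≤ τ (j + 1) - τ j) (k : ℤ) (n : ℕ) :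
    (n : ℝ) / 2 ≤ τ (k + n) - τ k := by
  induction n with
  | zero => simp
  | succ n ih =>
    have := hgap (k + n)
    push_cast
    rw [← add_assoc]
    linarith

theorem exists_index {τ : ℤ → ℝ} (hgap : ∀ j : ℤ, 1 / 2 ≤ τ (j + 1) - τ j) (t : ℝ) :
    ∃ j : ℤ, τ j ≤ t ∧ t < τ (j + 1) := by
  have hm := strictMono_of_gap hgap
  obtain ⟨n, hn⟩ := exists_nat_ge (2 * |t - τ 0| + 1)
  have h1 := gap_mul_le hgap 0 n
  have h2 := gap_mul_le hgap (-n) n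
  simp only [zero_add, neg_add_cancel] at h1 h2
  have h3 := abs_le.1 (le_refl |t - τ 0|)
  obtain ⟨j, hj, hj'⟩ := Int.exists_greatest_of_bdd (P := fun j => τ j ≤ t)
    ⟨n, fun z hz => hm.le_iff_le.1 (by linarith)⟩ ⟨-n, by linarith⟩
  refine ⟨j, hj, ?_⟩
  by_contra h
  have := hj' (j + 1) (not_lt.1 h)
  omega

theorem gap_le_of_lt {τ : ℤ → ℝ} (hgap : ∀ j : ℤ, 1 / 2 ≤ τ (j + 1) - τ j) {i j : ℤ}
    (hij : i < j) : 1 / 2 ≤ τ j - τ i := by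
  have := (strictMono_of_gap hgap).monotone (show i + 1 ≤ j by omega)
  linarith [hgap i]

theorem le_abs_sub_of_mem {τ : ℤ → ℝ} (hm : StrictMono τ) {j : ℤ} {t η : ℝ}
    (h1 : τ j + η ≤ t) (h2 : t ≤ τ (j + 1) - η) (k : ℤ) : η ≤ |t - τ k| := by
  rcases le_or_gt k j with h | h
  · have := hm.monotone h
    exact le_trans (by linarith) (le_abs_self _)
  · have := hm.monotone (show j + 1 ≤ k by omega)
    rw [abs_sub_comm]
    exact le_trans (by linarith) (le_abs_self _)

theorem exists_gap_bound {τ : ℤ → ℝ} (hτ : HasUniformlyAPDifferences τ) (hm : StrictMono τ) :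
    ∃ H : ℝ, ∀ k : ℤ, τ (k + 1) - τ k ≤ H := by
  obtain ⟨L, hL⟩ := hτ 1 one_pos
  refine ⟨1 + (τ (L + 1) - τ 0), fun k => ?_⟩
  -- The shift by `q` brings the index k into [0, L].
  obtain ⟨q, hq, h⟩ := hL (-k)
  have h1 := (abs_lt.1 (h 1 k)).1
  have h2 := hm.monotone (show k + q + 1 ≤ L + 1 by linarith [hq.2])
  have h3 := hm.monotone (show 0 ≤ k + q by linarith [hq.1])
  linarith

theorem sub_le_mul_gap {τ : ℤ → ℝ} {H : ℝ} (hH : ∀ k : ℤ, τ (k + 1) - τ k ≤ H) (k : ℤ) (n : ℕ) :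
    τ (k + n) - τ k ≤ n * H := by
  induction n with
  | zero => simp
  | succ n ih =>
    have := hH (k + n)
    push_cast
    rw [← add_assoc]
    linarith

/-- Pick an almost period q with k - L ≤ q ≤ k. The increments over j steps from 0 and from q differ
by less than 1, and replacing q by k moves each end by at most L H. -/
theorem exists_quasi_additive {τ : ℤ → ℝ} (hτ : HasUniformlyAPDifferences τ) (hm : StrictMono τ) :
    ∃ C : ℝ, 0 ≤ C ∧ ∀ k j : ℤ, |(τ (k + j) - τ k) - (τ j - τ 0)| ≤ C := by
  obtain ⟨H, hH⟩ := exists_gap_bound hτ hm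
  obtain ⟨L, hL⟩ := hτ 1 one_pos
  have hH0 : 0 ≤ H := by linarith [hH 0, hm (show (0 : ℤ) < 0 + 1 by norm_num)]
  have hL0 : 0 ≤ L := by
    obtain ⟨q, hq, -⟩ := hL 0
    linarith [hq.1, hq.2]
  have hL0' : (0 : ℝ) ≤ L := by exact_mod_cast hL0
  have hsh : ∀ i q : ℤ, q ≤ i → i ≤ q + L → 0 ≤ τ i - τ q ∧ τ i - τ q ≤ L * H := by
    intro i q h1 h2
    obtain ⟨n, rfl⟩ : ∃ n : ℕ, i = q + n := ⟨(i - q).toNat, by omega⟩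
    refine ⟨by linarith [hm.monotone h1], (sub_le_mul_gap hH q n).trans ?_⟩
    gcongr
    have : (n : ℤ) ≤ L := by omega
    exact_mod_cast this
  refine ⟨L * H + 1, by positivity, fun k j => ?_⟩
  obtain ⟨q, hq, h⟩ := hL (k - L)
  have h1 := abs_lt.1 (h j 0)
  rw [zero_add, zero_add] at h1
  have h2 := hsh k q (by linarith [hq.2]) (by linarith [hq.1])
  have h3 := hsh (k + j) (q + j) (by linarith [hq.2]) (by linarith [hq.1])
  rw [abs_le]
  constructor <;> linarith [h1.1, h1.2, h2.1, h2.2, h3.1, h3.2]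

/-- By quasi-additivity both τ_n - τ_0 + C and -(τ_n - τ_0) + C are subadditive. Fekete's limit
bounds each from one side, and the two limits are opposite because the quotients add up to 2C/n. So
the discrepancy is bounded, which is more than the existence of a density. -/
theorem exists_mean_gap {τ : ℤ → ℝ} (hτ : HasUniformlyAPDifferences τ)
    (hgap : ∀ j : ℤ, 1 / 2 ≤ τ (j + 1) - τ j) :
    ∃ a C : ℝ, 1 / 2 ≤ a ∧ 0 ≤ C ∧ ∀ (k : ℤ) (n : ℕ), |τ (k + n) - τ k - a * n| ≤ C := by
  have hm := strictMono_of_gap hgap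
  obtain ⟨C, hC0, hC⟩ := exists_quasi_additive hτ hm
  obtain ⟨H, hH⟩ := exists_gap_bound hτ hm
  have hC' : ∀ m n : ℕ, |(τ ((m + n : ℕ) : ℤ) - τ m) - (τ n - τ 0)| ≤ C := fun m n => by
    have := hC m n
    exact_mod_cast this
  have hu : Subadditive fun n : ℕ => τ n - τ 0 + C := fun m n => by
    linarith [(abs_le.1 (hC' m n)).2]
  have hv : Subadditive fun n : ℕ => -(τ n - τ 0) + C := fun m n => by
    linarith [(abs_le.1 (hC' m n)).1]
  have hlow : ∀ n : ℕ, (n : ℝ) / 2 ≤ τ n - τ 0 := fun n => by simpa using gap_mul_le hgap 0 n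
  have hup : ∀ n : ℕ, τ n - τ 0 ≤ n * H := fun n => by simpa using sub_le_mul_gap hH 0 n
  have hub : BddBelow (range fun n : ℕ => (τ n - τ 0 + C) / n) := by
    refine ⟨0, ?_⟩
    rintro _ ⟨n, rfl⟩
    have := hlow n
    have hn : (0 : ℝ) ≤ n := n.cast_nonneg
    exact div_nonneg (by linarith) hn
  have hvb : BddBelow (range fun n : ℕ => (-(τ n - τ 0) + C) / n) := by
    refine ⟨-|H|, ?_⟩
    rintro _ ⟨n, rfl⟩
    rcases n.eq_zero_or_pos with rfl | hn
    · simp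
    · have hn' : (0 : ℝ) < n := by exact_mod_cast hn
      simp only
      rw [le_div_iff₀ hn']
      have := hup n
      nlinarith [le_abs_self H]
  have t1 := hu.tendsto_lim hub
  have t2 := hv.tendsto_lim hvb
  have hlim : hv.lim = -hu.lim := by
    have t3 := t1.add t2
    have t4 : Tendsto (fun n : ℕ => 2 * C / (n : ℝ)) atTop (𝓝 0) :=
      tendsto_const_div_atTop_nhds_zero_nat _
    have : (fun n : ℕ => (τ n - τ 0 + C) / n + (-(τ n - τ 0) + C) / n) =
        fun n : ℕ => 2 * C / (n : ℝ) := funext fun n => by ring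
    rw [this] at t3
    linarith [tendsto_nhds_unique t3 t4]
  have hkey : ∀ n : ℕ, |τ n - τ 0 - hu.lim * n| ≤ C := by
    intro n
    rcases n.eq_zero_or_pos with rfl | hn
    · simpa using hC0
    · have hn' : (0 : ℝ) < n := by exact_mod_cast hn
      have h1 := hu.lim_le_div hub hn.ne'
      have h2 := hv.lim_le_div hvb hn.ne'
      rw [le_div_iff₀ hn'] at h1 h2
      rw [hlim] at h2
      rw [abs_le]
      constructor <;> linarith
  -- One C comes from the discrepancy at base point 0, the other from moving the base point to k.
  refine ⟨hu.lim, 2 * C, ?_, by positivity, fun k n => ?_⟩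
  · refine ge_of_tendsto t1 ?_
    filter_upwards [eventually_gt_atTop 0] with n hn
    have hn' : (0 : ℝ) < n := by exact_mod_cast hn
    rw [le_div_iff₀ hn']
    linarith [hlow n]
  · have h1 := abs_le.1 (hC k n)
    have h2 := abs_le.1 (hkey n)
    rw [abs_le]
    constructor <;> linarith [h1.1, h1.2, h2.1, h2.2]

/-- The points counted are those with indices j + 1, …, m, except that τ_m may coincide with t and
then is not in the open interval. -/
theorem impulseCount_bounds {τ : ℤ → ℝ} (hm : StrictMono τ) {s t : ℝ} {j m : ℤ} (hjm : j ≤ m)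
    (hj : τ j ≤ s) (hj' : s < τ (j + 1)) (hm1 : τ m ≤ t) (hm2 : t < τ (m + 1)) :
    ((m - j : ℤ) : ℝ) - 1 ≤ impulseCount τ s t ∧ (impulseCount τ s t : ℝ) ≤ ((m - j : ℤ) : ℝ) := by
  have hsub : {k : ℤ | τ k ∈ Ioo s t} ⊆ (Finset.Icc (j + 1) m : Finset ℤ) := by
    intro k hk
    rw [Finset.coe_Icc]
    have h1 := hm.lt_iff_lt.1 (hj.trans_lt hk.1)
    have h2 := hm.lt_iff_lt.1 (hk.2.trans hm2)
    constructor <;> omega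
  have hsup : ((Finset.Icc (j + 1) (m - 1) : Finset ℤ) : Set ℤ) ⊆ {k : ℤ | τ k ∈ Ioo s t} := by
    intro k hk
    rw [Finset.coe_Icc] at hk
    exact ⟨hj'.trans_le (hm.monotone hk.1),
      (hm (show k < m by linarith [hk.2])).trans_le hm1⟩
  have h1 := ncard_le_ncard hsub (Finset.finite_toSet _)
  have h2 := ncard_le_ncard hsup ((Finset.finite_toSet _).subset hsub)
  rw [ncard_coe_finset, Int.card_Icc] at h1 h2
  have h1' : ((impulseCount τ s t : ℕ) : ℤ) ≤ m - j := by
    have : (impulseCount τ s t : ℕ) ≤ (m + 1 - (j + 1)).toNat := h1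
    omega
  have h2' : m - j - 1 ≤ ((impulseCount τ s t : ℕ) : ℤ) := by
    have : (m - 1 + 1 - (j + 1)).toNat ≤ (impulseCount τ s t : ℕ) := h2
    omega
  constructor
  · exact_mod_cast h2'
  · exact_mod_cast h1'

/-- Bounded discrepancy keeps the count within a constant of T/a, so the quotient errs by O(1/T)
uniformly in t. -/
theorem hasDensity_of_mean_gap {τ : ℤ → ℝ} (hgap : ∀ j : ℤ, 1 / 2 ≤ τ (j + 1) - τ j) {a C : ℝ}
    (ha : 1 / 2 ≤ a) (hC : 0 ≤ C) (h : ∀ (k : ℤ) (n : ℕ), |τ (k + n) - τ k - a * n| ≤ C) :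
    HasDensity τ (1 / a) := by
  have hm := strictMono_of_gap hgap
  have ha0 : 0 < a := by linarith
  have key : ∀ t T : ℝ, 0 < T → |(impulseCount τ t (t + T) : ℝ) / T - 1 / a| ≤
      (2 + C / a) / T := by
    intro t T hT
    obtain ⟨j, hj, hj'⟩ := exists_index hgap t
    obtain ⟨m, hm1, hm2⟩ := exists_index hgap (t + T)
    have hjm : j ≤ m := by
      have := hm.lt_iff_lt.1 (hj.trans_lt ((by linarith : t < t + T).trans hm2))
      omega
    obtain ⟨c1, c2⟩ := impulseCount_bounds hm hjm hj hj' hm1 hm2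
    obtain ⟨n, rfl⟩ : ∃ n : ℕ, m = j + n := ⟨(m - j).toNat, by omega⟩
    set c : ℝ := (impulseCount τ t (t + T) : ℝ)
    simp only [add_sub_cancel_left, Int.cast_natCast] at c1 c2
    have e1 := (abs_le.1 (h j (n + 1))).2
    push_cast at e1
    rw [← add_assoc] at e1
    have e2 : a * (n - 1) - C ≤ T := by
      rcases n with _ | n
      · push_cast; nlinarith
      · have := (abs_le.1 (h (j + 1) n)).1
        push_cast at hm1 ⊢
        rw [show j + 1 + (n : ℤ) = j + ((n : ℤ) + 1) by ring] at this
        rw [add_sub_cancel_right]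
        linarith
    have e3 : T ≤ a * (c + 2) + C := by nlinarith
    have e4 : a * (c - 2) - C ≤ T := by nlinarith
    rw [div_sub_div _ _ hT.ne' ha0.ne', abs_div, abs_of_pos (mul_pos hT ha0),
      div_le_div_iff₀ (mul_pos hT ha0) hT]
    have e5 : (2 + C / a) * (T * a) = (2 * a + C) * T := by field_simp
    rw [e5]
    gcongr
    rw [abs_le]
    constructor <;> nlinarith
  rw [HasDensity, Metric.tendstoUniformly_iff]
  intro ε hε
  filter_upwards [eventually_gt_atTop ((2 + C / a) / ε), eventually_gt_atTop 0] with T hT hT0 t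
  rw [dist_comm, Real.dist_eq]
  refine (key t T hT0).trans_lt ?_
  rw [div_lt_iff₀ hε] at hT
  rw [div_lt_iff₀ hT0]
  linarith

/-! ### Almost periodic sequences and functions -/

theorem exists_bound_of_almostPeriodicSeq {b : ℤ → ℝ} (hb : IsAlmostPeriodicSeq b) :
    ∃ K : ℝ, ∀ k, |b k| ≤ K := by
  obtain ⟨L, hL⟩ := hb 1 one_pos
  obtain ⟨M, hM⟩ := ((Set.finite_Icc (0 : ℤ) L).image fun k => |b k|).bddAbove
  refine ⟨M + 1, fun k => ?_⟩
  obtain ⟨q, hq, h⟩ := hL (-k)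
  have h1 := hM ⟨k + q, ⟨by linarith [hq.1], by linarith [hq.2]⟩, rfl⟩
  have h2 := h k
  rw [Real.norm_eq_abs, abs_sub_comm] at h2
  have := abs_sub_abs_le_abs_sub (b k) (b (k + q))
  simp only at h1
  linarith

/-- Almost periods say nothing near the τ_k. Clamping t into the core of its interval moves it by at
most η, which uniform continuity can absorb. -/
theorem exists_mem_core {τ : ℤ → ℝ} (hgap : ∀ j : ℤ, 1 / 2 ≤ τ (j + 1) - τ j) {η : ℝ}
    (h0 : 0 < η) (h1 : η ≤ 1 / 8) (t : ℝ) : ∃ (j : ℤ) (t' : ℝ), t ∈ Ico (τ j) (τ (j + 1)) ∧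
      τ j + η ≤ t' ∧ t' ≤ τ (j + 1) - η ∧ |t - t'| ≤ η := by
  obtain ⟨j, hj, hj'⟩ := exists_index hgap t
  have := hgap j
  refine ⟨j, max (τ j + η) (min t (τ (j + 1) - η)), ⟨hj, hj'⟩, le_max_left _ _,
    max_le (by linarith) (min_le_right _ _), ?_⟩
  rw [abs_le]
  rcases le_total t (τ (j + 1) - η) with h | h
  · rw [min_eq_left h]
    rcases le_total (τ j + η) t with h' | h'
    · rw [max_eq_right h']; constructor <;> linarith
    · rw [max_eq_left h']; constructor <;> linarith
  · rw [min_eq_right h, max_eq_right (by linarith)]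
    constructor <;> linarith

/-- One-sided limits and compactness bound φ on [0, L]; any other time is first moved into the core
of its interval and then translated into [0, L] by an almost period. -/
theorem exists_bound_of_isWAlmostPeriodic {E : Type*} [SeminormedAddCommGroup E] {τ : ℤ → ℝ}
    {φ : ℝ → E} (hφ : IsWAlmostPeriodic τ φ) (hgap : ∀ j : ℤ, 1 / 2 ≤ τ (j + 1) - τ j) :
    ∃ K : ℝ, 0 ≤ K ∧ ∀ t, ‖φ t‖ ≤ K := by
  have hloc : ∀ t, ∃ U ∈ 𝓝 t, ∃ M, ∀ s ∈ U, ‖φ s‖ ≤ M := by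
    have haux : ∀ (l : Filter ℝ) (v : E), Tendsto φ l (𝓝 v) →
        ∀ᶠ s in l, ‖φ s‖ ≤ ‖v‖ + 1 := fun l v h =>
      (h.norm.eventually (gt_mem_nhds (lt_add_one _))).mono fun s hs => hs.le
    intro t
    by_cases ht : t ∈ range τ
    · obtain ⟨j, rfl⟩ := ht
      obtain ⟨v, hv⟩ := hφ.left_limit j
      have h1 := haux _ _ hv
      have h2 := haux _ _ (hφ.right_continuous j)
      have h3 : ∀ᶠ s in 𝓝 (τ j), ‖φ s‖ ≤ max (‖v‖ + 1) (‖φ (τ j)‖ + 1) := by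
        rw [← nhdsLT_sup_nhdsGE]
        exact eventually_sup.2 ⟨h1.mono fun s hs => hs.trans (le_max_left _ _),
          h2.mono fun s hs => hs.trans (le_max_right _ _)⟩
      exact ⟨_, h3, _, fun s hs => hs⟩
    · exact ⟨_, haux _ _ (hφ.continuousAt t ht), _, fun s hs => hs⟩
  obtain ⟨δ, hδ, hu⟩ := hφ.uniform 1 one_pos
  set η := min (δ / 2) (1 / 8)
  have hη : 0 < η := by positivity
  obtain ⟨L, hL⟩ := hφ.almost_periods η hη
  obtain ⟨M, hM⟩ : ∃ M, ∀ s ∈ Icc 0 L, ‖φ s‖ ≤ M := by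
    refine isCompact_Icc.induction_on (p := fun S => ∃ M, ∀ s ∈ S, ‖φ s‖ ≤ M) ⟨0, by simp⟩
      (fun S T hST ⟨M, hM⟩ => ⟨M, fun s hs => hM s (hST hs)⟩)
      (fun S T ⟨M, hM⟩ ⟨N, hN⟩ => ⟨max M N, fun s hs => hs.elim
        (fun h => (hM s h).trans (le_max_left _ _)) fun h => (hN s h).trans (le_max_right _ _)⟩)
      fun t _ => ?_
    obtain ⟨U, hU, hM⟩ := hloc t
    exact ⟨U, mem_nhdsWithin_of_mem_nhds hU, hM⟩
  refine ⟨max 0 (M + η + 1), le_max_left _ _, fun t => le_max_of_le_right ?_⟩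
  obtain ⟨j, t', ht, h1, h2, h3⟩ := exists_mem_core hgap hη (min_le_right _ _) t
  have h4 := hu j t ht t' ⟨by linarith, by linarith⟩ (h3.trans_lt (by
    have := min_le_left (δ / 2) (1 / 8)
    linarith))
  obtain ⟨r, hr, h5⟩ := hL (-t')
  have h6 := h5 t' (le_abs_sub_of_mem hφ.strictMono h1 h2)
  have h7 := hM (t' + r) ⟨by linarith [hr.1], by linarith [hr.2]⟩
  have h8 : φ t = (φ t - φ t') - (φ (t' + r) - φ t') + φ (t' + r) := by abel
  rw [h8]
  linarith [norm_sub_le (φ t - φ t') (φ (t' + r) - φ t'),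
    norm_add_le ((φ t - φ t') - (φ (t' + r) - φ t')) (φ (t' + r))]

/-! ### Common almost periods -/

/-- Pigeonhole: choose one representative index for each of the finitely many values. The
representatives are bounded, so subtracting from n the representative of its value gives a
relatively dense set of differences. -/
theorem exists_sub_mem_of_finite_range {α : Type*} (κ : ℤ → α) (h : (range κ).Finite) :
    ∃ L : ℤ, ∀ a : ℤ, ∃ n m : ℤ, κ n = κ m ∧ n - m ∈ Icc a (a + L) := by
  have hfin : (range fun n => Function.invFun κ (κ n)).Finite := by
    refine (h.image (Function.invFun κ)).subset ?_
    rintro _ ⟨n, rfl⟩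
    exact ⟨κ n, ⟨n, rfl⟩, rfl⟩
  obtain ⟨M, hM⟩ := hfin.bddAbove
  obtain ⟨N, hN⟩ := hfin.bddBelow
  refine ⟨M - N, fun a => ⟨a + M, Function.invFun κ (κ (a + M)),
    (Function.invFun_eq ⟨_, rfl⟩).symm, ?_⟩⟩
  have h1 := hM (mem_range_self (f := fun n => Function.invFun κ (κ n)) (a + M))
  have h2 := hN (mem_range_self (f := fun n => Function.invFun κ (κ n)) (a + M))
  constructor <;> linarith

/-- For every accuracy there is a relatively dense set of indices `q`, each with a real `r`, such
that `q` is an almost period of `b` and `c`, `r` is one of `f`, and the shift by `q` moves the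
points of `τ` by about `r`. -/
theorem exists_common_almost_periods {E : Type*} [SeminormedAddCommGroup E] {τ b c : ℤ → ℝ}
    {f : ℝ → E} (hτ : HasUniformlyAPDifferences τ) (hgap : ∀ j : ℤ, 1 / 2 ≤ τ (j + 1) - τ j)
    (hb : IsAlmostPeriodicSeq b) (hc : IsAlmostPeriodicSeq c) (hf : IsWAlmostPeriodic τ f)
    {ε : ℝ} (hε : 0 < ε) :
    ∃ L : ℤ, ∀ a : ℤ, ∃ q ∈ Icc a (a + L), ∃ r : ℝ,
      (∀ k, |τ (k + q) - τ k - r| < ε) ∧ (∀ k, |b (k + q) - b k| < ε) ∧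
      (∀ k, |c (k + q) - c k| < ε) ∧
      ∀ t, (∀ k, ε ≤ |t - τ k|) → ‖f (t + r) - f t‖ < ε := by
  have hm := strictMono_of_gap hgap
  obtain ⟨δ, hδ, hu⟩ := hf.uniform (ε / 4) (by positivity)
  obtain ⟨e, he, he1, he2, he3⟩ : ∃ e : ℝ, 0 < e ∧ e ≤ ε / 16 ∧ e ≤ δ / 8 ∧ e ≤ 1 / 32 :=
    ⟨min (ε / 16) (min (δ / 8) (1 / 32)), by positivity, min_le_left _ _,
      (min_le_right _ _).trans (min_le_left _ _), (min_le_right _ _).trans (min_le_right _ _)⟩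
  obtain ⟨L1, h1⟩ := hτ e he
  obtain ⟨L2, h2⟩ := hb e he
  obtain ⟨L3, h3⟩ := hc e he
  obtain ⟨L4, h4⟩ := hf.almost_periods e he
  -- To each index n attach an almost period of each sequence near n, and one of f near τ_n - τ_0.
  -- If the offsets for n and m agree, then n - m is a difference of two almost periods of every
  -- sequence.
  choose p1 hp1 hq1 using fun n : ℤ => h1 (n - L1)
  choose p2 hp2 hq2 using fun n : ℤ => h2 (n - L2)
  choose p3 hp3 hq3 using fun n : ℤ => h3 (n - L3)
  choose R hR hQ using fun n : ℤ => h4 (τ n - τ 0 - L4)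
  obtain ⟨L, hL⟩ := exists_sub_mem_of_finite_range
    -- The integer offsets take finitely many values. The real offset is rounded to cells of length
    -- `e`.
    (fun n : ℤ => (n - p1 n, n - p2 n, n - p3 n, ⌊(τ n - τ 0 - R n) / e⌋)) (by
      refine (((Set.finite_Icc 0 L1).prod ((Set.finite_Icc 0 L2).prod ((Set.finite_Icc 0 L3).prod
        (Set.finite_Icc 0 ⌊L4 / e⌋))))).subset ?_
      rintro _ ⟨n, rfl⟩
      refine ⟨⟨?_, ?_⟩, ⟨?_, ?_⟩, ⟨?_, ?_⟩, ⟨Int.floor_nonneg.2 ?_, Int.floor_le_floor ?_⟩⟩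
      · linarith [(hp1 n).2]
      · linarith [(hp1 n).1]
      · linarith [(hp2 n).2]
      · linarith [(hp2 n).1]
      · linarith [(hp3 n).2]
      · linarith [(hp3 n).1]
      · exact div_nonneg (by linarith [(hR n).2]) he.le
      · gcongr
        linarith [(hR n).1])
  refine ⟨L, fun a => ?_⟩
  obtain ⟨n, m, hκ, hnm⟩ := hL a
  simp only [Prod.mk.injEq] at hκ
  obtain ⟨k1, k2, k3, k4⟩ := hκ
  have hd : |(τ n - τ 0 - R n) - (τ m - τ 0 - R m)| < e := by
    have := Int.abs_sub_lt_one_of_floor_eq_floor k4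
    rw [← sub_div, abs_div, abs_of_pos he, div_lt_one he] at this
    exact this
  have hτq : ∀ k, |τ (k + (n - m)) - τ k - (R n - R m)| < 3 * e := by
    intro k
    have a1 := abs_lt.1 (hq1 n (m - k) (k - p1 m))
    have a2 := abs_lt.1 (hq1 m (m - k) (k - p1 m))
    rw [show k - p1 m + p1 n = k + (n - m) by omega] at a1
    rw [show k - p1 m + p1 m = k by omega] at a2
    rw [show k + (n - m) + (m - k) = n by omega] at a1
    rw [show k + (m - k) = m by omega] at a2
    have a3 := abs_lt.1 hd
    rw [abs_lt]
    constructor <;> linarith [a1.1, a1.2, a2.1, a2.2, a3.1, a3.2]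
  refine ⟨n - m, hnm, R n - R m, fun k => (hτq k).trans (by linarith), fun k => ?_, fun k => ?_,
    fun t ht => ?_⟩
  · have a1 := abs_lt.1 (hq2 n (k - p2 m))
    have a2 := abs_lt.1 (hq2 m (k - p2 m))
    rw [show k - p2 m + p2 n = k + (n - m) by omega] at a1
    rw [show k - p2 m + p2 m = k by omega] at a2
    rw [abs_lt]
    constructor <;> linarith [a1.1, a1.2, a2.1, a2.2]
  · have a1 := abs_lt.1 (hq3 n (k - p3 m))
    have a2 := abs_lt.1 (hq3 m (k - p3 m))
    rw [show k - p3 m + p3 n = k + (n - m) by omega] at a1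
    rw [show k - p3 m + p3 m = k by omega] at a2
    rw [abs_lt]
    constructor <;> linarith [a1.1, a1.2, a2.1, a2.2]
  -- The point t - R m may fall close to some τ_k, where the almost periods of f give no
  -- information. A nudge by 3e escapes, since only one τ_k can be that near, and uniform continuity
  -- removes the nudge afterwards.
  · obtain ⟨θ, hθ0, hθ4, hθ⟩ : ∃ θ : ℝ, 0 ≤ θ ∧ θ ≤ 4 * e ∧
        ∀ k, e ≤ |t - R m + θ - τ k| := by
      by_cases hbad : ∃ k, |t - R m - τ k| < e
      · obtain ⟨k, hk⟩ := hbad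
        rw [abs_lt] at hk
        refine ⟨3 * e, by positivity, by linarith, fun i => ?_⟩
        rcases lt_trichotomy i k with h | rfl | h
        · have := gap_le_of_lt hgap h
          exact le_trans (by linarith [hk.1]) (le_abs_self _)
        · exact le_trans (by linarith [hk.1]) (le_abs_self _)
        · have := gap_le_of_lt hgap h
          rw [abs_sub_comm]
          exact le_trans (by linarith [hk.2]) (le_abs_self _)
      · push Not at hbad
        exact ⟨0, le_rfl, by positivity, fun k => by simpa using hbad k⟩
    obtain ⟨j, hj, hj'⟩ := exists_index hgap t
    have c1 : τ j + ε ≤ t := by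
      have := ht j
      rw [abs_of_nonneg (by linarith)] at this
      linarith
    have c2 : t ≤ τ (j + 1) - ε := by
      have := ht (j + 1)
      rw [abs_of_neg (by linarith)] at this
      linarith
    have b1 := hQ n _ hθ
    have b2 := hQ m _ hθ
    rw [show t - R m + θ + R n = t + (R n - R m) + θ by ring] at b1
    rw [show t - R m + θ + R m = t + θ by ring] at b2
    have b3 := hu j (t + θ) ⟨by linarith, by linarith⟩ t ⟨hj, hj'⟩ (by
      rw [add_sub_cancel_left, abs_of_nonneg hθ0]; linarith)
    have d1 := abs_lt.1 (hτq j)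
    have d2 := abs_lt.1 (hτq (j + 1))
    rw [show j + 1 + (n - m) = j + (n - m) + 1 by ring] at d2
    have b4 := hu (j + (n - m)) (t + (R n - R m) + θ) ⟨by linarith [d1.1, d1.2], by
      linarith [d2.1, d2.2]⟩ (t + (R n - R m)) ⟨by linarith [d1.1, d1.2], by
      linarith [d2.1, d2.2]⟩ (by
      rw [add_sub_cancel_left, abs_of_nonneg hθ0]; linarith)
    set x1 := f (t + (R n - R m) + θ)
    set x2 := f (t - R m + θ)
    set x3 := f (t + θ)
    have e1 : f (t + (R n - R m)) - f t =
        (x1 - x2) - (x3 - x2) + (x3 - f t) - (x1 - f (t + (R n - R m))) := by abel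
    rw [e1]
    linarith [norm_sub_le ((x1 - x2) - (x3 - x2) + (x3 - f t)) (x1 - f (t + (R n - R m))),
      norm_add_le ((x1 - x2) - (x3 - x2)) (x3 - f t), norm_sub_le (x1 - x2) (x3 - x2)]

/-! ### Bounded solutions of weighted contractive recurrences -/

/-- The supremum s over all of ℤ satisfies s ≤ ρ s + e; no initial term appears because the sequence
is two-sided and bounded. -/
theorem le_div_of_recurrence {d : ℤ → ℝ} {ρ e D : ℝ} (hρ : 0 ≤ ρ) (hρ1 : ρ < 1)
    (hD : ∀ j, d j ≤ D) (h : ∀ j, d (j + 1) ≤ ρ * d j + e) (j : ℤ) : d j ≤ e / (1 - ρ) := by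
  have hb : BddAbove (range d) := ⟨D, by rintro _ ⟨j, rfl⟩; exact hD j⟩
  have h1 : ⨆ j, d j ≤ ρ * (⨆ j, d j) + e := by
    refine ciSup_le fun j => ?_
    have := h (j - 1)
    rw [sub_add_cancel] at this
    refine this.trans ?_
    gcongr
    exact le_ciSup hb _
  refine (le_ciSup hb j).trans ?_
  rw [le_div_iff₀ (by linarith)]
  linarith

/-- Banach's fixed point theorem for bounded sequences, applied to x_j = w_j y_j. In these variables
every step has Lipschitz constant ρ, and the bounds on the weights carry boundedness over and back.
-/
theorem exists_bounded_recurrence {E : Type*} [NormedAddCommGroup E] [NormedSpace ℝ E]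
    [CompleteSpace E] {T : ℤ → E → E} {w : ℤ → ℝ} {ρ m M B : ℝ} (hρ : 0 ≤ ρ) (hρ1 : ρ < 1)
    (hm : 0 < m) (hw : ∀ j, m ≤ w j) (hw' : ∀ j, w j ≤ M)
    (hT : ∀ j x y, w (j + 1) * ‖T j x - T j y‖ ≤ ρ * (w j * ‖x - y‖)) (hB : ∀ j, ‖T j 0‖ ≤ B) :
    ∃ y : ℤ → E, (∃ Y, ∀ j, ‖y j‖ ≤ Y) ∧ ∀ j, y (j + 1) = T j (y j) := by
  have hw0 : ∀ j, 0 < w j := fun j => hm.trans_le (hw j)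
  have hT' : ∀ j x y, w j * ‖T (j - 1) ((w (j - 1))⁻¹ • x) - T (j - 1) ((w (j - 1))⁻¹ • y)‖ ≤
      ρ * ‖x - y‖ := by
    intro j x y
    have := hT (j - 1) ((w (j - 1))⁻¹ • x) ((w (j - 1))⁻¹ • y)
    rw [← smul_sub, norm_smul, norm_inv, Real.norm_of_nonneg (hw0 _).le, sub_add_cancel,
      mul_inv_cancel_left₀ (hw0 _).ne'] at this
    exact this
  let Φ : BoundedContinuousFunction ℤ E → BoundedContinuousFunction ℤ E := fun x =>
    BoundedContinuousFunction.ofNormedAddCommGroupDiscrete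
      (fun j => w j • T (j - 1) ((w (j - 1))⁻¹ • x (j - 1))) (ρ * ‖x‖ + M * B) (fun j => by
        have h1 := hT' j (x (j - 1)) 0
        rw [smul_zero, sub_zero] at h1
        rw [norm_smul, Real.norm_of_nonneg (hw0 _).le]
        have h2 : w j * ‖T (j - 1) 0‖ ≤ M * B :=
          mul_le_mul (hw' j) (hB _) (norm_nonneg _) ((hw0 j).le.trans (hw' j))
        have h3 : ‖T (j - 1) ((w (j - 1))⁻¹ • x (j - 1))‖ ≤
            ‖T (j - 1) ((w (j - 1))⁻¹ • x (j - 1)) - T (j - 1) 0‖ + ‖T (j - 1) 0‖ := by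
          simpa using norm_add_le (T (j - 1) ((w (j - 1))⁻¹ • x (j - 1)) - T (j - 1) 0)
            (T (j - 1) 0)
        have h4 := mul_le_mul_of_nonneg_left h3 (hw0 j).le
        have h5 := mul_le_mul_of_nonneg_left (x.norm_coe_le_norm (j - 1)) hρ
        linarith)
  have hΦ : ContractingWith ⟨ρ, hρ⟩ Φ := by
    refine ⟨by exact_mod_cast hρ1, LipschitzWith.of_dist_le_mul fun x y => ?_⟩
    refine (BoundedContinuousFunction.dist_le (by positivity)).2 fun j => ?_
    change dist (w j • T (j - 1) ((w (j - 1))⁻¹ • x (j - 1)))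
      (w j • T (j - 1) ((w (j - 1))⁻¹ • y (j - 1))) ≤ ρ * dist x y
    rw [dist_eq_norm, ← smul_sub, norm_smul, Real.norm_of_nonneg (hw0 _).le]
    refine (hT' j _ _).trans ?_
    rw [← dist_eq_norm]
    gcongr
    exact BoundedContinuousFunction.dist_coe_le_dist _
  obtain ⟨x, hx⟩ : ∃ x, Φ x = x := ⟨_, hΦ.fixedPoint_isFixedPt⟩
  have hxj : ∀ j, x j = w j • T (j - 1) ((w (j - 1))⁻¹ • x (j - 1)) := fun j => by
    conv_lhs => rw [← hx]
    rfl
  refine ⟨fun j => (w j)⁻¹ • x j, ⟨m⁻¹ * ‖x‖, fun j => ?_⟩, fun j => ?_⟩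
  · rw [norm_smul, norm_inv, Real.norm_of_nonneg (hw0 _).le]
    have := hw j
    gcongr
    exact x.norm_coe_le_norm j
  · simp only
    rw [hxj (j + 1), add_sub_cancel_right, smul_smul, inv_mul_cancel₀ (hw0 _).ne', one_smul]

/-! ### The bounded solution in coefficients -/

/-- The standing quantitative assumptions: `a` is the mean gap of `τ`. -/
structure Setting (τ b c : ℤ → ℝ) (f : ℝ → L2Pi) (a C H K β γ : ℝ) : Prop where
  gap : ∀ j : ℤ, 1 / 2 ≤ τ (j + 1) - τ j
  gap_le : ∀ j : ℤ, τ (j + 1) - τ j ≤ H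
  mean : ∀ (k : ℤ) (n : ℕ), |τ (k + n) - τ k - a * n| ≤ C
  meas : AEStronglyMeasurable f volume
  bound : ∀ s, ‖f s‖ ≤ K
  b_le : ∀ j, |b j| ≤ β
  c_le : ∀ j, |c j| ≤ γ
  contr : (1 + β) * exp (-a) < 1

/-- The passage from one post-impulse state to the next one, in coefficients. -/
def step (τ b c : ℤ → ℝ) (f : ℝ → L2Pi) (j : ℤ) (x : ℕ → ℝ) : ℕ → ℝ :=
  jump (b (j + 1)) (c (j + 1)) (heat (τ (j + 1) - τ j) x + duhamel f (τ j) (τ (j + 1)))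

/-- The weights turning the steps into uniform contractions. -/
def weight (τ : ℤ → ℝ) (a : ℝ) (j : ℤ) : ℝ := exp (τ j - τ 0 - a * j)

theorem wnorm_zero_impulse_le {b β : ℝ} (hb : |b| ≤ β) (x : ℕ → ℝ) :
    wnorm 0 (x + b • sinDeriv x) ≤ ENNReal.ofReal (1 + β) * wnorm (1 / 2) x := by
  have hβ : 0 ≤ β := (abs_nonneg b).trans hb
  rw [ENNReal.ofReal_add zero_le_one hβ, add_mul, ENNReal.ofReal_one, one_mul]
  refine (wnorm_add_le _ _ _).trans (add_le_add (wnorm_mono_exponent (by norm_num) _) ?_)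
  rw [wnorm_smul]
  refine mul_le_mul' ?_ (wnorm_zero_sinDeriv_le x)
  rw [Real.enorm_eq_ofReal_abs]
  exact ENNReal.ofReal_le_ofReal hb

theorem wnorm_impulse_le {b β σ : ℝ} (hb : |b| ≤ β) (h0 : 0 ≤ σ) (h1 : σ ≤ 1 / 2) (x : ℕ → ℝ) :
    wnorm σ (x + b • sinDeriv x) ≤ ENNReal.ofReal (1 + 2 * β) * wnorm (σ + 1 / 2) x := by
  have hβ : 0 ≤ β := (abs_nonneg b).trans hb
  rw [ENNReal.ofReal_add zero_le_one (by positivity), add_mul, ENNReal.ofReal_one, one_mul]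
  refine (wnorm_add_le _ _ _).trans (add_le_add (wnorm_mono_exponent (by norm_num) _) ?_)
  rw [wnorm_smul, mul_comm 2 β, ENNReal.ofReal_mul hβ, mul_assoc]
  refine mul_le_mul' ?_ (by simpa using wnorm_sinDeriv_le_two (by linarith) h1 x)
  rw [Real.enorm_eq_ofReal_abs]
  exact ENNReal.ofReal_le_ofReal hb

theorem wnorm_heat_le_half {δ t : ℝ} (ht : 1 / 2 ≤ t) (h0 : 0 ≤ δ) (h1 : δ ≤ 1) (x : ℕ → ℝ) :
    wnorm δ (heat t x) ≤ 4 * wnorm 0 x := by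
  have e : heat t x = heat (t - 1 / 2) (heat (1 / 2) x) := by rw [heat_heat, sub_add_cancel]
  rw [e]
  refine (wnorm_heat_le_self (by linarith) _ _).trans ?_
  have := wnorm_heat_le (β := 0) (δ := δ) (t := 1 / 2) (by norm_num) h0 (by linarith) x
  rw [zero_add] at this
  refine this.trans ?_
  gcongr
  -- The smoothing constant is 2 (1/2)^{-δ} ≤ 4, as δ ≤ 1.
  rw [show (4 : ℝ≥0∞) = ENNReal.ofReal 4 by simp]
  apply ENNReal.ofReal_le_ofReal
  rw [one_div, inv_rpow zero_le_two, rpow_neg zero_le_two, inv_inv]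
  have : (2 : ℝ) ^ δ ≤ 2 ^ (1 : ℝ) := rpow_le_rpow_of_exponent_le one_le_two h1
  rw [rpow_one] at this
  linarith

theorem enorm_sq_le_of_norm_le {u : L2Pi} {K : ℝ} (h : ‖u‖ ≤ K) :
    ‖u‖ₑ ^ 2 ≤ ENNReal.ofReal (K ^ 2) := by
  rw [← ofReal_norm, ← ENNReal.ofReal_pow (norm_nonneg _)]
  gcongr

theorem wnorm_half_duhamel_sq_le_of_bound {f : ℝ → L2Pi} {K : ℝ}
    (hfm : AEStronglyMeasurable f volume) (hK : ∀ s, ‖f s‖ ≤ K) {s t : ℝ} (hst : s ≤ t) :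
    wnorm (1 / 2) (duhamel f s t) ^ 2 ≤ ENNReal.ofReal (2 * K ^ 2 * (t - s)) := by
  refine (wnorm_half_duhamel_sq_le hst hfm.restrict).trans ?_
  calc _ ≤ 2 * ∫⁻ _ in Ioo s t, ENNReal.ofReal (K ^ 2) := by
        gcongr with x
        exact enorm_sq_le_of_norm_le (hK x)
    _ = _ := by
        rw [setLIntegral_const, Real.volume_Ioo, ← ENNReal.ofReal_mul (by positivity),
          show (2 : ℝ≥0∞) = ENNReal.ofReal 2 by simp, ← ENNReal.ofReal_mul zero_le_two, mul_assoc]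

theorem le_rpow_half_of_sq_le {x y : ℝ≥0∞} (h : x ^ 2 ≤ y) : x ≤ y ^ (1 / 2 : ℝ) := by
  calc x = (x ^ 2) ^ (1 / 2 : ℝ) := by
        rw [← ENNReal.rpow_two, ← ENNReal.rpow_mul]; norm_num
    _ ≤ _ := ENNReal.rpow_le_rpow h (by norm_num)

/-- For bounded f the kernel (t-s)^{-(2σ-1)} is integrable precisely because σ < 1. -/
theorem exists_duhamel_bound {f : ℝ → L2Pi} {K : ℝ} (hfm : AEStronglyMeasurable f volume)
    (hK : ∀ s, ‖f s‖ ≤ K) (H : ℝ) {σ : ℝ} (h1 : 1 / 2 ≤ σ) (h2 : σ < 1) :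
    ∃ D : ℝ≥0∞, D ≠ ⊤ ∧ ∀ s t, s ≤ t → t - s ≤ H → wnorm σ (duhamel f s t) ≤ D := by
  have hm := kernelMass_ne_top (γ := 2 * σ - 1) (by linarith) H
  refine ⟨(2 * (K ^ 2).toNNReal * kernelMass (2 * σ - 1) H) ^ (1 / 2 : ℝ),
    ENNReal.rpow_ne_top_of_nonneg (by norm_num) (by finiteness), fun s t hst hH => ?_⟩
  refine le_rpow_half_of_sq_le ?_
  refine (wnorm_duhamel_sq_le_of_bound (γ := 2 * σ - 1) (K := (K ^ 2).toNNReal) hst hfm.restrict h1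
    (by linarith) fun x _ => ?_).trans ?_
  · rw [mul_comm]
    gcongr
    exact enorm_sq_le_of_norm_le (hK x)
  · gcongr
    exact kernelMass_mono _ hH

variable {τ b c : ℤ → ℝ} {f : ℝ → L2Pi} {a C H K β γ : ℝ}

theorem Setting.beta_nonneg (S : Setting τ b c f a C H K β γ) : 0 ≤ β :=
  (abs_nonneg _).trans (S.b_le 0)

theorem Setting.weight_bounds (S : Setting τ b c f a C H K β γ) (j : ℤ) :
    exp (-C) ≤ weight τ a j ∧ weight τ a j ≤ exp C := by
  rw [weight, exp_le_exp, exp_le_exp, ← abs_le]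
  rcases le_total 0 j with h | h
  · lift j to ℕ using h
    simpa using S.mean 0 j
  -- For negative indices the discrepancy bound is used from j up to 0.
  · obtain ⟨n, hn⟩ : ∃ n : ℕ, j = -n := ⟨(-j).toNat, by omega⟩
    have := S.mean j n
    rw [show j + (n : ℤ) = 0 by omega, abs_le] at this
    have hj : (j : ℝ) = -n := by rw [hn]; simp
    rw [hj, abs_le]
    constructor <;> linarith [this.1, this.2]

/-- The weights trade the individual gap for the mean gap. -/
theorem Setting.weight_succ (j : ℤ) :
    weight τ a (j + 1) * exp (-(τ (j + 1) - τ j)) = weight τ a j * exp (-a) := by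
  rw [weight, weight, ← exp_add, ← exp_add]
  push_cast
  ring_nf

/-- The Duhamel term and the parabola cancel in the difference; the impulse contributes 1 + β, and
the heat flow from L² to X^{1/2} contributes the exponential. -/
theorem Setting.wnorm_step_sub_le (S : Setting τ b c f a C H K β γ) (j : ℤ) (x y : ℕ → ℝ) :
    wnorm 0 (step τ b c f j x - step τ b c f j y) ≤
      ENNReal.ofReal ((1 + β) * exp (-(τ (j + 1) - τ j))) * wnorm 0 (x - y) := by
  rw [step, step, jump_sub, add_sub_add_right_eq_sub, ← heat_sub]
  refine (wnorm_zero_impulse_le (S.b_le _) _).trans ?_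
  rw [ENNReal.ofReal_mul (by linarith [S.beta_nonneg]), mul_assoc]
  gcongr
  exact wnorm_half_heat_le (S.gap j) _

/-- Post-impulse states lie in `X^σ`, `σ < 1/2`, with uniform bounds. -/
theorem Setting.exists_wnorm_step_le (S : Setting τ b c f a C H K β γ) {σ : ℝ} (h0 : 0 ≤ σ)
    (h1 : σ < 1 / 2) : ∃ M : ℝ≥0∞, M ≠ ⊤ ∧ ∀ j x,
      wnorm σ (step τ b c f j x) ≤ M + M * wnorm 0 x := by
  obtain ⟨D, hD, hD'⟩ := exists_duhamel_bound S.meas S.bound H (σ := σ + 1 / 2) (by linarith)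
    (by linarith)
  have hp := wnorm_parabola_ne_top (β := σ) (by linarith)
  refine ⟨ENNReal.ofReal (1 + 2 * β) * 4 + ENNReal.ofReal (1 + 2 * β) * D +
    ENNReal.ofReal γ * wnorm σ (sineCoeff parabola), by finiteness, fun j x => ?_⟩
  rw [step, jump]
  have h2 : wnorm (σ + 1 / 2) (heat (τ (j + 1) - τ j) x + duhamel f (τ j) (τ (j + 1))) ≤
      4 * wnorm 0 x + D :=
    (wnorm_add_le _ _ _).trans (add_le_add
      (wnorm_heat_le_half (S.gap j) (by linarith) (by linarith) x)
      (hD' _ _ (by linarith [S.gap j]) (S.gap_le j)))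
  refine (wnorm_add_le _ _ _).trans ((add_le_add ((wnorm_impulse_le (S.b_le _) h0 h1.le _).trans
    (mul_le_mul_right h2 _)) (le_refl _)).trans ?_)
  rw [wnorm_smul, Real.enorm_eq_ofReal_abs]
  calc _ ≤ ENNReal.ofReal (1 + 2 * β) * (4 * wnorm 0 x + D) +
        ENNReal.ofReal γ * wnorm σ (sineCoeff parabola) := by
        gcongr
        exact S.c_le _
    _ = (ENNReal.ofReal (1 + 2 * β) * D + ENNReal.ofReal γ * wnorm σ (sineCoeff parabola)) +
        (ENNReal.ofReal (1 + 2 * β) * 4) * wnorm 0 x := by ring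
    _ ≤ _ := by
        gcongr ?_ + ?_ * _
        · rw [add_assoc]; exact le_add_self
        · rw [add_assoc]; exact le_self_add

theorem enorm_sub_eq_wnorm (u v : L2Pi) : ‖u - v‖ₑ = wnorm 0 (sineCoeff u - sineCoeff v) := by
  rw [enorm_eq_wnorm, sineCoeff_sub_fun]

theorem norm_le_of_enorm_le {E : Type*} [SeminormedAddCommGroup E] {x : E} {r : ℝ} (hr : 0 ≤ r)
    (h : ‖x‖ₑ ≤ ENNReal.ofReal r) : ‖x‖ ≤ r := by
  rw [← ofReal_norm] at h
  exact (ENNReal.ofReal_le_ofReal_iff hr).1 h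

theorem Setting.weighted_step_sub_le (S : Setting τ b c f a C H K β γ) (j : ℤ) {x y x' y' : L2Pi}
    (hx : sineCoeff x' = step τ b c f j (sineCoeff x))
    (hy : sineCoeff y' = step τ b c f j (sineCoeff y)) :
    weight τ a (j + 1) * ‖x' - y'‖ ≤ (1 + β) * exp (-a) * (weight τ a j * ‖x - y‖) := by
  have h1 : ‖x' - y'‖ ≤ (1 + β) * exp (-(τ (j + 1) - τ j)) * ‖x - y‖ := by
    have hβ := S.beta_nonneg
    refine norm_le_of_enorm_le (by positivity) ?_
    rw [enorm_sub_eq_wnorm, hx, hy, ENNReal.ofReal_mul (by positivity), ofReal_norm,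
      enorm_sub_eq_wnorm]
    exact S.wnorm_step_sub_le j _ _
  have h2 := mul_le_mul_of_nonneg_left h1
    (show 0 ≤ weight τ a (j + 1) from (exp_pos _).le)
  have h3 := Setting.weight_succ (τ := τ) (a := a) j
  calc _ ≤ _ := h2
    _ = (1 + β) * (weight τ a (j + 1) * exp (-(τ (j + 1) - τ j))) * ‖x - y‖ := by ring
    _ = _ := by rw [h3]; ring

theorem Setting.exists_bounded_states (S : Setting τ b c f a C H K β γ) :
    ∃ y : ℤ → L2Pi, (∃ Y, ∀ j, ‖y j‖ ≤ Y) ∧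
      ∀ j, sineCoeff (y (j + 1)) = step τ b c f j (sineCoeff (y j)) := by
  obtain ⟨M, hM, hM'⟩ := S.exists_wnorm_step_le le_rfl (by norm_num)
  have hfin : ∀ j (x : L2Pi), wnorm 0 (step τ b c f j (sineCoeff x)) ≠ ⊤ := fun j x =>
    ne_top_of_le_ne_top (by have := wnorm_zero_sineCoeff_ne_top x; finiteness) (hM' j _)
  choose T hT using fun j x => exists_sineCoeff_eq (hfin j x)
  have hβ := S.beta_nonneg
  obtain ⟨y, hy, hrec⟩ := exists_bounded_recurrence (T := T) (w := weight τ a) (B := M.toReal)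
    (by positivity) S.contr (exp_pos (-C)) (fun j => (S.weight_bounds j).1)
    (fun j => (S.weight_bounds j).2)
    (fun j x y => S.weighted_step_sub_le j (hT j x) (hT j y)) (fun j => by
      refine norm_le_of_enorm_le ENNReal.toReal_nonneg ?_
      rw [ENNReal.ofReal_toReal hM, enorm_eq_wnorm, hT]
      refine (hM' j _).trans (le_of_eq ?_)
      have : sineCoeff 0 = 0 := funext fun k => sineCoeff_zero k
      rw [this, wnorm_zero_right, mul_zero, add_zero])
  exact ⟨y, hy, fun j => by rw [hrec, hT]⟩

/-! ### Mild solutions between impulses -/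

/-- The mild solution starting from the state `x` at time `s`, in coefficients. -/
def arc (f : ℝ → L2Pi) (s : ℝ) (x : ℕ → ℝ) (t : ℝ) : ℕ → ℝ := heat (t - s) x + duhamel f s t

@[simp] theorem arc_self (f : ℝ → L2Pi) (s : ℝ) (x : ℕ → ℝ) : arc f s x s = x := by
  funext k
  simp [arc, duhamel]

theorem arc_arc {f : ℝ → L2Pi} {K : ℝ} (hfm : AEStronglyMeasurable f volume)
    (hK : ∀ s, ‖f s‖ ≤ K) (s r t : ℝ) (x : ℕ → ℝ) :
    arc f s x t = arc f r (arc f s x r) t := by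
  rw [arc, arc, arc, heat_add, heat_heat, duhamel_eq_add hfm hK s r t, ← add_assoc]
  congr 3
  ring

theorem exists_wnorm_arc_le {f : ℝ → L2Pi} {K : ℝ} (hfm : AEStronglyMeasurable f volume)
    (hK : ∀ s, ‖f s‖ ≤ K) (H : ℝ) : ∃ D : ℝ≥0∞, D ≠ ⊤ ∧ ∀ σ s t x, σ ≤ 1 / 2 → s ≤ t →
      t - s ≤ H → wnorm σ (arc f s x t) ≤ wnorm σ x + D := by
  obtain ⟨D, hD, h⟩ := exists_duhamel_bound hfm hK H (σ := 1 / 2) le_rfl (by norm_num)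
  refine ⟨D, hD, fun σ s t x hσ hst hH => (wnorm_add_le _ _ _).trans ?_⟩
  exact add_le_add (wnorm_heat_le_self (sub_nonneg.2 hst) _ _)
    ((wnorm_mono_exponent hσ _).trans (h s t hst hH))

/-- Equicontinuity of mild solutions with bounded initial states. -/
theorem exists_arc_modulus {f : ℝ → L2Pi} {K : ℝ} (hfm : AEStronglyMeasurable f volume)
    (hK : ∀ s, ‖f s‖ ≤ K) (H : ℝ) {α σ : ℝ} (hα : 0 ≤ α) (hασ : α < σ) (hσ : σ ≤ 1 / 2)
    {M : ℝ≥0∞} (hM : M ≠ ⊤) {ε : ℝ≥0∞} (hε : 0 < ε) :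
    ∃ δ : ℝ, 0 < δ ∧ ∀ s r t x, wnorm σ x ≤ M → s ≤ r → s ≤ t → r - s ≤ H → t - s ≤ H →
      |t - r| < δ → wnorm α (arc f s x t - arc f s x r) < ε := by
  obtain ⟨D, hD, hD'⟩ := exists_wnorm_arc_le hfm hK H
  have hlim : Tendsto (fun h : ℝ => ENNReal.ofReal (h ^ (σ - α)) * (M + D) +
      ENNReal.ofReal (2 * K ^ 2 * h) ^ (1 / 2 : ℝ)) (𝓝 0) (𝓝 0) := by
    have h1 : Tendsto (fun h : ℝ => ENNReal.ofReal (h ^ (σ - α))) (𝓝 0) (𝓝 0) := by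
      have := (ENNReal.continuous_ofReal.comp
        (Real.continuous_rpow_const (q := σ - α) (by linarith))).tendsto 0
      simpa [Real.zero_rpow (sub_pos.2 hασ).ne', Function.comp_def] using this
    have h2 := ENNReal.Tendsto.mul_const (b := M + D) h1 (Or.inr (by finiteness))
    have h3 : Tendsto (fun h : ℝ => ENNReal.ofReal (2 * K ^ 2 * h) ^ (1 / 2 : ℝ)) (𝓝 0) (𝓝 0) := by
      have : Continuous fun h : ℝ => ENNReal.ofReal (2 * K ^ 2 * h) ^ (1 / 2 : ℝ) :=
        ENNReal.continuous_rpow_const.comp (ENNReal.continuous_ofReal.comp (by fun_prop))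
      simpa using this.tendsto 0
    simpa using h2.add h3
  obtain ⟨δ, hδ, hδ'⟩ := Metric.eventually_nhds_iff.1 (hlim.eventually (gt_mem_nhds hε))
  refine ⟨δ, hδ, ?_⟩
  have key : ∀ s r t x, wnorm σ x ≤ M → s ≤ r → r ≤ t → t - s ≤ H →
      t - r < δ → wnorm α (arc f s x t - arc f s x r) < ε := by
    intro s r t x hx hsr hrt hH htr
    -- Restart at time r. The heat increment is O((t-r)^{σ-α}) thanks to the spare regularity of the
    -- state, and the Duhamel term over [r, t] is O((t-r)^{1/2}).
    rw [arc_arc hfm hK s r t x]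
    set z := arc f s x r
    have e1 : arc f r z t - z = (heat (t - r) z - z) + duhamel f r t := by
      rw [arc]; abel
    rw [e1]
    refine lt_of_le_of_lt ((wnorm_add_le _ _ _).trans (add_le_add ?_ ?_))
      (hδ' (y := t - r) (by rw [Real.dist_eq, sub_zero, abs_of_nonneg (by linarith)]; exact htr))
    · refine (wnorm_heat_sub_le (γ := σ - α) (by linarith) (by linarith) (by linarith) _).trans ?_
      rw [add_sub_cancel]
      gcongr
      exact (hD' σ s r x hσ hsr (by linarith)).trans (add_le_add hx le_rfl)
    · exact (wnorm_mono_exponent (by linarith) _).trans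
        (le_rpow_half_of_sq_le (wnorm_half_duhamel_sq_le_of_bound hfm hK hrt))
  intro s r t x hx hr ht hrH htH hd
  rcases le_total r t with h | h
  · exact key s r t x hx hr h htH ((le_abs_self _).trans_lt hd)
  · rw [wnorm_sub_comm]
    rw [abs_sub_comm] at hd
    exact key s t r x hx ht h hrH ((le_abs_self _).trans_lt hd)

theorem hasDerivAt_arc {f : ℝ → L2Pi} {K : ℝ} (hfm : AEStronglyMeasurable f volume)
    (hK : ∀ s, ‖f s‖ ≤ K) (s : ℝ) (x : ℕ → ℝ) {t : ℝ} (hc : ContinuousAt f t) (k : ℕ) :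
    HasDerivAt (fun t => arc f s x t k)
      (-((k : ℝ) + 1) ^ 2 * arc f s x t k + sineCoeff (f t) k) t := by
  have h1 : HasDerivAt (fun t => heat (t - s) x k)
      (exp (-(((k : ℝ) + 1) ^ 2 * (t - s))) * (-(((k : ℝ) + 1) ^ 2 * 1)) * x k) t :=
    ((((hasDerivAt_id t).sub_const s).const_mul (((k : ℝ) + 1) ^ 2)).neg.exp).mul_const (x k)
  refine (h1.add (hasDerivAt_duhamel hfm hK s hc k)).congr_deriv ?_
  simp only [arc, Pi.add_apply, heat]
  ring

/-! ### From coefficients to `L²`-valued functions -/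

theorem sineCoeff_sineFun (i k : ℕ) : sineCoeff (sineFun i) k = if k = i then 1 else 0 :=
  orthonormal_iff_ite.1 orthonormal_sineFun k i

theorem sineCoeff_sum (u : L2Pi) (N k : ℕ) :
    sineCoeff (∑ i ∈ Finset.range N, sineCoeff u i • sineFun i) k =
      if k < N then sineCoeff u k else 0 := by
  rw [sineCoeff, inner_sum]
  simp_rw [real_inner_smul_right]
  have : ∀ i, inner ℝ (sineFun k) (sineFun i) = if k = i then (1 : ℝ) else 0 := fun i =>
    sineCoeff_sineFun i k
  simp [this]

/-- The bound in X^κ with κ > 0 makes the tails of the sine series small uniformly near t₀, so u is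
a local uniform limit of finite sums continuous at t₀. -/
theorem continuousAt_of_coeff {u : ℝ → L2Pi} {t₀ κ : ℝ} {M : ℝ≥0∞} (hκ : 0 < κ) (hM : M ≠ ⊤)
    (hc : ∀ k, ContinuousAt (fun t => sineCoeff (u t) k) t₀)
    (hb : ∀ᶠ t in 𝓝 t₀, wnorm κ (sineCoeff (u t)) ≤ M) : ContinuousAt u t₀ := by
  refine continuousAt_of_locally_uniform_approx_of_continuousAt fun V hV => ?_
  obtain ⟨ε, hε, hεV⟩ := Metric.mem_uniformity_dist.1 hV
  have hlim : Tendsto (fun N : ℕ => ENNReal.ofReal (((N : ℝ) + 1) ^ (-(2 * κ))) * M) atTop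
      (𝓝 0) := by
    have h1 : Tendsto (fun N : ℕ => ((N : ℝ) + 1) ^ (-(2 * κ))) atTop (𝓝 0) :=
      (tendsto_rpow_neg_atTop (by positivity)).comp
        (tendsto_atTop_add_const_right _ _ tendsto_natCast_atTop_atTop)
    have h2 := ENNReal.Tendsto.mul_const (b := M) (ENNReal.tendsto_ofReal h1) (Or.inr hM)
    simpa using h2
  obtain ⟨N, hN⟩ := (hlim.eventually (gt_mem_nhds (ENNReal.ofReal_pos.2 hε))).exists
  refine ⟨_, hb, fun t => ∑ i ∈ Finset.range N, sineCoeff (u t) i • sineFun i, ?_, fun t ht => ?_⟩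
  · exact tendsto_finsetSum _ fun i _ => (hc i).smul continuousAt_const
  · refine hεV ?_
    rw [dist_eq_norm]
    have h1 : ‖u t - ∑ i ∈ Finset.range N, sineCoeff (u t) i • sineFun i‖ₑ < ENNReal.ofReal ε := by
      refine lt_of_le_of_lt ?_ hN
      rw [enorm_sub_eq_wnorm]
      refine (wnorm_le_of_le (γ := κ) (b := sineCoeff (u t)) fun k => ?_).trans
        (mul_le_mul_right (show wnorm κ (sineCoeff (u t)) ≤ M from ht) _)
      rw [Pi.sub_apply, sineCoeff_sum]
      split_ifs with h
      · simp; positivity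
      · rw [sub_zero, mul_zero, rpow_zero, one_mul, ← mul_assoc]
        refine le_mul_of_one_le_left (abs_nonneg _) ?_
        rw [rpow_neg (by positivity), inv_mul_eq_div, one_le_div (by positivity)]
        have : N ≤ k := not_lt.1 h
        gcongr
    rw [← ofReal_norm] at h1
    exact (ENNReal.ofReal_lt_ofReal_iff hε).1 h1

/-- By comparison of coefficients u(s) = u(t) + ∫ w from t to s, and w is continuous. -/
theorem hasDerivAt_of_coeff {u w : ℝ → L2Pi} {p q : ℝ} (hw : ContinuousOn w (Ioo p q))
    (hd : ∀ k, ∀ t ∈ Ioo p q, HasDerivAt (fun t => sineCoeff (u t) k) (sineCoeff (w t) k) t)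
    {t : ℝ} (ht : t ∈ Ioo p q) : HasDerivAt u (w t) t := by
  have hsub : ∀ s ∈ Ioo p q, uIcc t s ⊆ Ioo p q := fun s hs =>
    (ordConnected_Ioo.uIcc_subset ht hs)
  have hi : ∀ s ∈ Ioo p q, IntervalIntegrable w volume t s := fun s hs =>
    (hw.mono (hsub s hs)).intervalIntegrable
  have hwt : ContinuousAt w t := hw.continuousAt (isOpen_Ioo.mem_nhds ht)
  have h1 : HasDerivAt (fun s => ∫ r in t..s, w r) (w t) t :=
    intervalIntegral.integral_hasDerivAt_right (by simp)
      (hw.stronglyMeasurableAtFilter isOpen_Ioo t ht) hwt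
  refine (h1.const_add (u t)).congr_of_eventuallyEq ?_
  filter_upwards [isOpen_Ioo.mem_nhds ht] with s hs
  refine ext_sineCoeff fun k => ?_
  have h2 : sineCoeff (∫ r in t..s, w r) k = ∫ r in t..s, sineCoeff (w r) k :=
    ((innerSL ℝ (sineFun k)).intervalIntegral_comp_comm (hi s hs)).symm
  have h3 : ContinuousOn (fun r => sineCoeff (w r) k) (Ioo p q) :=
    (continuous_sineCoeff k).comp_continuousOn hw
  rw [sineCoeff_add, h2, intervalIntegral.integral_eq_sub_of_hasDerivAt
    (f := fun t => sineCoeff (u t) k) (fun r hr => hd k r (hsub s hs hr))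
    (h3.mono (hsub s hs)).intervalIntegrable]
  ring

theorem wnorm_heat_le_of_le {β δ m t : ℝ} (hm : 0 < m) (ht : m ≤ t) (h0 : 0 ≤ δ) (h2 : δ ≤ 2)
    (x : ℕ → ℝ) : wnorm (β + δ) (heat t x) ≤ ENNReal.ofReal (2 * m ^ (-δ)) * wnorm β x := by
  have e : heat t x = heat (t - m) (heat m x) := by rw [heat_heat, sub_add_cancel]
  rw [e]
  exact (wnorm_heat_le_self (by linarith) _ _).trans (wnorm_heat_le hm h0 h2 x)

/-- The coefficients of the time derivative. -/
def slope (g : L2Pi) (a : ℕ → ℝ) (k : ℕ) : ℝ := -((k : ℝ) + 1) ^ 2 * a k + sineCoeff g k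

theorem wnorm_mul_sq (κ : ℝ) (a : ℕ → ℝ) :
    wnorm κ (fun k : ℕ => -((k : ℝ) + 1) ^ 2 * a k) = wnorm (1 + κ) a := by
  refine eLpNorm_congr_norm_ae (Eventually.of_forall fun k => ?_)
  simp only [norm_mul, norm_neg, mul_add, mul_one]
  rw [rpow_add (by positivity), rpow_two, norm_mul]
  ring

/-- Freeze the forcing at its final value. Its Duhamel integral is explicit and cancels f(t) up to a
smooth term, leaving a forcing f(s) - f(t) that vanishes at the singular end of the kernel. -/
theorem slope_arc {f : ℝ → L2Pi} {K : ℝ} (hfm : AEStronglyMeasurable f volume)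
    (hK : ∀ s, ‖f s‖ ≤ K) (p t : ℝ) (z : ℕ → ℝ) :
    slope (f t) (arc f p z t) = (fun k : ℕ => -((k : ℝ) + 1) ^ 2 * heat (t - p) z k) +
      (fun k : ℕ => -((k : ℝ) + 1) ^ 2 * duhamel (f - fun _ => f t) p t k) +
      heat (t - p) (sineCoeff (f t)) := by
  have hconst : ∀ k : ℕ, -((k : ℝ) + 1) ^ 2 * duhamel (fun _ => f t) p t k =
      -(1 - exp (-(((k : ℝ) + 1) ^ 2 * (t - p)))) * sineCoeff (f t) k := by
    intro k
    have hl : ((k : ℝ) + 1) ^ 2 ≠ 0 := by positivity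
    set l := ((k : ℝ) + 1) ^ 2
    have hd : ∀ s, HasDerivAt (fun s => exp (-(l * (t - s))) / l) (exp (-(l * (t - s)))) s := by
      intro s
      have h1 : HasDerivAt (fun s => exp (-(l * (t - s))) / l)
          (exp (-(l * (t - s))) * (-(l * (-1))) / l) s :=
        (((hasDerivAt_id s).const_sub t).const_mul l).neg.exp.div_const l
      convert h1 using 1
      field_simp
    rw [duhamel, intervalIntegral.integral_mul_const,
      intervalIntegral.integral_eq_sub_of_hasDerivAt (fun s _ => hd s)
        ((by fun_prop : Continuous fun s => exp (-(l * (t - s)))).intervalIntegrable _ _),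
      sub_self, mul_zero, neg_zero, exp_zero]
    field_simp
  funext k
  rw [duhamel_sub hfm hK aestronglyMeasurable_const (fun _ => le_refl ‖f t‖)]
  simp only [slope, arc, Pi.add_apply, Pi.sub_apply, mul_sub, mul_add, hconst, heat]
  ring

theorem exists_slope_bound {f : ℝ → L2Pi} {K : ℝ} (hfm : AEStronglyMeasurable f volume)
    (hK : ∀ s, ‖f s‖ ≤ K) {p m e : ℝ} (hm : 0 < m) (he : e ≤ p + 1) {C r : ℝ≥0} (hr : 0 < r)
    (hf : HolderOnWith C r f (Icc p e)) {z : ℕ → ℝ} (hz : wnorm 0 z ≠ ⊤) :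
    ∃ κ : ℝ, 0 < κ ∧ ∃ M : ℝ≥0∞, M ≠ ⊤ ∧ ∀ t, p + m ≤ t → t ≤ e →
      wnorm κ (slope (f t) (arc f p z t)) ≤ M := by
  -- In X^{1+ρ/2} the squared kernel (t-s)^{-(1+ρ)} meets the squared Hölder bound (t-s)^{2ρ},
  -- leaving the integrable power ρ - 1. Capping ρ at 1 respects the range β ≤ 3/2, and intervals of
  -- length at most 1 allow the exponent to be lowered.
  set ρ : ℝ := min r 1 with hρ
  have hρ0 : 0 < ρ := lt_min (by exact_mod_cast hr) one_pos
  have hρ1 : ρ ≤ 1 := min_le_right _ _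
  have hkm := kernelMass_ne_top (γ := 1 - ρ) (by linarith) 1
  refine ⟨ρ / 2, by positivity, ENNReal.ofReal (2 * m ^ (-(1 + ρ / 2))) * wnorm 0 z +
    (2 * (C ^ 2 : ℝ≥0) * kernelMass (1 - ρ) 1) ^ (1 / 2 : ℝ) +
    ENNReal.ofReal (2 * m ^ (-(ρ / 2))) * ENNReal.ofReal K, ?_, fun t ht hte => ?_⟩
  · have : (2 * (C ^ 2 : ℝ≥0) * kernelMass (1 - ρ) 1) ^ (1 / 2 : ℝ) ≠ ⊤ :=
      ENNReal.rpow_ne_top_of_nonneg (by norm_num) (by finiteness)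
    finiteness
  rw [slope_arc hfm hK p t z]
  refine (wnorm_add_le _ _ _).trans (add_le_add ((wnorm_add_le _ _ _).trans (add_le_add ?_ ?_)) ?_)
  · rw [wnorm_mul_sq]
    have := wnorm_heat_le_of_le (β := 0) (δ := 1 + ρ / 2) hm (show m ≤ t - p by linarith)
      (by positivity) (by linarith) z
    rwa [zero_add] at this
  · rw [wnorm_mul_sq]
    refine le_rpow_half_of_sq_le ?_
    refine (wnorm_duhamel_sq_le_of_bound (γ := 1 - ρ) (K := C ^ 2) (by linarith)
      (hfm.sub aestronglyMeasurable_const).restrict (by linarith) (by linarith)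
      fun s hs => ?_).trans ?_
    · have hts : 0 < t - s := sub_pos.2 hs.2
      have h1 : ‖(f - fun _ : ℝ => f t : ℝ → L2Pi) s‖ₑ ≤ ENNReal.ofReal (C * (t - s) ^ ρ) := by
        have h2 := hf.dist_le (x := s) (y := t) ⟨hs.1.le, by linarith [hs.2]⟩ ⟨by linarith, hte⟩
        rw [dist_eq_norm, Real.dist_eq, abs_sub_comm, abs_of_pos hts] at h2
        rw [Pi.sub_apply, ← ofReal_norm]
        apply ENNReal.ofReal_le_ofReal
        refine h2.trans ?_
        gcongr ?_ * ?_
        exact rpow_le_rpow_of_exponent_ge hts (by linarith [hs.1]) (min_le_left _ _)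
      calc _ ≤ ENNReal.ofReal ((t - s) ^ (-(2 * (1 + ρ / 2) - 1))) *
            ENNReal.ofReal (C * (t - s) ^ ρ) ^ 2 := by gcongr
        _ = _ := by
            rw [← ENNReal.ofReal_pow (by positivity), ← ENNReal.ofReal_mul (by positivity), mul_pow,
              mul_left_comm, ENNReal.ofReal_mul (by positivity)]
            congr 1
            · rw [← NNReal.coe_pow, ENNReal.ofReal_coe_nnreal]
            · rw [← rpow_natCast, ← rpow_mul hts.le, ← rpow_add hts]
              congr 2
              push_cast; ring
    · gcongr
      exact kernelMass_mono _ (by linarith)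
  · have := wnorm_heat_le_of_le (β := 0) (δ := ρ / 2) hm (show m ≤ t - p by linarith)
      (by positivity) (by linarith) (sineCoeff (f t))
    rw [zero_add] at this
    refine this.trans ?_
    gcongr
    rw [← enorm_eq_wnorm, ← ofReal_norm]
    exact ENNReal.ofReal_le_ofReal (hK t)

/-- Mild solutions with locally Hölder continuous forcing are classical solutions. -/
theorem satisfiesHeat_of_arc {f u : ℝ → L2Pi} {K s e t₀ : ℝ} (hfm : AEStronglyMeasurable f volume)
    (hK : ∀ s, ‖f s‖ ≤ K) {x : ℕ → ℝ} (hx : wnorm 0 x ≠ ⊤)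
    (hu : ∀ t ∈ Ioo s e, sineCoeff (u t) = arc f s x t) (ht₀ : t₀ ∈ Ioo s e) {C r : ℝ≥0}
    (hr : 0 < r) {U : Set ℝ} (hU : U ∈ 𝓝 t₀) (hf : HolderOnWith C r f U) :
    SatisfiesHeatAt f u t₀ ∧ ContinuousAt (deriv u) t₀ := by
  -- The solution is restarted at t₀ - η, inside the Hölder neighbourhood; η ≤ 1/2 keeps the
  -- interval length at most 1.
  obtain ⟨η, hη, hη1, hηU⟩ : ∃ η : ℝ, 0 < η ∧ η ≤ 1 / 2 ∧
      Icc (t₀ - η) (t₀ + η) ⊆ U ∩ Ioo s e := by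
    obtain ⟨η, hη, h⟩ := Metric.nhds_basis_closedBall.mem_iff.1
      (inter_mem hU (isOpen_Ioo.mem_nhds ht₀))
    refine ⟨min η (1 / 2), by positivity, min_le_right _ _, subset_trans ?_ h⟩
    rw [Real.closedBall_eq_Icc]
    exact Icc_subset_Icc (by linarith [min_le_left η (1 / 2)])
      (by linarith [min_le_left η (1 / 2)])
  have hHol := hf.mono (hηU.trans inter_subset_left)
  have hfc : ∀ t ∈ Ioo (t₀ - η) (t₀ + η), ContinuousAt f t := fun t ht =>
    (hHol.uniformContinuousOn hr).continuousOn.continuousAt (Icc_mem_nhds ht.1 ht.2)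
  set z := arc f s x (t₀ - η)
  have hp : s ≤ t₀ - η := (hηU ⟨le_rfl, by linarith⟩).2.1.le
  have hz : wnorm 0 z ≠ ⊤ := by
    obtain ⟨D, hD, h⟩ := exists_wnorm_arc_le hfm hK (t₀ - η - s)
    exact ne_top_of_le_ne_top (by finiteness) (h 0 s (t₀ - η) x (by norm_num) hp le_rfl)
  have hu' : ∀ t ∈ Ioo (t₀ - η / 2) (t₀ + η / 2), sineCoeff (u t) = arc f (t₀ - η) z t := by
    intro t ht
    rw [hu t (hηU ⟨by linarith [ht.1], by linarith [ht.2]⟩).2]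
    exact arc_arc hfm hK s (t₀ - η) t x
  obtain ⟨κ, hκ, M, hM, hbd⟩ := exists_slope_bound hfm hK (m := η / 2) (by positivity)
    (show t₀ + η ≤ t₀ - η + 1 by linarith) hr hHol hz
  have hbd' : ∀ t ∈ Ioo (t₀ - η / 2) (t₀ + η / 2), wnorm κ (slope (f t) (sineCoeff (u t))) ≤ M :=
    fun t ht => by
      rw [hu' t ht]
      exact hbd t (by linarith [ht.1]) (by linarith [ht.2])
  have hex : ∀ t, ∃ w : L2Pi, t ∈ Ioo (t₀ - η / 2) (t₀ + η / 2) →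
      sineCoeff w = slope (f t) (sineCoeff (u t)) := by
    intro t
    by_cases ht : t ∈ Ioo (t₀ - η / 2) (t₀ + η / 2)
    · obtain ⟨w, hw⟩ := exists_sineCoeff_eq (ne_top_of_le_ne_top hM
        ((wnorm_mono_exponent hκ.le _).trans (hbd' t ht)))
      exact ⟨w, fun _ => hw⟩
    · exact ⟨0, fun h => absurd h ht⟩
  choose w hw using hex
  have hd : ∀ k, ∀ t ∈ Ioo (t₀ - η / 2) (t₀ + η / 2),
      HasDerivAt (fun t => sineCoeff (u t) k) (sineCoeff (w t) k) t := by
    intro k t ht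
    rw [hw t ht, hu' t ht]
    refine (hasDerivAt_arc hfm hK (t₀ - η) z
      (hfc t ⟨by linarith [ht.1], by linarith [ht.2]⟩) k).congr_of_eventuallyEq ?_
    filter_upwards [isOpen_Ioo.mem_nhds ht] with r hr
    rw [hu' r hr]
  have hwc : ContinuousOn w (Ioo (t₀ - η / 2) (t₀ + η / 2)) := by
    intro t ht
    refine ContinuousAt.continuousWithinAt (continuousAt_of_coeff hκ hM (fun k => ?_) ?_)
    · have h1 : ContinuousAt (fun t => slope (f t) (sineCoeff (u t)) k) t :=
        (continuousAt_const.mul (hd k t ht).continuousAt).add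
          ((continuous_sineCoeff k).continuousAt.comp
            (hfc t ⟨by linarith [ht.1], by linarith [ht.2]⟩))
      refine h1.congr ?_
      filter_upwards [isOpen_Ioo.mem_nhds ht] with r hr
      rw [hw r hr]
    · filter_upwards [isOpen_Ioo.mem_nhds ht] with r hr
      rw [hw r hr]
      exact hbd' r hr
  have hder : ∀ t ∈ Ioo (t₀ - η / 2) (t₀ + η / 2), HasDerivAt u (w t) t := fun t ht =>
    hasDerivAt_of_coeff hwc hd ht
  have hmem : t₀ ∈ Ioo (t₀ - η / 2) (t₀ + η / 2) := ⟨by linarith, by linarith⟩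
  constructor
  · obtain ⟨v, h1, h2, h3⟩ := exists_second_weakDeriv (u := u t₀) (w := w t₀ - f t₀) fun k => by
      rw [sineCoeff_sub, hw t₀ hmem, slope]; ring
    exact ⟨v, w t₀ - f t₀, h1, h2, h3, by rw [sub_add_cancel]; exact hder t₀ hmem⟩
  · refine ContinuousAt.congr (hwc.continuousAt (isOpen_Ioo.mem_nhds hmem)) ?_
    filter_upwards [isOpen_Ioo.mem_nhds hmem] with t ht
    exact (hder t ht).deriv.symm

/-! ### The bounded solution -/

theorem FracSpace.tendsto_of_wnorm {α : ℝ} {ι : Type*} {l : Filter ι} {u : ι → FracSpace α}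
    {v : FracSpace α} (h : ∀ ε : ℝ≥0∞, 0 < ε → ∀ᶠ t in l,
      wnorm α (sineCoeff (u t).toL2 - sineCoeff v.toL2) < ε) : Tendsto u l (𝓝 v) := by
  rw [EMetric.tendsto_nhds]
  intro ε hε
  filter_upwards [h ε hε] with t ht
  rwa [edist_eq_enorm_sub, FracSpace.enorm_sub_eq]

/-- `y` is the sequence of post-impulse states and `u` the mild solution through them. -/
structure IsMild (τ b c : ℤ → ℝ) (f : ℝ → L2Pi) {α : ℝ} (y : ℤ → L2Pi) (Y : ℝ)
    (u : ℝ → FracSpace α) : Prop where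
  bound : ∀ j, ‖y j‖ ≤ Y
  step_eq : ∀ j, sineCoeff (y (j + 1)) = step τ b c f j (sineCoeff (y j))
  coeff : ∀ j, ∀ t ∈ Ico (τ j) (τ (j + 1)), sineCoeff (u t).toL2 = arc f (τ j) (sineCoeff (y j)) t

variable {τ b c : ℤ → ℝ} {f : ℝ → L2Pi} {a C H K β γ α Y : ℝ} {y : ℤ → L2Pi}
  {u : ℝ → FracSpace α}

theorem wnorm_zero_le_of_norm_le {u : L2Pi} {Y : ℝ} (h : ‖u‖ ≤ Y) :
    wnorm 0 (sineCoeff u) ≤ ENNReal.ofReal Y := by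
  rw [← enorm_eq_wnorm, ← ofReal_norm]
  exact ENNReal.ofReal_le_ofReal h

/-- Every state is the image of its predecessor, so the smoothing of one step applies at every
index. -/
theorem Setting.exists_state_bound (S : Setting τ b c f a C H K β γ) (hy : ∀ j, ‖y j‖ ≤ Y)
    (hs : ∀ j, sineCoeff (y (j + 1)) = step τ b c f j (sineCoeff (y j))) {σ : ℝ} (h0 : 0 ≤ σ)
    (h1 : σ < 1 / 2) : ∃ M : ℝ≥0∞, M ≠ ⊤ ∧ ∀ j, wnorm σ (sineCoeff (y j)) ≤ M := by
  obtain ⟨M, hM, h⟩ := S.exists_wnorm_step_le h0 h1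
  refine ⟨M + M * ENNReal.ofReal Y, by finiteness, fun j => ?_⟩
  have := hs (j - 1)
  rw [sub_add_cancel] at this
  rw [this]
  refine (h _ _).trans ?_
  gcongr
  exact wnorm_zero_le_of_norm_le (hy _)

theorem Setting.exists_arc_element (S : Setting τ b c f a C H K β γ) (hα : 0 ≤ α) (hα' : α < 1 / 2)
    (hy : ∀ j, ‖y j‖ ≤ Y)
    (hs : ∀ j, sineCoeff (y (j + 1)) = step τ b c f j (sineCoeff (y j))) (j : ℤ) {t : ℝ}
    (ht : t ∈ Icc (τ j) (τ (j + 1))) :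
    ∃ v : FracSpace α, sineCoeff v.toL2 = arc f (τ j) (sineCoeff (y j)) t := by
  obtain ⟨M, hM, h⟩ := S.exists_state_bound hy hs hα hα'
  obtain ⟨D, hD, h'⟩ := exists_wnorm_arc_le S.meas S.bound H
  have hfin : wnorm α (arc f (τ j) (sineCoeff (y j)) t) ≠ ⊤ :=
    ne_top_of_le_ne_top (by finiteness : M + D ≠ ⊤)
      ((h' α _ _ _ hα'.le ht.1 (by linarith [ht.2, S.gap_le j])).trans
        (add_le_add (h j) le_rfl))
  obtain ⟨v, hv⟩ := exists_sineCoeff_eq (ne_top_of_le_ne_top hfin (wnorm_mono_exponent hα _))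
  obtain ⟨V, hV⟩ := exists_fracSpace (α := α) v (by rw [hv]; exact hfin)
  exact ⟨V, by rw [hV, hv]⟩

theorem Setting.exists_isMild (S : Setting τ b c f a C H K β γ) (hα : 0 ≤ α) (hα' : α < 1 / 2) :
    ∃ (y : ℤ → L2Pi) (Y : ℝ) (u : ℝ → FracSpace α), IsMild τ b c f y Y u := by
  obtain ⟨y, ⟨Y, hY⟩, hy⟩ := S.exists_bounded_states
  have hm := strictMono_of_gap S.gap
  choose i hi hi' using exists_index S.gap
  choose u hu using fun t => S.exists_arc_element hα hα' hY hy (i t) ⟨hi t, (hi' t).le⟩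
  refine ⟨y, Y, u, hY, hy, fun j t ht => ?_⟩
  have h1 := hm.lt_iff_lt.1 ((hi t).trans_lt ht.2)
  have h2 := hm.lt_iff_lt.1 (ht.1.trans_lt (hi' t))
  rw [hu, show i t = j by omega]

theorem exists_modulus (S : Setting τ b c f a C H K β γ) (hα : 0 ≤ α) (hα' : α < 1 / 2)
    (hu : IsMild τ b c f y Y u) {ε : ℝ≥0∞} (hε : 0 < ε) :
    ∃ δ : ℝ, 0 < δ ∧ ∀ j, ∀ t ∈ Icc (τ j) (τ (j + 1)), ∀ s ∈ Icc (τ j) (τ (j + 1)), |t - s| < δ →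
      wnorm α (arc f (τ j) (sineCoeff (y j)) t - arc f (τ j) (sineCoeff (y j)) s) < ε := by
  -- Any exponent strictly between α and 1/2 would do; the midpoint is taken.
  obtain ⟨M, hM, h⟩ := S.exists_state_bound hu.bound hu.step_eq (σ := (α + 1 / 2) / 2)
    (by linarith) (by linarith)
  obtain ⟨δ, hδ, h'⟩ := exists_arc_modulus S.meas S.bound H (α := α) (σ := (α + 1 / 2) / 2) hα
    (by linarith) (by linarith) hM hε
  exact ⟨δ, hδ, fun j t ht s hs hd => h' (τ j) s t _ (h j) hs.1 ht.1
    (by linarith [hs.2, S.gap_le j]) (by linarith [ht.2, S.gap_le j]) hd⟩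

theorem mem_Ioo_of_notMem_range (hgap : ∀ j : ℤ, 1 / 2 ≤ τ (j + 1) - τ j) {t : ℝ}
    (ht : t ∉ range τ) : ∃ j, t ∈ Ioo (τ j) (τ (j + 1)) := by
  obtain ⟨j, hj, hj'⟩ := exists_index hgap t
  exact ⟨j, lt_of_le_of_ne hj fun h => ht ⟨j, h⟩, hj'⟩

theorem IsMild.continuousWithinAt (S : Setting τ b c f a C H K β γ) (hα : 0 ≤ α) (hα' : α < 1 / 2)
    (hu : IsMild τ b c f y Y u) {j : ℤ} {t : ℝ} (ht : t ∈ Ico (τ j) (τ (j + 1))) :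
    ContinuousWithinAt u (Ico (τ j) (τ (j + 1))) t := by
  refine FracSpace.tendsto_of_wnorm fun ε hε => ?_
  obtain ⟨δ, hδ, h⟩ := exists_modulus S hα hα' hu hε
  filter_upwards [self_mem_nhdsWithin, mem_nhdsWithin_of_mem_nhds (Metric.ball_mem_nhds t hδ)]
    with s hs hs'
  rw [hu.coeff j s hs, hu.coeff j t ht]
  exact h j s (Ico_subset_Icc_self hs) t (Ico_subset_Icc_self ht) hs'

theorem IsMild.exists_left_limit (S : Setting τ b c f a C H K β γ) (hα : 0 ≤ α) (hα' : α < 1 / 2)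
    (hu : IsMild τ b c f y Y u) (j : ℤ) : ∃ v : FracSpace α,
      sineCoeff v.toL2 = arc f (τ j) (sineCoeff (y j)) (τ (j + 1)) ∧
        Tendsto u (𝓝[<] (τ (j + 1))) (𝓝 v) := by
  have hlt : τ j < τ (j + 1) := by linarith [S.gap j]
  obtain ⟨v, hv⟩ := S.exists_arc_element hα hα' hu.bound hu.step_eq j (right_mem_Icc.2 hlt.le)
  refine ⟨v, hv, FracSpace.tendsto_of_wnorm fun ε hε => ?_⟩
  obtain ⟨δ, hδ, h⟩ := exists_modulus S hα hα' hu hε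
  filter_upwards [Ico_mem_nhdsLT hlt,
    mem_nhdsWithin_of_mem_nhds (Metric.ball_mem_nhds (τ (j + 1)) hδ)] with s hs hs'
  rw [hu.coeff j s hs, hv]
  exact h j s (Ico_subset_Icc_self hs) _ (right_mem_Icc.2 hlt.le) hs'

theorem IsMild.isImpulsiveSolution (S : Setting τ b c f a C H K β γ) (hα : 0 ≤ α) (hα' : α < 1 / 2)
    (hu : IsMild τ b c f y Y u) (hf : IsLocallyHolderOff τ f) :
    IsImpulsiveSolution τ b c f univ u := by
  have hheat : ∀ t, t ∉ range τ → SatisfiesHeatAt f (fun s => (u s).toL2) t ∧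
      ContinuousAt (deriv fun s => (u s).toL2) t := by
    intro t ht
    obtain ⟨j, hj⟩ := mem_Ioo_of_notMem_range S.gap ht
    obtain ⟨C, r, hr, U, hU, hH⟩ := hf t ht
    exact satisfiesHeat_of_arc S.meas S.bound (wnorm_zero_sineCoeff_ne_top (y j))
      (fun s hs => hu.coeff j s (Ioo_subset_Ico_self hs)) hj hr hU hH
  refine ⟨fun t _ => ?_, fun t _ ht => ?_, fun t _ ht => (hheat t ht).1,
    fun t _ ht => (hheat t ht).2, fun j _ => ?_⟩
  · obtain ⟨j, hj, hj'⟩ := exists_index S.gap t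
    refine (hu.continuousWithinAt S hα hα' ⟨hj, hj'⟩).mono_of_mem_nhdsWithin ?_
    filter_upwards [Ico_mem_nhdsGE hj'] with s hs
    exact ⟨hj.trans hs.1, hs.2⟩
  · obtain ⟨j, hj⟩ := mem_Ioo_of_notMem_range S.gap ht
    exact (hu.continuousWithinAt S hα hα' (Ioo_subset_Ico_self hj)).continuousAt
      (Ico_mem_nhds hj.1 hj.2)
  · obtain ⟨v, hv, hlim⟩ := hu.exists_left_limit S hα hα' (j - 1)
    rw [sub_add_cancel] at hv hlim
    refine ⟨v, hlim, isImpulse_of_sineCoeff ?_ ?_⟩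
    -- The left limit lies in X^{1/2}, although α < 1/2, because a time of at least 1/2 has passed
    -- since the previous impulse.
    · rw [hv, arc]
      have hg := S.gap (j - 1)
      have hg' := S.gap_le (j - 1)
      rw [sub_add_cancel] at hg hg'
      obtain ⟨D, hD, h⟩ := exists_duhamel_bound S.meas S.bound H (σ := 1 / 2) le_rfl (by norm_num)
      refine ne_top_of_le_ne_top ?_ ((wnorm_add_le _ _ _).trans (add_le_add
        (wnorm_heat_le_half hg (by norm_num) (by norm_num) _) (h _ _ (by linarith) hg')))
      have := wnorm_zero_sineCoeff_ne_top (y (j - 1))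
      finiteness
    · rw [hu.coeff j (τ j) ⟨le_rfl, by linarith [S.gap j]⟩, arc_self, hv]
      have := hu.step_eq (j - 1)
      rw [step, sub_add_cancel] at this
      exact this

/-! ### Almost periodicity of the bounded solution -/

/-- `q` and `r` are common almost periods of accuracy `d`. -/
def CommonPeriod (τ b c : ℤ → ℝ) (f : ℝ → L2Pi) (d : ℝ) (q : ℤ) (r : ℝ) : Prop :=
  (∀ k, |τ (k + q) - τ k - r| < d) ∧ (∀ k, |b (k + q) - b k| < d) ∧
    (∀ k, |c (k + q) - c k| < d) ∧ ∀ t, (∀ k, d ≤ |t - τ k|) → ‖f (t + r) - f t‖ < d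

theorem eventually_ofReal_mul_le {A ε : ℝ≥0∞} (hA : A ≠ ⊤) (hε : 0 < ε) :
    ∀ᶠ d in 𝓝[>] (0 : ℝ), ENNReal.ofReal d * A ≤ ε := by
  have h1 : Tendsto (fun d : ℝ => ENNReal.ofReal d * A) (𝓝 0) (𝓝 0) := by
    have := ENNReal.Tendsto.mul_const (b := A) (ENNReal.continuous_ofReal.tendsto 0) (Or.inr hA)
    simpa using this
  exact (h1.mono_left nhdsWithin_le_nhds).eventually (ge_mem_nhds hε)

/-- Near the two impulse moments only the crude bound K is available, but on a set of measure at
most 6d. -/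
theorem lintegral_sq_le_of_bad {g : ℝ → L2Pi} {m t e K d s₁ s₂ : ℝ} (hmt : m ≤ t)
    (h1 : ∀ s ∈ Ioo m t, s ∉ Icc s₁ (s₁ + 3 * d) ∪ Icc (s₂ - 3 * d) s₂ → ‖g s‖ ≤ e)
    (h2 : ∀ s, ‖g s‖ ≤ K) (hd : 0 ≤ d) :
    ∫⁻ s in Ioo m t, ‖g s‖ₑ ^ 2 ≤
      ENNReal.ofReal (e ^ 2 * (t - m) + K ^ 2 * (6 * d)) := by
  set B := Icc s₁ (s₁ + 3 * d) ∪ Icc (s₂ - 3 * d) s₂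
  have hB : MeasurableSet B := measurableSet_Icc.union measurableSet_Icc
  calc _ ≤ ∫⁻ s in Ioo m t, (ENNReal.ofReal (e ^ 2) +
        B.indicator (fun _ => ENNReal.ofReal (K ^ 2)) s) := by
        refine setLIntegral_mono' measurableSet_Ioo fun s hs => ?_
        by_cases hsB : s ∈ B
        · rw [indicator_of_mem hsB]
          exact (enorm_sq_le_of_norm_le (h2 s)).trans le_add_self
        · rw [indicator_of_notMem hsB, add_zero]
          exact enorm_sq_le_of_norm_le (h1 s hs hsB)
    _ ≤ ENNReal.ofReal (e ^ 2) * ENNReal.ofReal (t - m) +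
        ENNReal.ofReal (K ^ 2) * ENNReal.ofReal (6 * d) := by
        rw [lintegral_add_left measurable_const, setLIntegral_const, Real.volume_Ioo,
          lintegral_indicator_const hB]
        gcongr
        calc _ ≤ volume B := Measure.restrict_apply_le _ _
          _ ≤ volume (Icc s₁ (s₁ + 3 * d)) + volume (Icc (s₂ - 3 * d) s₂) := measure_union_le _ _
          _ = _ := by
            rw [Real.volume_Icc, Real.volume_Icc, ← ENNReal.ofReal_add (by linarith) (by linarith)]
            congr 1; ring
    _ = _ := by
        rw [ENNReal.ofReal_add (by have := sub_nonneg.2 hmt; positivity) (by positivity),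
          ENNReal.ofReal_mul (sq_nonneg e), ENNReal.ofReal_mul (sq_nonneg K)]

/-- After translation both integrals end at t. Their starting points differ by at most 2d, and on
the common interval f and its translate are close except within 3d of the impulse moments. Since the
X^{1/2} norm sees only the square integral in time, the exceptional pieces are negligible. -/
theorem eventually_duhamel_compare (S : Setting τ b c f a C H K β γ)
    (hf : IsWAlmostPeriodic τ f) {ε : ℝ≥0∞} (hε : 0 < ε) :
    ∀ᶠ d in 𝓝[>] (0 : ℝ), ∀ q r, CommonPeriod τ b c f d q r → ∀ j t t',
      τ j + 2 * d ≤ t → t ≤ τ (j + 1) → |t' - t - r| ≤ d →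
      wnorm (1 / 2) (duhamel f (τ (j + q)) t' - duhamel f (τ j) t) ≤ ε := by
  have hK0 : 0 ≤ K := (norm_nonneg _).trans (S.bound 0)
  have hH0 : 0 ≤ H := by
    exact (by norm_num : (0 : ℝ) ≤ 1 / 2).trans ((S.gap 0).trans (S.gap_le 0))
  have hlim : Tendsto (fun e : ℝ => ENNReal.ofReal (2 * K ^ 2 * (2 * e)) ^ (1 / 2 : ℝ) +
      ENNReal.ofReal (2 * K ^ 2 * (2 * e)) ^ (1 / 2 : ℝ) +
      ENNReal.ofReal (2 * ((2 * e) ^ 2 * H + (2 * K) ^ 2 * (6 * e))) ^ (1 / 2 : ℝ)) (𝓝[>] 0)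
      (𝓝 0) := by
    have : Continuous (fun e : ℝ => ENNReal.ofReal (2 * K ^ 2 * (2 * e)) ^ (1 / 2 : ℝ) +
      ENNReal.ofReal (2 * K ^ 2 * (2 * e)) ^ (1 / 2 : ℝ) +
      ENNReal.ofReal (2 * ((2 * e) ^ 2 * H + (2 * K) ^ 2 * (6 * e))) ^ (1 / 2 : ℝ)) :=
      ((ENNReal.continuous_rpow_const.comp (ENNReal.continuous_ofReal.comp (by fun_prop))).add
        (ENNReal.continuous_rpow_const.comp (ENNReal.continuous_ofReal.comp (by fun_prop)))).add
        (ENNReal.continuous_rpow_const.comp (ENNReal.continuous_ofReal.comp (by fun_prop)))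
    have h0 := (this.tendsto 0).mono_left (nhdsWithin_le_nhds (s := Ioi 0))
    simpa using h0
  obtain ⟨e, he', he⟩ := ((hlim.eventually (ge_mem_nhds hε)).and self_mem_nhdsWithin).exists
  have he0 : 0 < e := he
  obtain ⟨δ, hδ, hu⟩ := hf.uniform e he0
  filter_upwards [Ioo_mem_nhdsGT (show (0 : ℝ) < min e δ by positivity)] with d hd q r hq j t t'
    ht ht' htt
  have hd0 : 0 < d := hd.1
  have hde : d ≤ e := hd.2.le.trans (min_le_left _ _)
  have hdδ : d < δ := hd.2.trans_le (min_le_right _ _)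
  obtain ⟨hq1, -, -, hq4⟩ := hq
  -- The actual time shift θ differs from the almost period r by at most d; uniform continuity of f
  -- on the shifted interval bridges the two.
  set θ := t' - t with hθ
  set g : ℝ → L2Pi := fun s => f (s + θ) with hg
  have hgm : AEStronglyMeasurable g volume :=
    S.meas.comp_measurePreserving (measurePreserving_add_right volume θ)
  have hgK : ∀ s, ‖g s‖ ≤ K := fun s => S.bound _
  set a'' := τ (j + q) - θ with ha''
  have e1 : duhamel f (τ (j + q)) t' = duhamel g a'' t := by
    have := duhamel_translate f a'' t θ
    rwa [show a'' + θ = τ (j + q) by rw [ha'']; ring, show t + θ = t' by rw [hθ]; ring] at this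
  have h1 := abs_lt.1 (hq1 j)
  have h2 := abs_le.1 htt
  set m := max (τ j) a'' with hm
  have hm1 : τ j ≤ m := le_max_left _ _
  have hm2 : a'' ≤ m := le_max_right _ _
  have hm3 : m ≤ τ j + 2 * d := max_le (by linarith) (by rw [ha'']; linarith [h1.2, h2.1])
  have hm4 : m ≤ a'' + 2 * d := max_le (by rw [ha'']; linarith [h1.1, h2.2]) (by linarith)
  have hmt : m ≤ t := hm3.trans ht
  have e2 : duhamel f (τ (j + q)) t' - duhamel f (τ j) t =
      heat (t - m) (duhamel g a'' m) - heat (t - m) (duhamel f (τ j) m) +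
        duhamel (g - f) m t := by
    rw [e1, duhamel_eq_add hgm hgK a'' m t, duhamel_eq_add S.meas S.bound (τ j) m t,
      duhamel_sub hgm hgK S.meas S.bound]
    abel
  rw [e2]
  refine le_trans ((wnorm_add_le _ _ _).trans (add_le_add ((wnorm_sub_le _ _ _).trans
    (add_le_add ?_ ?_)) ?_)) he'
  · refine (wnorm_heat_le_self (by linarith) _ _).trans (le_rpow_half_of_sq_le
      ((wnorm_half_duhamel_sq_le_of_bound hgm hgK hm2).trans ?_))
    apply ENNReal.ofReal_le_ofReal
    gcongr
    linarith
  · refine (wnorm_heat_le_self (by linarith) _ _).trans (le_rpow_half_of_sq_le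
      ((wnorm_half_duhamel_sq_le_of_bound S.meas S.bound hm1).trans ?_))
    apply ENNReal.ofReal_le_ofReal
    gcongr
    linarith
  · refine le_rpow_half_of_sq_le ((wnorm_half_duhamel_sq_le hmt (hgm.sub S.meas).restrict).trans ?_)
    rw [ENNReal.ofReal_mul zero_le_two]
    refine mul_le_mul' (by simp) ?_
    refine (lintegral_sq_le_of_bad (g := g - f) (e := 2 * e) (K := 2 * K) (s₁ := τ j)
      (s₂ := τ (j + 1)) hmt (fun s hs hsB => ?_) (fun s => ?_) hd0.le).trans ?_
    · rw [mem_union, not_or, mem_Icc, mem_Icc, not_and, not_and, not_le, not_le] at hsB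
      have hs1 : τ j + 3 * d < s := hsB.1 (by linarith [hs.1])
      have hs2 : s < τ (j + 1) - 3 * d := by
        by_contra h
        have := hsB.2 (not_lt.1 h)
        linarith [hs.2]
      have h3 := abs_lt.1 (hq1 (j + 1))
      rw [show j + 1 + q = j + q + 1 by ring] at h3
      have b1 := hq4 s (le_abs_sub_of_mem hf.strictMono (j := j) (by linarith) (by linarith))
      have b2 := hu (j + q) (s + θ) ⟨by linarith [h1.2, h2.1], by linarith [h3.1, h2.2]⟩ (s + r)
        ⟨by linarith [h1.2], by linarith [h3.1]⟩ (by
          rw [add_sub_add_left_eq_sub]; exact htt.trans_lt hdδ)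
      have e3 : (g - f) s = (f (s + θ) - f (s + r)) + (f (s + r) - f s) := by
        rw [Pi.sub_apply, hg]; abel
      rw [e3]
      linarith [norm_add_le (f (s + θ) - f (s + r)) (f (s + r) - f s)]
    · rw [Pi.sub_apply]
      linarith [norm_sub_le (g s) (f s), hgK s, S.bound s]
    · apply ENNReal.ofReal_le_ofReal
      gcongr
      linarith [S.gap_le j]

theorem jump_sub_jump (b b' c c' : ℝ) (v v' : ℕ → ℝ) :
    jump b' c' v' - jump b c v = ((v' - v) + b' • sinDeriv (v' - v)) + (b' - b) • sinDeriv v +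
      (c' - c) • sineCoeff parabola := by
  rw [jump, jump, sinDeriv_sub, smul_sub, sub_smul, sub_smul]
  abel

theorem eventually_step_compare (S : Setting τ b c f a C H K β γ) (hf : IsWAlmostPeriodic τ f)
    (Y : ℝ) {ε : ℝ≥0∞} (hε : 0 < ε) :
    ∀ᶠ d in 𝓝[>] (0 : ℝ), ∀ q r, CommonPeriod τ b c f d q r → ∀ j x,
      wnorm 0 x ≤ ENNReal.ofReal Y →
      wnorm 0 (step τ b c f (j + q) x - step τ b c f j x) ≤ ε := by
  obtain ⟨D, hD, hD'⟩ := exists_duhamel_bound S.meas S.bound H (σ := 1 / 2) le_rfl (by norm_num)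
  have hε2 : 0 < ε / 2 := ENNReal.half_pos hε.ne'
  obtain ⟨e, he, he0⟩ := ((eventually_ofReal_mul_le (A := ENNReal.ofReal (1 + β)) (by finiteness)
    hε2).and self_mem_nhdsWithin).exists
  have hpar := wnorm_zero_sineCoeff_ne_top parabola
  set A : ℝ≥0∞ := ENNReal.ofReal (1 + β) * (ENNReal.ofReal 2 *
    (ENNReal.ofReal (2 * (1 / 2 : ℝ) ^ (-(1 / 2 + 1 : ℝ))) * ENNReal.ofReal Y)) +
    (4 * ENNReal.ofReal Y + D) + wnorm 0 (sineCoeff parabola) with hA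
  filter_upwards [eventually_duhamel_compare S hf (ε := ENNReal.ofReal e)
    (ENNReal.ofReal_pos.2 he0), eventually_ofReal_mul_le (A := A) (by finiteness) hε2,
    Ioo_mem_nhdsGT (show (0 : ℝ) < 1 / 8 by norm_num)] with d hd1 hd2 hd3 q r hq j x hx
  have hg := S.gap j
  have hg' := S.gap (j + q)
  have h1 := hd1 q r hq j (τ (j + 1)) (τ (j + q + 1)) (by linarith [hd3.2]) le_rfl (by
    have := hq.1 (j + 1)
    rw [show j + 1 + q = j + q + 1 by ring] at this
    exact this.le)
  have hh : |(τ (j + q + 1) - τ (j + q)) - (τ (j + 1) - τ j)| ≤ 2 * d := by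
    have a1 := abs_lt.1 (hq.1 j)
    have a2 := abs_lt.1 (hq.1 (j + 1))
    rw [show j + 1 + q = j + q + 1 by ring] at a2
    rw [abs_le]
    constructor <;> linarith [a1.1, a1.2, a2.1, a2.2]
  have hbb := hq.2.1 (j + 1)
  have hcc := hq.2.2.1 (j + 1)
  rw [show j + 1 + q = j + q + 1 by ring] at hbb hcc
  rw [step, step, jump_sub_jump]
  set v := heat (τ (j + 1) - τ j) x + duhamel f (τ j) (τ (j + 1)) with hv
  set v' := heat (τ (j + q + 1) - τ (j + q)) x + duhamel f (τ (j + q)) (τ (j + q + 1)) with hv'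
  have hdiff : wnorm (1 / 2) (v' - v) ≤ ENNReal.ofReal (2 * d) *
      (ENNReal.ofReal (2 * (1 / 2 : ℝ) ^ (-(1 / 2 + 1 : ℝ))) * ENNReal.ofReal Y) +
        ENNReal.ofReal e := by
    have e1 : v' - v = (heat (τ (j + q + 1) - τ (j + q)) x - heat (τ (j + 1) - τ j) x) +
        (duhamel f (τ (j + q)) (τ (j + q + 1)) - duhamel f (τ j) (τ (j + 1))) := by
      rw [hv, hv']; abel
    rw [e1]
    refine (wnorm_add_le _ _ _).trans (add_le_add ?_ h1)
    have := wnorm_heat_sub_heat_le (β := 0) (δ := 1 / 2) (m := 1 / 2) (by norm_num) hg' hg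
      (by norm_num) (by norm_num) x
    rw [zero_add] at this
    refine this.trans ?_
    gcongr
  have hvb : wnorm (1 / 2) v ≤ 4 * ENNReal.ofReal Y + D :=
    (wnorm_add_le _ _ _).trans (add_le_add
      ((wnorm_heat_le_half hg (by norm_num) (by norm_num) x).trans (by gcongr))
      (hD' _ _ (by linarith) (S.gap_le j)))
  refine ((wnorm_add_le _ _ _).trans (add_le_add ((wnorm_add_le _ _ _).trans (add_le_add
    ((wnorm_zero_impulse_le (S.b_le _) _).trans (mul_le_mul_right hdiff _)) ?_)) ?_)).trans
    (b := ENNReal.ofReal (1 + β) * (ENNReal.ofReal (2 * d) *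
      (ENNReal.ofReal (2 * (1 / 2 : ℝ) ^ (-(1 / 2 + 1 : ℝ))) * ENNReal.ofReal Y) +
        ENNReal.ofReal e) + ENNReal.ofReal d * (4 * ENNReal.ofReal Y + D) +
        ENNReal.ofReal d * wnorm 0 (sineCoeff parabola)) ?_
  · rw [wnorm_smul, Real.enorm_eq_ofReal_abs]
    exact mul_le_mul' (ENNReal.ofReal_le_ofReal hbb.le) ((wnorm_zero_sinDeriv_le v).trans hvb)
  · rw [wnorm_smul, Real.enorm_eq_ofReal_abs]
    gcongr
  · rw [mul_comm 2 d, ENNReal.ofReal_mul hd3.1.le]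
    calc _ = ENNReal.ofReal d * A + ENNReal.ofReal e * ENNReal.ofReal (1 + β) := by
          rw [hA]; ring
      _ ≤ ε / 2 + ε / 2 := add_le_add hd2 he
      _ = ε := ENNReal.add_halves ε

/-- The shifted and the original states obey almost the same contractive recurrence, so their
weighted distance satisfies d_{j+1} ≤ ρ d_j + small on all of ℤ. -/
theorem eventually_state_compare (S : Setting τ b c f a C H K β γ) (hf : IsWAlmostPeriodic τ f)
    (hu : IsMild τ b c f y Y u) {ε : ℝ} (hε : 0 < ε) :
    ∀ᶠ d in 𝓝[>] (0 : ℝ), ∀ q r, CommonPeriod τ b c f d q r → ∀ j, ‖y (j + q) - y j‖ ≤ ε := by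
  set ρ := (1 + β) * exp (-a) with hρ
  have hβ := S.beta_nonneg
  have hρ0 : 0 ≤ ρ := by positivity
  have hρ1 : 0 < 1 - ρ := by linarith [S.contr]
  -- Chosen so that exp C · e / (1 - ρ) = exp(-C) ε; the two factors pay for the upper and the lower
  -- bound of the weights.
  set e := ε * exp (-C) * (1 - ρ) * exp (-C) with he
  have he0 : 0 < e := by positivity
  filter_upwards [eventually_step_compare S hf Y (ENNReal.ofReal_pos.2 he0)] with d hd q r hq j
  obtain ⟨M, hM, hM'⟩ := S.exists_wnorm_step_le le_rfl (by norm_num)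
  have hrec : ∀ j, weight τ a (j + 1) * ‖y (j + 1 + q) - y (j + 1)‖ ≤
      ρ * (weight τ a j * ‖y (j + q) - y j‖) + exp C * e := by
    intro j
    -- The intermediate `z` applies the unshifted step to the shifted state, separating the
    -- contraction from the change of the step map.
    obtain ⟨z, hz⟩ := exists_sineCoeff_eq (a := step τ b c f j (sineCoeff (y (j + q))))
      (ne_top_of_le_ne_top (by
        have := wnorm_zero_sineCoeff_ne_top (y (j + q)); finiteness) (hM' j _))
    have h1 := S.weighted_step_sub_le j hz (hu.step_eq j)
    have h2 : ‖y (j + 1 + q) - z‖ ≤ e := by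
      refine norm_le_of_enorm_le he0.le ?_
      rw [enorm_sub_eq_wnorm, hz, show j + 1 + q = j + q + 1 by ring, hu.step_eq]
      exact hd q r hq j _ (wnorm_zero_le_of_norm_le (hu.bound _))
    have h3 : ‖y (j + 1 + q) - y (j + 1)‖ ≤ ‖y (j + 1 + q) - z‖ + ‖z - y (j + 1)‖ :=
      norm_sub_le_norm_sub_add_norm_sub _ _ _
    have hw := (S.weight_bounds (j + 1)).2
    have hw0 : 0 ≤ weight τ a (j + 1) := (exp_pos _).le
    calc _ ≤ weight τ a (j + 1) * (‖y (j + 1 + q) - z‖ + ‖z - y (j + 1)‖) := by gcongr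
      _ = weight τ a (j + 1) * ‖z - y (j + 1)‖ + weight τ a (j + 1) * ‖y (j + 1 + q) - z‖ := by
          ring
      _ ≤ _ := add_le_add h1 (by gcongr)
  have hfin := le_div_of_recurrence (d := fun j => weight τ a j * ‖y (j + q) - y j‖) (ρ := ρ)
    (e := exp C * e) (D := exp C * (Y + Y)) hρ0 S.contr (fun j => by
      refine mul_le_mul (S.weight_bounds j).2 ?_ (norm_nonneg _) (exp_pos _).le
      exact (norm_sub_le _ _).trans (add_le_add (hu.bound _) (hu.bound _))) hrec j
  have hw := (S.weight_bounds j).1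
  have h4 : exp (-C) * ‖y (j + q) - y j‖ ≤ exp C * e / (1 - ρ) := le_trans (by gcongr) hfin
  have h5 : exp C * e / (1 - ρ) = exp (-C) * ε := by
    have : exp C * exp (-C) = 1 := by rw [← exp_add]; simp
    rw [he, div_eq_iff hρ1.ne']
    linear_combination (ε * (1 - ρ) * exp (-C)) * this
  rw [h5] at h4
  exact le_of_mul_le_mul_left h4 (exp_pos _)

/-- At distance ε from the impulses the heat flow has had time at least ε/2 to smooth, so L²
closeness of the states suffices. The three errors are the time shift, the change of state and the
Duhamel term, each at most ε/4. -/
theorem eventually_mild_compare (S : Setting τ b c f a C H K β γ) (hf : IsWAlmostPeriodic τ f)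
    (hα : 0 ≤ α) (hα' : α < 1 / 2) (hu : IsMild τ b c f y Y u) {ε : ℝ} (hε : 0 < ε) :
    ∀ᶠ d in 𝓝[>] (0 : ℝ), ∀ q r, CommonPeriod τ b c f d q r →
      ∀ t, (∀ k, ε ≤ |t - τ k|) → ‖u (t + r) - u t‖ < ε := by
  have hε3 : (0 : ℝ≥0∞) < ENNReal.ofReal (ε / 4) := ENNReal.ofReal_pos.2 (by positivity)
  set A₁ : ℝ≥0∞ := ENNReal.ofReal (2 * (ε / 2) ^ (-(α + 1))) * ENNReal.ofReal Y
  set A₂ : ℝ≥0∞ := ENNReal.ofReal (2 * (ε / 2) ^ (-α))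
  obtain ⟨e, he, he0⟩ := ((eventually_ofReal_mul_le (A := A₂) (by finiteness) hε3).and
    self_mem_nhdsWithin).exists
  filter_upwards [eventually_duhamel_compare S hf hε3, eventually_ofReal_mul_le (A := A₁)
    (by finiteness) hε3, eventually_state_compare S hf hu (ε := e) he0,
    Ioo_mem_nhdsGT (show (0 : ℝ) < ε / 2 by positivity)] with d hd1 hd2 hd3 hd4 q r hq t ht
  obtain ⟨j, hj, hj'⟩ := exists_index S.gap t
  have c1 : τ j + ε ≤ t := by
    have := ht j
    rw [abs_of_nonneg (by linarith)] at this
    linarith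
  have c2 : t ≤ τ (j + 1) - ε := by
    have := ht (j + 1)
    rw [abs_of_neg (by linarith)] at this
    linarith
  have h1 := abs_lt.1 (hq.1 j)
  have h2 := abs_lt.1 (hq.1 (j + 1))
  rw [show j + 1 + q = j + q + 1 by ring] at h2
  have hmem : t + r ∈ Ico (τ (j + q)) (τ (j + q + 1)) :=
    ⟨by linarith [h1.2, hd4.2], by linarith [h2.1, hd4.2]⟩
  have key : ‖u (t + r) - u t‖ₑ ≤ ENNReal.ofReal (3 * (ε / 4)) := by
    rw [FracSpace.enorm_sub_eq, hu.coeff j t ⟨hj, hj'⟩, hu.coeff (j + q) (t + r) hmem, arc, arc]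
    have e1 : heat (t + r - τ (j + q)) (sineCoeff (y (j + q))) + duhamel f (τ (j + q)) (t + r) -
        (heat (t - τ j) (sineCoeff (y j)) + duhamel f (τ j) t) =
        (heat (t + r - τ (j + q)) (sineCoeff (y (j + q))) -
          heat (t - τ j) (sineCoeff (y (j + q)))) +
        heat (t - τ j) (sineCoeff (y (j + q)) - sineCoeff (y j)) +
        (duhamel f (τ (j + q)) (t + r) - duhamel f (τ j) t) := by
      rw [heat_sub]; abel
    rw [e1, show 3 * (ε / 4) = ε / 4 + ε / 4 + ε / 4 by ring,
      ENNReal.ofReal_add (by positivity) (by positivity),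
      ENNReal.ofReal_add (by positivity) (by positivity)]
    refine (wnorm_add_le _ _ _).trans (add_le_add ((wnorm_add_le _ _ _).trans
      (add_le_add ?_ ?_)) ?_)
    · have h3 := wnorm_heat_sub_heat_le (β := 0) (δ := α) (m := ε / 2) (by positivity)
        (show ε / 2 ≤ t + r - τ (j + q) by linarith [h1.2, hd4.2])
        (show ε / 2 ≤ t - τ j by linarith) hα (by linarith) (sineCoeff (y (j + q)))
      rw [zero_add] at h3
      refine h3.trans (le_trans ?_ hd2)
      refine mul_le_mul' (ENNReal.ofReal_le_ofReal ?_) (mul_le_mul' le_rfl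
        (wnorm_zero_le_of_norm_le (hu.bound _)))
      rw [abs_le]
      constructor <;> linarith [h1.1, h1.2]
    · have h3 := wnorm_heat_le_of_le (β := 0) (δ := α) (m := ε / 2) (by positivity)
        (show ε / 2 ≤ t - τ j by linarith) hα (by linarith)
        (sineCoeff (y (j + q)) - sineCoeff (y j))
      rw [zero_add] at h3
      refine h3.trans (le_trans ?_ he)
      rw [mul_comm]
      gcongr
      rw [← enorm_sub_eq_wnorm, ← ofReal_norm]
      exact ENNReal.ofReal_le_ofReal (hd3 q r hq j)
    · refine (wnorm_mono_exponent hα'.le _).trans (hd1 q r hq j t (t + r) (by linarith [hd4.2])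
        hj'.le ?_)
      rw [add_sub_cancel_left, sub_self, abs_zero]
      exact hd4.1.le
  have := norm_le_of_enorm_le (by positivity) key
  linarith

theorem IsMild.isWAlmostPeriodic (S : Setting τ b c f a C H K β γ)
    (hτ : HasUniformlyAPDifferences τ) (hb : IsAlmostPeriodicSeq b) (hc : IsAlmostPeriodicSeq c)
    (hf : IsWAlmostPeriodic τ f) (hf' : IsLocallyHolderOff τ f) (hα : 0 ≤ α) (hα' : α < 1 / 2)
    (hu : IsMild τ b c f y Y u) : IsWAlmostPeriodic τ u := by
  have hsol := hu.isImpulsiveSolution S hα hα' hf'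
  have hm := strictMono_of_gap S.gap
  refine ⟨hm, hτ, fun t ht => hsol.continuousAt t (by simp) ht,
    fun j => hsol.right_continuous _ (mem_univ _), fun j => ?_, fun ε hε => ?_, fun ε hε => ?_⟩
  · obtain ⟨v, hv, -⟩ := hsol.impulse j (by simp)
    exact ⟨v, hv⟩
  · obtain ⟨δ, hδ, h⟩ := exists_modulus S hα hα' hu (ENNReal.ofReal_pos.2 hε)
    refine ⟨δ, hδ, fun j t ht s hs hd => ?_⟩
    have := h j t (Ico_subset_Icc_self ht) s (Ico_subset_Icc_self hs) hd
    rw [← hu.coeff j t ht, ← hu.coeff j s hs, ← FracSpace.enorm_sub_eq, ← ofReal_norm] at this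
    exact (ENNReal.ofReal_lt_ofReal_iff hε).1 this
  · obtain ⟨d, hd, hd0⟩ := ((eventually_mild_compare S hf hα hα' hu hε).and
      self_mem_nhdsWithin).exists
    have hd0' : 0 < d := hd0
    obtain ⟨L, hL⟩ := exists_common_almost_periods hτ S.gap hb hc hf hd0'
    -- Since r is within d of τ_q - τ_0 and q ranges over at most L + 1 indices past j, with gaps at
    -- most H, every window of this length contains such an r.
    refine ⟨2 * d + (L.toNat + 1 : ℕ) * H, fun x => ?_⟩
    obtain ⟨j, hj, hj'⟩ := exists_index S.gap (x + τ 0 + d)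
    obtain ⟨q, hq, r, hr⟩ := hL (j + 1)
    refine ⟨r, ?_, hd q r hr⟩
    have h1 := abs_lt.1 (hr.1 0)
    rw [zero_add] at h1
    have h2 := hm.monotone hq.1
    have h3 : τ q ≤ τ (j + (L.toNat + 1 : ℕ)) := hm.monotone (by
      push_cast
      linarith [hq.2, Int.self_le_toNat L])
    have h4 := sub_le_mul_gap S.gap_le j (L.toNat + 1)
    constructor <;> linarith [h1.1, h1.2]

/-! ### Differences of solutions -/

theorem FracSpace.continuous_toL2 {α : ℝ} (hα : 0 ≤ α) :
    Continuous (FracSpace.toL2 : FracSpace α → L2Pi) := by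
  refine AddMonoidHomClass.continuous_of_bound (FracSpace.toL2 (α := α)) 1 fun u => ?_
  refine norm_le_of_enorm_le (by positivity) ?_
  rw [one_mul, ofReal_norm, FracSpace.enorm_eq, enorm_eq_wnorm]
  exact wnorm_mono_exponent hα _

theorem hasDerivAt_sineCoeff_of_satisfiesHeatAt {f u : ℝ → L2Pi} {t : ℝ}
    (h : SatisfiesHeatAt f u t) (k : ℕ) :
    HasDerivAt (fun s => sineCoeff (u s) k)
      (-((k : ℝ) + 1) ^ 2 * sineCoeff (u t) k + sineCoeff (f t) k) t := by
  obtain ⟨v, w, h0, h1, h2, hd⟩ := h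
  have := (innerSL ℝ (sineFun k)).hasFDerivAt.comp_hasDerivAt t hd
  refine this.congr_deriv ?_
  rw [← sineCoeff_second_deriv h0 h1 h2, ← sineCoeff_add]
  rfl

/-- The difference of two curves, in coefficients. -/
def coeffDiff {α : ℝ} (u v : ℝ → FracSpace α) (t : ℝ) : ℕ → ℝ :=
  sineCoeff (u t).toL2 - sineCoeff (v t).toL2

/-- `x` solves on `[t₀, ∞)` the homogeneous impulsive equation, in coefficients. -/
structure IsHomogeneous (τ b : ℤ → ℝ) (t₀ : ℝ) (x : ℝ → ℕ → ℝ) : Prop where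
  arc : ∀ s t, t₀ ≤ s → s ≤ t → (∀ j, τ j ∉ Ioc s t) → x t = heat (t - s) (x s)
  impulse : ∀ s j, t₀ ≤ s → s < τ j → (∀ i, τ i ∉ Ioo s (τ j)) →
    x (τ j) = heat (τ j - s) (x s) + b j • sinDeriv (heat (τ j - s) (x s))

theorem restrict_solution {τ b c : ℤ → ℝ} {f : ℝ → L2Pi} {α : ℝ} {u : ℝ → FracSpace α}
    (hu : IsImpulsiveSolution τ b c f univ u) (t₀ : ℝ) :
    IsImpulsiveSolution τ b c f (Ici t₀) u := by
  have hi : interior (Ici t₀) ⊆ interior univ := interior_mono (subset_univ _)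
  exact ⟨fun t _ => hu.right_continuous t trivial, fun t ht => hu.continuousAt t (hi ht),
    fun t ht => hu.equation t (hi ht), fun t ht => hu.deriv_continuousAt t (hi ht),
    fun j hj => hu.impulse j (hi hj)⟩

/-- The forcing and the fixed impulse term are common to both solutions and cancel. Between impulses
each coefficient obeys a linear scalar equation, solved with an integrating factor; at an impulse
the left limits are identified by continuity. -/
theorem isHomogeneous_coeffDiff {τ b c : ℤ → ℝ} {f : ℝ → L2Pi} {α t₀ : ℝ} (hα : 0 ≤ α)
    {u v : ℝ → FracSpace α} (hu : IsImpulsiveSolution τ b c f (Ici t₀) u)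
    (hv : IsImpulsiveSolution τ b c f (Ici t₀) v) : IsHomogeneous τ b t₀ (coeffDiff u v) := by
  have hlim : ∀ {l : Filter ℝ} {p q : FracSpace α} (k : ℕ), Tendsto u l (𝓝 p) →
      Tendsto v l (𝓝 q) → Tendsto (fun t => coeffDiff u v t k) l
        (𝓝 (sineCoeff p.toL2 k - sineCoeff q.toL2 k)) := fun k h1 h2 =>
    ((((continuous_sineCoeff k).comp (FracSpace.continuous_toL2 hα)).tendsto _).comp h1).sub
      ((((continuous_sineCoeff k).comp (FracSpace.continuous_toL2 hα)).tendsto _).comp h2)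
  have harc : ∀ s t, t₀ ≤ s → s ≤ t → (∀ j, τ j ∉ Ioc s t) →
      coeffDiff u v t = heat (t - s) (coeffDiff u v s) := by
    intro s t hs hst hτ
    rcases hst.eq_or_lt with rfl | hlt
    · simp [heat_zero]
    funext k
    have hmem : ∀ r ∈ Ioc s t, r ∈ interior (Ici t₀) ∧ r ∉ range τ := by
      rintro r hr
      refine ⟨by rw [interior_Ici]; exact hs.trans_lt hr.1, ?_⟩
      rintro ⟨j, rfl⟩
      exact hτ j hr
    have hd : ∀ r ∈ Ioc s t, HasDerivAt (fun r => coeffDiff u v r k)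
        (-((k : ℝ) + 1) ^ 2 * coeffDiff u v r k) r := by
      intro r hr
      obtain ⟨h1, h2⟩ := hmem r hr
      refine ((hasDerivAt_sineCoeff_of_satisfiesHeatAt (hu.equation r h1 h2) k).sub
        (hasDerivAt_sineCoeff_of_satisfiesHeatAt (hv.equation r h1 h2) k)).congr_deriv ?_
      simp only [coeffDiff, Pi.sub_apply]
      ring
    set g : ℝ → ℝ := fun r => exp (((k : ℝ) + 1) ^ 2 * (r - s)) * coeffDiff u v r k
    have hg : ∀ r ∈ Ioc s t, HasDerivAt g 0 r := by
      intro r hr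
      refine ((((hasDerivAt_id r).sub_const s).const_mul (((k : ℝ) + 1) ^ 2)).exp.mul
        (hd r hr)).congr_deriv ?_
      simp only [id]
      ring
    have hc : ContinuousOn g (Icc s t) := by
      intro r hr
      -- At the left end, which may be t₀ or an impulse moment, only right continuity is known.
      rcases hr.1.eq_or_lt with rfl | h
      · have h1 : ContinuousWithinAt (fun r => coeffDiff u v r k) (Ici s) s :=
          hlim k (hu.right_continuous s hs) (hv.right_continuous s hs)
        exact ((by fun_prop : Continuous fun r => exp (((k : ℝ) + 1) ^ 2 * (r - s))
          ).continuousWithinAt.mul h1).mono Icc_subset_Ici_self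
      · exact (hg r ⟨h, hr.2⟩).continuousAt.continuousWithinAt
    obtain ⟨q, -, hq⟩ := exists_hasDerivAt_eq_slope g (fun _ => 0) hlt hc
      fun r hr => hg r (Ioo_subset_Ioc_self hr)
    have h0 : g t = g s := by
      have := (div_eq_zero_iff.1 hq.symm).resolve_right (by linarith)
      linarith
    simp only [g, sub_self, mul_zero, exp_zero, one_mul] at h0
    rw [heat, ← h0, ← mul_assoc, ← exp_add, neg_add_cancel, exp_zero, one_mul]
  refine ⟨harc, fun s j hs hsj hτ => ?_⟩
  have hj : τ j ∈ interior (Ici t₀) := by rw [interior_Ici]; exact hs.trans_lt hsj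
  obtain ⟨p, hp, hp'⟩ := hu.impulse j hj
  obtain ⟨q, hq, hq'⟩ := hv.impulse j hj
  have hz : sineCoeff p.toL2 - sineCoeff q.toL2 = heat (τ j - s) (coeffDiff u v s) := by
    funext k
    refine tendsto_nhds_unique (hlim k hp hq) ?_
    have hcont : Tendsto (fun t => heat (t - s) (coeffDiff u v s) k) (𝓝[<] (τ j))
        (𝓝 (heat (τ j - s) (coeffDiff u v s) k)) := by
      have : Continuous fun t => heat (t - s) (coeffDiff u v s) k := by
        unfold heat; fun_prop
      exact (this.tendsto _).mono_left nhdsWithin_le_nhds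
    refine hcont.congr' ?_
    filter_upwards [Ioo_mem_nhdsLT hsj] with t ht
    rw [harc s t hs ht.1.le fun i hi => hτ i ⟨hi.1, hi.2.trans_lt ht.2⟩]
  rw [coeffDiff, sineCoeff_of_isImpulse hp', sineCoeff_of_isImpulse hq', jump_sub, hz]

/-! ### Decay of homogeneous solutions -/

variable {τ b c : ℤ → ℝ} {f : ℝ → L2Pi} {a C H K β γ α t₀ : ℝ} {x : ℝ → ℕ → ℝ}

theorem notMem_of_Ico {τ : ℤ → ℝ} (hm : StrictMono τ) {j : ℤ} {s t : ℝ} (hs : τ j ≤ s)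
    (ht : t < τ (j + 1)) (i : ℤ) : τ i ∉ Ioc s t := fun hi => by
  have h1 := hm.lt_iff_lt.1 (hs.trans_lt hi.1)
  have h2 := hm.lt_iff_lt.1 (hi.2.trans_lt ht)
  omega

theorem notMem_Ioo_succ {τ : ℤ → ℝ} (hm : StrictMono τ) {j : ℤ} {s : ℝ} (hs : τ j ≤ s)
    (i : ℤ) : τ i ∉ Ioo s (τ (j + 1)) := fun hi => by
  have h1 := hm.lt_iff_lt.1 (hs.trans_lt hi.1)
  have h2 := hm.lt_iff_lt.1 hi.2
  omega

theorem IsHomogeneous.arc_eq (S : Setting τ b c f a C H K β γ) (hx : IsHomogeneous τ b t₀ x)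
    {j : ℤ} (hj : t₀ ≤ τ j) {t : ℝ} (ht : τ j ≤ t) (ht' : t < τ (j + 1)) :
    x t = heat (t - τ j) (x (τ j)) :=
  hx.arc _ _ hj ht (notMem_of_Ico (strictMono_of_gap S.gap) le_rfl ht')

theorem IsHomogeneous.impulse_eq (S : Setting τ b c f a C H K β γ) (hx : IsHomogeneous τ b t₀ x)
    {j : ℤ} {s : ℝ} (hs : t₀ ≤ s) (hj : τ j ≤ s) (hj' : s < τ (j + 1)) :
    x (τ (j + 1)) = heat (τ (j + 1) - s) (x s) +
      b (j + 1) • sinDeriv (heat (τ (j + 1) - s) (x s)) :=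
  hx.impulse _ _ hs hj' (notMem_Ioo_succ (strictMono_of_gap S.gap) hj)

theorem IsHomogeneous.weighted_succ_le (S : Setting τ b c f a C H K β γ)
    (hx : IsHomogeneous τ b t₀ x) {j : ℤ} (hj : t₀ ≤ τ j) :
    ENNReal.ofReal (weight τ a (j + 1)) * wnorm 0 (x (τ (j + 1))) ≤
      ENNReal.ofReal ((1 + β) * exp (-a)) *
        (ENNReal.ofReal (weight τ a j) * wnorm 0 (x (τ j))) := by
  have hβ := S.beta_nonneg
  have hw : ∀ j, 0 ≤ weight τ a j := fun j => (exp_pos _).le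
  rw [hx.impulse_eq S hj le_rfl (by linarith [S.gap j])]
  refine (mul_le_mul_right ((wnorm_zero_impulse_le (S.b_le _) _).trans
    (mul_le_mul_right (wnorm_half_heat_le (S.gap j) _) _)) _).trans (le_of_eq ?_)
  rw [← mul_assoc, ← mul_assoc, ← mul_assoc, ← ENNReal.ofReal_mul (hw _),
    ← ENNReal.ofReal_mul (mul_nonneg (hw _) (by positivity)),
    ← ENNReal.ofReal_mul (by positivity)]
  congr 2
  have := Setting.weight_succ (τ := τ) (a := a) j
  linear_combination (1 + β) * this

/-- Iterated weighted contraction; removing the weights costs exp C at either end. -/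
theorem IsHomogeneous.wnorm_zero_le (S : Setting τ b c f a C H K β γ)
    (hx : IsHomogeneous τ b t₀ x) {j : ℤ} (hj : t₀ ≤ τ j) (n : ℕ) :
    wnorm 0 (x (τ (j + n))) ≤
      ENNReal.ofReal (exp (2 * C)) * ENNReal.ofReal ((1 + β) * exp (-a)) ^ n *
        wnorm 0 (x (τ j)) := by
  set ρ := ENNReal.ofReal ((1 + β) * exp (-a))
  have key : ENNReal.ofReal (weight τ a (j + n)) * wnorm 0 (x (τ (j + n))) ≤
      ρ ^ n * (ENNReal.ofReal (weight τ a j) * wnorm 0 (x (τ j))) := by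
    induction n with
    | zero => simp
    | succ n ih =>
      have h1 : t₀ ≤ τ (j + n) :=
        hj.trans ((strictMono_of_gap S.gap).monotone (by omega))
      have h2 := hx.weighted_succ_le S h1
      rw [Nat.cast_succ, ← add_assoc, pow_succ', mul_assoc]
      exact h2.trans (mul_le_mul_right ih _)
  have h1 : ENNReal.ofReal (exp (-C)) * wnorm 0 (x (τ (j + n))) ≤
      ρ ^ n * (ENNReal.ofReal (exp C) * wnorm 0 (x (τ j))) := by
    refine le_trans ?_ (key.trans ?_)
    · gcongr; exact (S.weight_bounds _).1
    · gcongr; exact (S.weight_bounds _).2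
  calc wnorm 0 (x (τ (j + n))) = ENNReal.ofReal (exp C) *
        (ENNReal.ofReal (exp (-C)) * wnorm 0 (x (τ (j + n)))) := by
        rw [← mul_assoc, ← ENNReal.ofReal_mul (exp_pos _).le, ← exp_add]
        simp
    _ ≤ ENNReal.ofReal (exp C) * (ρ ^ n * (ENNReal.ofReal (exp C) * wnorm 0 (x (τ j)))) := by
        gcongr
    _ = _ := by
        rw [two_mul, exp_add, ENNReal.ofReal_mul (exp_pos _).le]
        ring

theorem Setting.rate_lt_one (S : Setting τ b c f a C H K β γ) :
    ENNReal.ofReal ((1 + β) * exp (-a)) < 1 := by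
  rw [← ENNReal.ofReal_one]
  exact (ENNReal.ofReal_lt_ofReal_iff one_pos).2 S.contr

/-- Starting n impulses earlier from a bounded state gives a bound tending to zero as n grows. -/
theorem IsHomogeneous.eq_zero (S : Setting τ b c f a C H K β γ)
    (hx : ∀ t₀, IsHomogeneous τ b t₀ x) {D : ℝ≥0∞} (hD : D ≠ ⊤) (hb : ∀ t, wnorm 0 (x t) ≤ D)
    (t : ℝ) : x t = 0 := by
  have hzero : ∀ j, wnorm 0 (x (τ j)) = 0 := by
    intro j
    have hlim : Tendsto (fun n : ℕ => ENNReal.ofReal (exp (2 * C)) *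
        ENNReal.ofReal ((1 + β) * exp (-a)) ^ n * D) atTop (𝓝 0) := by
      have h1 := ENNReal.tendsto_pow_atTop_nhds_zero_of_lt_one S.rate_lt_one
      have h2 := ENNReal.Tendsto.mul_const (b := D)
        (ENNReal.Tendsto.const_mul (a := ENNReal.ofReal (exp (2 * C))) h1
          (Or.inr ENNReal.ofReal_ne_top)) (Or.inr hD)
      simpa using h2
    refine le_antisymm (ge_of_tendsto' hlim fun n => ?_) zero_le
    have := (hx (τ (j - n))).wnorm_zero_le S le_rfl n
    rw [sub_add_cancel] at this
    exact this.trans (mul_le_mul_right (hb _) _)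
  have hcoord : ∀ y : ℕ → ℝ, wnorm 0 y = 0 → y = 0 := by
    intro y hy
    funext k
    have := enorm_coord_le (β := 0) y k
    rw [hy] at this
    simpa using this
  obtain ⟨j, hj, hj'⟩ := exists_index S.gap t
  rw [(hx (τ j)).arc_eq S le_rfl hj hj', hcoord _ (hzero j)]
  funext k
  simp [heat]

/-- The initial state is measured in L² only, so the time from t₀ to the first impulse must do the
smoothing. Hence D depends on t₀ and blows up as that time shrinks. The last step is spent on
returning from L² to X^α, which is why the power is n - 1, truncated at n = 0. -/
theorem IsHomogeneous.exists_decay (S : Setting τ b c f a C H K β γ) (hα : 0 ≤ α)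
    (hα' : α < 1 / 2) {j₀ : ℤ} (hj : τ j₀ ≤ t₀) (hj' : t₀ < τ (j₀ + 1)) :
    ∃ D : ℝ≥0∞, D ≠ ⊤ ∧ ∀ x, IsHomogeneous τ b t₀ x → ∀ (n : ℕ) (t : ℝ),
      τ (j₀ + 1 + n) ≤ t → t < τ (j₀ + 1 + n + 1) →
      wnorm α (x t) ≤ D * ENNReal.ofReal ((1 + β) * exp (-a)) ^ (n - 1) * wnorm 0 (x t₀) := by
  set P := ENNReal.ofReal (1 + 2 * β)
  set Q := ENNReal.ofReal (2 * (τ (j₀ + 1) - t₀) ^ (-(α + 1 / 2)))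
  set R := ENNReal.ofReal (exp (2 * C))
  refine ⟨P * Q + P * (4 * (R * (P * Q))), by finiteness, fun x hx n t ht ht' => ?_⟩
  have hfirst : wnorm α (x (τ (j₀ + 1))) ≤ P * Q * wnorm 0 (x t₀) := by
    rw [hx.impulse_eq S le_rfl hj hj', mul_assoc]
    refine (wnorm_impulse_le (S.b_le _) hα hα'.le _).trans (mul_le_mul_right ?_ _)
    have := wnorm_heat_le (β := 0) (δ := α + 1 / 2) (sub_pos.2 hj') (by linarith) (by linarith)
      (x t₀)
    rwa [zero_add] at this
  have hm : ∀ n : ℕ, t₀ ≤ τ (j₀ + 1 + n) := fun n =>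
    hj'.le.trans ((strictMono_of_gap S.gap).monotone (by omega))
  rw [hx.arc_eq S (hm n) ht ht']
  refine (wnorm_heat_le_self (sub_nonneg.2 ht) _ _).trans ?_
  rcases n with _ | n
  · rw [Nat.cast_zero, add_zero, zero_tsub, pow_zero, mul_one]
    refine hfirst.trans ?_
    gcongr
    exact le_self_add
  · rw [Nat.cast_succ, ← add_assoc, hx.impulse_eq S (hm n) le_rfl
      (by linarith [S.gap (j₀ + 1 + n)]), Nat.add_sub_cancel]
    have h1 := hx.wnorm_zero_le S (j := j₀ + 1) hj'.le n
    calc _ ≤ P * (4 * wnorm 0 (x (τ (j₀ + 1 + n)))) :=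
          (wnorm_impulse_le (S.b_le _) hα hα'.le _).trans (mul_le_mul_right
            (wnorm_heat_le_half (S.gap _) (by linarith) (by linarith) _) _)
      _ ≤ P * (4 * (R * ENNReal.ofReal ((1 + β) * exp (-a)) ^ n *
            (P * Q * wnorm 0 (x t₀)))) := by
          gcongr
          refine h1.trans ?_
          gcongr
          exact (wnorm_mono_exponent hα _).trans hfirst
      _ = P * (4 * (R * (P * Q))) * ENNReal.ofReal ((1 + β) * exp (-a)) ^ n * wnorm 0 (x t₀) := by
          ring
      _ ≤ _ := by
          gcongr
          exact le_add_self

/-- The impulse is applied to a state known only in L²: its derivative lands in X^{-1/2}, and the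
heat flow after the impulse restores the regularity. No smoothing time before the impulse is needed.
-/
theorem wnorm_heat_impulse_le {b β η s σ : ℝ} (hb : |b| ≤ β) (hη : 0 < η) (hs : η ≤ s)
    (h0 : 0 ≤ σ) (h1 : σ ≤ 1) (z : ℕ → ℝ) :
    wnorm σ (heat s (z + b • sinDeriv z)) ≤
      (ENNReal.ofReal (2 * η ^ (-σ)) +
        ENNReal.ofReal β * (ENNReal.ofReal (2 * η ^ (-(σ + 1 / 2))) * 2)) * wnorm 0 z := by
  rw [heat_add, heat_smul, add_mul, mul_assoc, mul_assoc]
  refine (wnorm_add_le _ _ _).trans (add_le_add ?_ ?_)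
  · have := wnorm_heat_le_of_le (β := 0) hη hs h0 (by linarith) z
    rwa [zero_add] at this
  · rw [wnorm_smul, Real.enorm_eq_ofReal_abs]
    have h2 := wnorm_heat_le_of_le (β := -(1 / 2)) (δ := σ + 1 / 2) hη hs (by linarith)
      (by linarith) (sinDeriv z)
    rw [neg_add_cancel_comm_assoc] at h2
    have h3 := wnorm_sinDeriv_le_two (α := -(1 / 2)) le_rfl (by norm_num) z
    rw [neg_add_cancel] at h3
    gcongr
    exact h2.trans (mul_le_mul_right h3 _)

/-- The smoothing is taken after the first impulse, so the constant depends on η but not on how soon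
after t₀ that impulse comes. The three summands of D correspond to no impulse, exactly one, and at
least two between t₀ and t. -/
theorem IsHomogeneous.exists_uniform_bound (S : Setting τ b c f a C H K β γ) (hα : 0 ≤ α)
    (hα' : α < 1 / 2) {η : ℝ} (hη : 0 < η) :
    ∃ D : ℝ≥0∞, D ≠ ⊤ ∧ ∀ t₀ x, IsHomogeneous τ b t₀ x → ∀ t, t₀ ≤ t →
      (∀ j, η < |t - τ j|) → wnorm α (x t) ≤ D * wnorm α (x t₀) := by
  set A := ENNReal.ofReal (2 * η ^ (-α)) +
    ENNReal.ofReal β * (ENNReal.ofReal (2 * η ^ (-(α + 1 / 2))) * 2)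
  set B := ENNReal.ofReal (2 * (1 / 2) ^ (-(1 / 2 : ℝ))) +
    ENNReal.ofReal β * (ENNReal.ofReal (2 * (1 / 2 : ℝ) ^ (-(1 / 2 + 1 / 2 : ℝ))) * 2)
  set P := ENNReal.ofReal (1 + β)
  set Q := ENNReal.ofReal (2 * η ^ (-α))
  set R := ENNReal.ofReal (exp (2 * C))
  refine ⟨1 + A + Q * (R * (P * B)), by finiteness, fun t₀ x hx t ht hfar => ?_⟩
  have hmono := strictMono_of_gap S.gap
  obtain ⟨j₀, hj, hj'⟩ := exists_index S.gap t₀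
  obtain ⟨j, hjt, hjt'⟩ := exists_index S.gap t
  have hfar' : η ≤ t - τ j := by
    have := hfar j
    rw [abs_of_nonneg (sub_nonneg.2 hjt)] at this
    exact this.le
  have hle : j₀ ≤ j := by
    have := hmono.lt_iff_lt.1 (hj.trans_lt (ht.trans_lt hjt'))
    omega
  have hz : wnorm 0 (heat (τ (j₀ + 1) - t₀) (x t₀)) ≤ wnorm α (x t₀) :=
    (wnorm_heat_le_self (sub_nonneg.2 hj'.le) _ _).trans (wnorm_mono_exponent hα _)
  have hfirst := hx.impulse_eq S le_rfl hj hj'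
  rcases hle.eq_or_lt with rfl | hlt
  · rw [hx.arc _ _ le_rfl ht (notMem_of_Ico hmono hj hjt')]
    refine (wnorm_heat_le_self (sub_nonneg.2 ht) _ _).trans ?_
    refine le_mul_of_one_le_left' ?_
    rw [add_assoc]
    exact le_self_add
  have hj0 : t₀ ≤ τ j := hj'.le.trans (hmono.monotone (by omega))
  rw [hx.arc_eq S hj0 hjt hjt']
  rcases (show j₀ + 1 ≤ j by omega).eq_or_lt with rfl | hlt'
  · rw [hfirst]
    refine (wnorm_heat_impulse_le (S.b_le _) hη hfar' hα (by linarith) _).trans ?_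
    refine mul_le_mul' ?_ hz
    rw [add_right_comm]
    exact le_add_self
  · obtain ⟨n, rfl⟩ : ∃ n : ℕ, j = j₀ + 1 + 1 + n := ⟨(j - (j₀ + 1 + 1)).toNat, by omega⟩
    have h1 := wnorm_heat_le_of_le (β := 0) hη hfar' hα (by linarith) (x (τ (j₀ + 1 + 1 + n)))
    rw [zero_add] at h1
    have h2 := hx.wnorm_zero_le S (j := j₀ + 1 + 1) (hj'.le.trans (hmono.monotone (by omega))) n
    have h3 : wnorm 0 (x (τ (j₀ + 1 + 1))) ≤ P * (B * wnorm α (x t₀)) := by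
      rw [hx.impulse_eq S hj'.le le_rfl (by linarith [S.gap (j₀ + 1)]), hfirst]
      refine (wnorm_zero_impulse_le (S.b_le _) _).trans (mul_le_mul_right ?_ _)
      exact (wnorm_heat_impulse_le (S.b_le _) (by norm_num) (S.gap _) (by norm_num) (by norm_num)
        _).trans (mul_le_mul_right hz _)
    calc _ ≤ Q * (R * ENNReal.ofReal ((1 + β) * exp (-a)) ^ n * (P * (B * wnorm α (x t₀)))) :=
          h1.trans (mul_le_mul_right (h2.trans (mul_le_mul_right h3 _)) _)
      _ ≤ Q * (R * 1 * (P * (B * wnorm α (x t₀)))) := by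
          gcongr
          exact pow_le_one' S.rate_lt_one.le n
      _ = Q * (R * (P * B)) * wnorm α (x t₀) := by ring
      _ ≤ _ := by
          gcongr
          exact le_add_self

/-! ### Uniqueness and stability -/

theorem norm_lt_of_enorm_le {E F : Type*} [SeminormedAddCommGroup E] [SeminormedAddCommGroup F]
    {x : E} {y : F} {D : ℝ≥0∞} {ε : ℝ} (hD : D ≠ ⊤) (hε : 0 < ε) (h : ‖x‖ₑ ≤ D * ‖y‖ₑ)
    (hy : ‖y‖ < ε / (D.toReal + 1)) : ‖x‖ < ε := by
  have hD0 : 0 ≤ D.toReal := ENNReal.toReal_nonneg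
  have h1 : ‖x‖ ≤ D.toReal * ‖y‖ := by
    refine norm_le_of_enorm_le (by positivity) ?_
    rwa [ENNReal.ofReal_mul hD0, ENNReal.ofReal_toReal hD, ofReal_norm]
  rw [lt_div_iff₀ (by positivity)] at hy
  rcases (norm_nonneg y).eq_or_lt with h0 | h0
  · rw [← h0, mul_zero] at h1
    linarith
  · linarith

/-- Both solutions are bounded, so their difference is a bounded homogeneous solution on the whole
line. -/
theorem eq_of_isWAlmostPeriodic (S : Setting τ b c f a C H K β γ) (hα : 0 ≤ α)
    {u v : ℝ → FracSpace α} (hu : IsImpulsiveSolution τ b c f univ u)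
    (hv : IsImpulsiveSolution τ b c f univ v) (hu' : IsWAlmostPeriodic τ u)
    (hv' : IsWAlmostPeriodic τ v) : u = v := by
  obtain ⟨M, hM, hM'⟩ := exists_bound_of_isWAlmostPeriodic hu' S.gap
  obtain ⟨N, hN, hN'⟩ := exists_bound_of_isWAlmostPeriodic hv' S.gap
  have h := IsHomogeneous.eq_zero S (x := coeffDiff u v)
    (fun t₀ => isHomogeneous_coeffDiff hα (restrict_solution hu t₀) (restrict_solution hv t₀))
    (D := ENNReal.ofReal (M + N)) ENNReal.ofReal_ne_top fun t => by
      refine (wnorm_mono_exponent hα _).trans ?_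
      rw [coeffDiff, ← FracSpace.enorm_sub_eq, ← ofReal_norm]
      exact ENNReal.ofReal_le_ofReal ((norm_sub_le _ _).trans (add_le_add (hM' t) (hN' t)))
  funext t
  refine FracSpace.toL2_injective (ext_sineCoeff fun k => ?_)
  have := congrFun (h t) k
  simpa [coeffDiff, sub_eq_zero] using this

theorem isAsymptoticallyStable_of_isImpulsiveSolution (S : Setting τ b c f a C H K β γ)
    (hα : 0 ≤ α) (hα' : α < 1 / 2) {u₀ : ℝ → FracSpace α}
    (hu₀ : IsImpulsiveSolution τ b c f univ u₀) : IsAsymptoticallyStable τ b c f u₀ := by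
  have hmono := strictMono_of_gap S.gap
  have hdiff : ∀ {t₀ : ℝ} {u : ℝ → FracSpace α}, IsImpulsiveSolution τ b c f (Ici t₀) u →
      IsHomogeneous τ b t₀ (coeffDiff u u₀) := fun hu =>
    isHomogeneous_coeffDiff hα hu (restrict_solution hu₀ _)
  have hnorm : ∀ (u : ℝ → FracSpace α) (t : ℝ), ‖u t - u₀ t‖ₑ = wnorm α (coeffDiff u u₀ t) :=
    fun u t => FracSpace.enorm_sub_eq _ _
  have hnorm0 : ∀ (u : ℝ → FracSpace α) (t : ℝ),
      ‖(u t).toL2 - (u₀ t).toL2‖ₑ = wnorm 0 (coeffDiff u u₀ t) :=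
    fun u t => enorm_sub_eq_wnorm _ _
  set ρ := ENNReal.ofReal ((1 + β) * exp (-a)) with hρ
  have hρ1 : ρ < 1 := S.rate_lt_one
  -- By linearity of the difference any radius of attraction would do; 1 is taken.
  refine ⟨fun t₀ ε hε => ?_, fun ε η hε hη => ?_, fun t₀ => ⟨1, one_pos, fun ε hε => ?_⟩⟩
  · obtain ⟨j₀, hj, hj'⟩ := exists_index S.gap t₀
    obtain ⟨D, hD, h⟩ := IsHomogeneous.exists_decay S hα hα' hj hj'
    refine ⟨ε / ((1 + D).toReal + 1), by positivity, fun u hu hu0 t ht => ?_⟩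
    refine norm_lt_of_enorm_le (by finiteness) hε ?_ hu0
    rw [hnorm, hnorm]
    obtain ⟨j, hjt, hjt'⟩ := exists_index S.gap t
    have hle : j₀ ≤ j := by
      have := hmono.lt_iff_lt.1 (hj.trans_lt (ht.trans_lt hjt'))
      omega
    rcases hle.eq_or_lt with rfl | hlt
    · rw [(hdiff hu).arc _ _ le_rfl ht (notMem_of_Ico hmono hj hjt')]
      exact (wnorm_heat_le_self (sub_nonneg.2 ht) _ _).trans (le_mul_of_one_le_left' le_self_add)
    · obtain ⟨n, rfl⟩ : ∃ n : ℕ, j = j₀ + 1 + n := ⟨(j - (j₀ + 1)).toNat, by omega⟩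
      refine (h _ (hdiff hu) n t hjt hjt').trans ?_
      refine mul_le_mul' ?_ (wnorm_mono_exponent hα _)
      calc D * ρ ^ (n - 1) ≤ D * 1 := by gcongr; exact pow_le_one' hρ1.le _
        _ ≤ _ := by rw [mul_one]; exact le_add_self
  · obtain ⟨D, hD, h⟩ := IsHomogeneous.exists_uniform_bound S hα hα' hη
    refine ⟨ε / (D.toReal + 1), by positivity, fun t₀ u hu hu0 t ht hfar => ?_⟩
    refine norm_lt_of_enorm_le hD hε ?_ hu0
    rw [hnorm, hnorm]
    exact h t₀ _ (hdiff hu) t ht hfar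
  · obtain ⟨j₀, hj, hj'⟩ := exists_index S.gap t₀
    obtain ⟨D, hD, h⟩ := IsHomogeneous.exists_decay S hα hα' hj hj'
    have hlim : Tendsto (fun n : ℕ => D * ρ ^ (n - 1)) atTop (𝓝 0) := by
      have h1 := (ENNReal.tendsto_pow_atTop_nhds_zero_of_lt_one hρ1).comp (tendsto_sub_atTop_nat 1)
      simpa using ENNReal.Tendsto.const_mul h1 (Or.inr hD)
    obtain ⟨M, hM⟩ := eventually_atTop.1
      (hlim.eventually (gt_mem_nhds (ENNReal.ofReal_pos.2 hε)))
    have hM0 : t₀ < τ (j₀ + 1 + M) := hj'.trans_le (hmono.monotone (by omega))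
    refine ⟨τ (j₀ + 1 + M) - t₀, sub_pos.2 hM0, fun u hu hu0 t ht => ?_⟩
    obtain ⟨j, hjt, hjt'⟩ := exists_index S.gap t
    have hle : j₀ + 1 + M ≤ j := by
      have := hmono.lt_iff_lt.1 (show τ (j₀ + 1 + M) < τ (j + 1) by linarith)
      omega
    obtain ⟨n, rfl⟩ : ∃ n : ℕ, j = j₀ + 1 + n := ⟨(j - (j₀ + 1)).toNat, by omega⟩
    have h1 := h _ (hdiff hu) n t hjt hjt'
    rw [← hnorm, ← hnorm0] at h1
    have h2 : ‖(u t₀).toL2 - (u₀ t₀).toL2‖ₑ ≤ 1 := by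
      rw [← ofReal_norm, ← ENNReal.ofReal_one]
      exact ENNReal.ofReal_le_ofReal hu0.le
    have h3 : ‖u t - u₀ t‖ₑ < ENNReal.ofReal ε :=
      ((h1.trans (mul_le_mul_right h2 _)).trans_eq (mul_one _)).trans_lt (hM n (by omega))
    rw [← ofReal_norm] at h3
    exact (ENNReal.ofReal_lt_ofReal_iff hε).1 h3

theorem aestronglyMeasurable_of_continuousAt_off {E : Type*} [TopologicalSpace E]
    [TopologicalSpace.PseudoMetrizableSpace E] [SecondCountableTopologyEither ℝ E] {s : Set ℝ}
    (hs : s.Countable) {g : ℝ → E} (hg : ∀ t, t ∉ s → ContinuousAt g t) :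
    AEStronglyMeasurable g volume := by
  have h1 : ContinuousOn g sᶜ := fun t ht => (hg t ht).continuousWithinAt
  have h2 := h1.aestronglyMeasurable (μ := volume) hs.measurableSet.compl
  rwa [Measure.restrict_eq_self_of_ae_mem] at h2
  exact hs.ae_notMem volume

end ImpulsiveHeat
end

/-! ### The theorem -/

theorem mainTheorem6 (τ b c : ℤ → ℝ) (f : ℝ → L2Pi)
    (hτ : HasUniformlyAPDifferences τ)
    (hgap : ∀ j : ℤ, 1 / 2 ≤ τ (j + 1) - τ j)
    (hb : IsAlmostPeriodicSeq b) (hc : IsAlmostPeriodicSeq c)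
    (hf : IsWAlmostPeriodic τ f) (hf' : IsLocallyHolderOff τ f) :
    ∃ p : ℝ, HasDensity τ p ∧
      (p * Real.log (1 + ⨆ j : ℤ, |b j|) < 1 →
        ∀ α : ℝ, 0 ≤ α → α < 1 / 2 →
          ∃ u₀ : ℝ → FracSpace α,
            (IsImpulsiveSolution τ b c f univ u₀ ∧ IsWAlmostPeriodic τ u₀) ∧
            (∀ u : ℝ → FracSpace α,
              IsImpulsiveSolution τ b c f univ u → IsWAlmostPeriodic τ u → u = u₀) ∧
            IsAsymptoticallyStable τ b c f u₀) := by
  open ImpulsiveHeat in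
  obtain ⟨a, C, ha, hC, hmean⟩ := exists_mean_gap hτ hgap
  obtain ⟨H, hH⟩ := exists_gap_bound hτ hf.strictMono
  obtain ⟨K, -, hK⟩ := exists_bound_of_isWAlmostPeriodic hf hgap
  obtain ⟨B, hB⟩ := exists_bound_of_almostPeriodicSeq hb
  obtain ⟨γ, hγ⟩ := exists_bound_of_almostPeriodicSeq hc
  refine ⟨1 / a, hasDensity_of_mean_gap hgap (by linarith) hC hmean, fun hp α hα hα' => ?_⟩
  have hle : ∀ j, |b j| ≤ ⨆ j, |b j| :=
    le_ciSup (f := fun j => |b j|) ⟨B, by rintro _ ⟨j, rfl⟩; exact hB j⟩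
  have hβ : 0 ≤ ⨆ j, |b j| := (abs_nonneg _).trans (hle 0)
  have S : Setting τ b c f a C H K (⨆ j, |b j|) γ :=
    { gap := hgap
      gap_le := hH
      mean := hmean
      meas := aestronglyMeasurable_of_continuousAt_off (countable_range τ) hf.continuousAt
      bound := hK
      b_le := hle
      c_le := hγ
      contr := by
        -- With p = 1/a the hypothesis says ln(1 + b) < a, that is (1 + b) e^{-a} < 1.
        rw [one_div, inv_mul_lt_iff₀ (by linarith), mul_one,
          Real.log_lt_iff_lt_exp (by linarith)] at hp
        rw [exp_neg, ← div_eq_mul_inv, div_lt_one (exp_pos a)]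
        exact hp }
  obtain ⟨y, Y, u₀, hu⟩ := S.exists_isMild hα hα'
  have hsol := hu.isImpulsiveSolution S hα hα' hf'
  have hap := hu.isWAlmostPeriodic S hτ hb hc hf hf' hα hα'
  exact ⟨u₀, ⟨hsol, hap⟩, fun u hu hu' => eq_of_isWAlmostPeriodic S hα hu hsol hu' hap,
    isAsymptoticallyStable_of_isImpulsiveSolution S hα hα' hsol⟩
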